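/- Let $d\in\mathbb N$, $T>0$, $\mathbb T^d=\mathbb R^d/\mathbb Z^d$, let $q>1$ and $p$ be its conjugate exponent, $\frac1p+\frac1q=1$, and let $r>\max\{d(q-1),1\}$. Assume the following. 1. $f:\mathbb T^d\times[0,+\infty)\to\mathbb R$ is continuous, nondecreasing in its second variable, $f(x,0)=0$ for all $x$, and for some $C>0$, $\frac1C m^{q-1}-C\le f(x,m)\le C m^{q-1}+C$ for all $x\in\mathbb T^d$, $m\ge 0$. 2. $H:\mathbb T^d\times\mathbb R^d\to\mathbb R$ is continuous, convex and differentiable in its second variable, $D_pH$ is continuous on $\mathbb T^d\times\mathbb R^d$, and for some $C>0$, $\frac1{rC}|\xi|^r-C\le H(x,\xi)\le\frac Cr|\xi|^r+C$ for all $(x,\xi)\in\mathbb T^d\times\mathbb R^d$. 3. There are $\theta\in[0,\frac r{d+1})$ and $C>0$ with $|H(x,\xi)-H(y,\xi)|\le C|x-y|\max\{|\xi|,1\}^\theta$ for all $x,y\in\mathbb T^d$, $\xi\in\mathbb R^d$. 4. $\phi_T:\mathbb T^d\to\mathbb R$ is of class $C^1$; $m_0:\mathbb T^d\to\mathbb R$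 is continuous, $m_0\ge 0$ and $\int_{\mathbb T^d}m_0\,dx=1$. Let $F(x,m)=\int_0^m f(x,\tau)\,d\tau$ for $m\ge 0$, $F(x,m)=+\infty$ for $m<0$, and let $F^*(x,a)=\sup_{m\in\mathbb R}\{am-F(x,m)\}$. Let $\mathcal K_0$ be the set of $\phi\in C^1([0,T]\times\mathbb T^d)$ with $\phi(T,\cdot)=\phi_T$, and for $\phi\in\mathcal K_0$ set $$\mathcal A(\phi)=\int_0^T\!\!\int_{\mathbb T^d}F^*\bigl(x,-\partial_t\phi+H(x,D\phi)\bigr)\,dx\,dt-\int_{\mathbb T^d}\phi(0,x)\,m_0(x)\,dx .$$ Let $\mathcal K$ be the set of pairs $(\phi,\alpha)\in BV((0,T)\times\mathbb T^d)\times L^p((0,T)\times\mathbb T^d)$ such that $D\phi\in L^r((0,T)\times\mathbb T^d)$, $\phi(T,\cdot)=\phi_T$ in the sense of traces, and $-\partial_t\phi+H(x,D\phi)\le\alpha$ in $(0,T)\times\mathbb T^d$ in the sense of distributions. For $(\phi,\alpha)\in\mathcal K$ set $$\mathcal A(\phi,\alpha)=\int_0^T\!\!\int_{\mathbb T^d}F^*(x,\alpha(t,x))\,dx\,dt-\int_{\mathbb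 T^d}\phi(0,x)\,m_0(x)\,dx ,$$ where $\phi(0,\cdot)$ is the trace of $\phi$ at $t=0$. Here $D$ denotes the gradient in $x$. Then $$\inf_{\phi\in\mathcal K_0}\mathcal A(\phi)=\inf_{(\phi,\alpha)\in\mathcal K}\mathcal A(\phi,\alpha).$$ -/

import Mathlib

open Set Filter Topology MeasureTheory
open scoped ENNReal ContDiff

noncomputable section

namespace MFG

/-! Functions on the flat torus `ℝ^d / ℤ^d` are `ℤ^d`-periodic functions on the Euclidean space
`ℝ^d`; integrals over the torus are integrals over the unit cell `[0,1)^d`. -/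

/-- Euclidean space `ℝ^d`. -/
abbrev E (d : ℕ) : Type := EuclideanSpace ℝ (Fin d)

/-- The integer vector `k` seen as an element of `ℝ^d`. -/
def latticeVec {d : ℕ} (k : Fin d → ℤ) : E d := WithLp.toLp 2 (fun i => (k i : ℝ))

/-- `g` is a function on the torus. -/
def TorusPeriodic {d : ℕ} {β : Type*} (g : E d → β) : Prop :=
  ∀ (k : Fin d → ℤ) (x : E d), g (x + latticeVec k) = g x

/-- `u = u(t,x)` is, for each time, a function on the torus. -/
def SpacePeriodic {d : ℕ} {β : Type*} (u : ℝ × E d → β) : Prop :=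
  ∀ t : ℝ, TorusPeriodic (fun x => u (t, x))

/-- Fundamental cell `[0,1)^d` of the torus. -/
def unitCell (d : ℕ) : Set (E d) := {x | ∀ i, x i ∈ Ico (0 : ℝ) 1}

/-- Fundamental cell of `(0,T) × 𝕋^d`. -/
def spaceTime (d : ℕ) (T : ℝ) : Set (ℝ × E d) := Ioo 0 T ×ˢ unitCell d

/-- Time derivative. -/
def dt {d : ℕ} (u : ℝ × E d → ℝ) (z : ℝ × E d) : ℝ := deriv (fun t => u (t, z.2)) z.1

/-- Space gradient. -/
def Dx {d : ℕ} (u : ℝ × E d → ℝ) (z : ℝ × E d) : E d := gradient (fun x => u (z.1, x)) z.2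

/-- Space divergence. -/
def divx {d : ℕ} (Ψ : ℝ × E d → E d) (z : ℝ × E d) : ℝ :=
  ∑ i, (fderiv ℝ (fun x => Ψ (z.1, x)) z.2 (EuclideanSpace.single i 1)) i

/-! ### Assumptions on the data -/

/-- Assumptions on the coupling `f : 𝕋^d × [0,∞) → ℝ`, with growth exponent `q - 1`. Only the
values `f x m` with `m ≥ 0` matter. -/
structure CouplingAssumption {d : ℕ} (q : ℝ) (f : E d → ℝ → ℝ) : Prop where
  one_lt_q : 1 < q
  periodic : ∀ m, 0 ≤ m → TorusPeriodic (fun x => f x m)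
  continuousOn : ContinuousOn (fun y : E d × ℝ => f y.1 y.2) (univ ×ˢ Ici 0)
  monotoneOn : ∀ x, MonotoneOn (f x) (Ici 0)
  growth : ∃ C > 0, ∀ x m, 0 ≤ m →
    1 / C * m ^ (q - 1) - C ≤ f x m ∧ f x m ≤ C * m ^ (q - 1) + C
  map_zero : ∀ x, f x 0 = 0

/-- Assumptions on the Hamiltonian `H : 𝕋^d × ℝ^d → ℝ`: regularity, convexity, growth of order `r`
in the second variable, and control of the dependence on the first variable. -/
structure HamiltonianAssumption {d : ℕ} (q r : ℝ) (H : E d → E d → ℝ) : Prop where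
  r_gt : max ((d : ℝ) * (q - 1)) 1 < r
  periodic : ∀ ξ, TorusPeriodic (fun x => H x ξ)
  continuous : Continuous (fun y : E d × E d => H y.1 y.2)
  convex : ∀ x, ConvexOn ℝ univ (H x)
  differentiable : ∀ x, Differentiable ℝ (H x)
  continuous_grad : Continuous (fun y : E d × E d => gradient (H y.1) y.2)
  growth : ∃ C > 0, ∀ x ξ,
    1 / (r * C) * ‖ξ‖ ^ r - C ≤ H x ξ ∧ H x ξ ≤ C / r * ‖ξ‖ ^ r + C
  lipschitz : ∃ θ C : ℝ, 0 ≤ θ ∧ θ < r / (d + 1) ∧ 0 < C ∧ ∀ x y ξ,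
    |H x ξ - H y ξ| ≤ C * ‖x - y‖ * (max ‖ξ‖ 1) ^ θ

/-- Assumptions on the terminal value `φT` and the initial density `m₀`. -/
structure BoundaryAssumption {d : ℕ} (φT m₀ : E d → ℝ) : Prop where
  terminal_periodic : TorusPeriodic φT
  terminal_contDiff : ContDiff ℝ 1 φT
  initial_periodic : TorusPeriodic m₀
  initial_continuous : Continuous m₀
  initial_nonneg : ∀ x, 0 ≤ m₀ x
  initial_mass : ∫ x in unitCell d, m₀ x = 1

/-! ### The cost -/

/-- `F(x,m) = ∫₀^m f(x,τ) dτ` for `m ≥ 0`, and `+∞` for `m < 0`. -/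
def potential {d : ℕ} (f : E d → ℝ → ℝ) (x : E d) (m : ℝ) : EReal :=
  if 0 ≤ m then ((∫ τ in (0 : ℝ)..m, f x τ : ℝ) : EReal) else ⊤

/-- Convex conjugate `F*(x,a)` of `F(x,·)`. -/
def conjPotential {d : ℕ} (f : E d → ℝ → ℝ) (x : E d) (a : ℝ) : EReal :=
  ⨆ m : ℝ, ((a * m : ℝ) : EReal) - potential f x m

/-- `F*` is nonnegative, so that converting its values to `ℝ≥0∞` loses nothing. -/
theorem conjPotential_nonneg {d : ℕ} (f : E d → ℝ → ℝ) (x : E d) (a : ℝ) :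
    0 ≤ conjPotential f x a := by
  refine le_trans ?_ (le_iSup _ (0 : ℝ))
  simp [potential]

/-- `∫₀^T ∫ F*(x, α(t,x)) dx dt - ∫ φ₀(x) m₀(x) dx`. -/
def cost {d : ℕ} (T : ℝ) (f : E d → ℝ → ℝ) (m₀ : E d → ℝ) (α : ℝ × E d → ℝ) (φ₀ : E d → ℝ) :
    EReal :=
  ((∫⁻ z in spaceTime d T, (conjPotential f z.2 (α z)).toENNReal : ℝ≥0∞) : EReal)
    - ((∫ x in unitCell d, φ₀ x * m₀ x : ℝ) : EReal)

/-! ### The smooth problem -/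

/-- Maps of class `C¹` on `[0,T] × 𝕋^d` equal to `φT` at time `T`. -/
def K0 {d : ℕ} (T : ℝ) (φT : E d → ℝ) : Set (ℝ × E d → ℝ) :=
  {φ | SpacePeriodic φ ∧ ContDiffOn ℝ 1 φ (Icc 0 T ×ˢ univ) ∧ ∀ x, φ (T, x) = φT x}

/-- The functional `A(φ)`. -/
def smoothCost {d : ℕ} (T : ℝ) (f : E d → ℝ → ℝ) (H : E d → E d → ℝ) (m₀ : E d → ℝ)
    (φ : ℝ × E d → ℝ) : EReal :=
  cost T f m₀ (fun z => - dt φ z + H z.2 (Dx φ z)) (fun x => φ (0, x))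

/-! ### The relaxed problem -/

/-- Smooth test functions (or fields) with compact support in `(0,T) × 𝕋^d`. -/
structure IsTest {d : ℕ} {V : Type*} [NormedAddCommGroup V] [NormedSpace ℝ V] (T : ℝ)
    (ψ : ℝ × E d → V) : Prop where
  contDiff : ContDiff ℝ ∞ ψ
  periodic : SpacePeriodic ψ
  support : ∃ a b : ℝ, 0 < a ∧ b < T ∧ ∀ z, z.1 ∉ Icc a b → ψ z = 0

/-- `φ ∈ BV((0,T) × 𝕋^d)`: `φ` is integrable and has finite total variation
`sup {∫ φ (∂_t ψ + div Ψ) : (ψ, Ψ) a test field with |(ψ, Ψ)| ≤ 1}`. -/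
structure IsBV {d : ℕ} (T : ℝ) (φ : ℝ × E d → ℝ) : Prop where
  periodic : SpacePeriodic φ
  integrable : IntegrableOn φ (spaceTime d T)
  variation : ∃ C : ℝ, ∀ (ψ : ℝ × E d → ℝ) (Ψ : ℝ × E d → E d), IsTest T ψ → IsTest T Ψ →
    (∀ z, ψ z ^ 2 + ‖Ψ z‖ ^ 2 ≤ 1) →
    ∫ z in spaceTime d T, φ z * (dt ψ z + divx Ψ z) ≤ C

/-- `u ∈ L^s((0,T) × 𝕋^d)`. -/
def IsLp {d : ℕ} {V : Type*} [NormedAddCommGroup V] (T s : ℝ) (u : ℝ × E d → V) : Prop :=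
  SpacePeriodic u ∧ MemLp u (ENNReal.ofReal s) (volume.restrict (spaceTime d T))

/-- `G` is the distributional space gradient of `φ` in `(0,T) × 𝕋^d`. -/
def IsWeakGradient {d : ℕ} (T : ℝ) (φ : ℝ × E d → ℝ) (G : ℝ × E d → E d) : Prop :=
  ∀ ψ : ℝ × E d → ℝ, IsTest T ψ →
    ∫ z in spaceTime d T, φ z • Dx ψ z = - ∫ z in spaceTime d T, ψ z • G z

/-- `-∂_t φ + H(x, G) ≤ α` in the sense of distributions in `(0,T) × 𝕋^d`. -/
def IsSubsolution {d : ℕ} (T : ℝ) (H : E d → E d → ℝ) (φ : ℝ × E d → ℝ) (G : ℝ × E d → E d)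
    (α : ℝ × E d → ℝ) : Prop :=
  ∀ ψ : ℝ × E d → ℝ, IsTest T ψ → (∀ z, 0 ≤ ψ z) →
    ∫ z in spaceTime d T, (φ z * dt ψ z + H z.2 (G z) * ψ z) ≤
      ∫ z in spaceTime d T, α z * ψ z

/-- `g ∈ L¹(𝕋^d)` is the trace of `φ` at time `t₀` from the right:
`h⁻¹ ∫_{t₀}^{t₀+h} ‖φ(t,·) - g‖_{L¹} dt → 0` as `h → 0⁺`. -/
def IsTraceRight {d : ℕ} (φ : ℝ × E d → ℝ) (t₀ : ℝ) (g : E d → ℝ) : Prop :=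
  TorusPeriodic g ∧ IntegrableOn g (unitCell d) ∧
  Tendsto (fun h : ℝ =>
    (∫⁻ z in Ioo t₀ (t₀ + h) ×ˢ unitCell d, ‖φ z - g z.2‖ₑ) / ENNReal.ofReal h) (𝓝[>] 0) (𝓝 0)

/-- `g ∈ L¹(𝕋^d)` is the trace of `φ` at time `t₀` from the left. -/
def IsTraceLeft {d : ℕ} (φ : ℝ × E d → ℝ) (t₀ : ℝ) (g : E d → ℝ) : Prop :=
  TorusPeriodic g ∧ IntegrableOn g (unitCell d) ∧
  Tendsto (fun h : ℝ =>
    (∫⁻ z in Ioo (t₀ - h) t₀ ×ˢ unitCell d, ‖φ z - g z.2‖ₑ) / ENNReal.ofReal h) (𝓝[>] 0) (𝓝 0)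

open Classical in
/-- The trace `φ(0⁺,·)` (unique up to null sets; it exists for every `BV` function; the value `0`
stands for functions that have no trace). -/
def initialTrace {d : ℕ} (φ : ℝ × E d → ℝ) : E d → ℝ :=
  if h : ∃ g, IsTraceRight φ 0 g then h.choose else 0

/-- The relaxed admissible set: pairs `(φ,α) ∈ BV × L^p` with `Dφ ∈ L^r`, with trace `φT` at time
`T`, and with `-∂_t φ + H(x,Dφ) ≤ α` in the sense of distributions. -/
def K {d : ℕ} (T p r : ℝ) (H : E d → E d → ℝ) (φT : E d → ℝ) :
    Set ((ℝ × E d → ℝ) × (ℝ × E d → ℝ)) :=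
  {w | IsBV T w.1 ∧ IsLp T p w.2 ∧ IsTraceLeft w.1 T φT ∧
    ∃ G : ℝ × E d → E d, IsLp T r G ∧ IsWeakGradient T w.1 G ∧ IsSubsolution T H w.1 G w.2}

/-- The relaxed functional `A(φ,α)`. -/
def relaxedCost {d : ℕ} (T : ℝ) (f : E d → ℝ → ℝ) (m₀ : E d → ℝ)
    (w : (ℝ × E d → ℝ) × (ℝ × E d → ℝ)) : EReal :=
  cost T f m₀ w.2 (initialTrace w.1)

end MFG

end

/-!
Smooth competitors are relaxed competitors with the same cost, which gives one inequality
(`MFG.iInf_relaxedCost_le`). For the other one, a relaxed pair `(φ, α)` with spatial gradient `G` is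
approximated by smooth competitors whose cost is arbitrarily close to that of `(φ, α)`
(`MFG.exists_smoothCost_le`).

The pair is first continued past time `T` by the terminal datum, `φ = φT` and `α = H(x, ∇φT)`;
the trace condition at `T` makes this a subsolution on `(0, T + 1)`
(`MFG.weakSubsolution_extend`). It is then averaged against a kernel at scale `ε` supported at
strictly later times, so that the averages are `C¹` up to time `0` without any extension below `0`.
Averaging the inequality and using Jensen in the convex Hamiltonian costs an error coming from the
dependence of `H` on `x`. Since an average of `G ∈ L^r` at scale `ε` is at most of order
`ε^{-(d+1)/r}`, and `|H(x,ξ) - H(y,ξ)|` is at most `C |x - y| max(|ξ|,1)^θ` with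
`θ < r / (d + 1)`, this error is `O(ε^κ)` with `κ > 0` (`MFG.exists_hamiltonian_avg_le`).

At time `T` the average differs slightly from `φT` in `C¹`. The competitor is the average multiplied
by `1 - l`, plus a time-independent correction restoring the value `φT`; convexity of `H` absorbs
the correction into the fraction `l` (`MFG.WeakSubsolution.competitor_le`). The conjugate `F*` is
convex, nondecreasing and of growth `p`, and averages of `α` converge in `L^p`, so the running cost
increases by `O(l)` only (`MFG.lintegral_conjPotential_le`).

For the initial term, subsolutions satisfy `∂_t φ ≥ -β` with `β` integrable, because `H` is bounded
below. Increments of the averages in time are therefore nonnegative up to a small error, and their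
`L¹` norm is controlled by the variation of the total mass; the mass is bounded below near time `0`
since `φ` is of bounded variation. Hence the averages at time `0` converge in `L¹`, and their limit
is the trace of `φ` (`MFG.WeakSubsolution.exists_trace`).

The torus is handled through the measure `MFG.cyl d` on the fundamental domain `ℝ × [0,1)^d`, whose
integrals of periodic functions are invariant under translations.
-/


namespace MFG

open scoped Pointwise

/-! ### Periodic functions and the measure on the cylinder `ℝ × 𝕋^d` -/

variable {d : ℕ}

instance : (volume : Measure (ℝ × E d)).IsAddHaarMeasure :=
  inferInstanceAs (((volume : Measure ℝ).prod (volume : Measure (E d))).IsAddHaarMeasure)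

@[simp] lemma latticeVec_apply (k : Fin d → ℤ) (i : Fin d) : latticeVec k i = k i := rfl

lemma latticeVec_zero : latticeVec (0 : Fin d → ℤ) = 0 := by
  ext i; simp

lemma latticeVec_add (k l : Fin d → ℤ) : latticeVec (k + l) = latticeVec k + latticeVec l := by
  ext i; simp

lemma latticeVec_neg (k : Fin d → ℤ) : latticeVec (-k) = -latticeVec k := by
  ext i; simp

/-- Coordinatewise integer part. -/
noncomputable def floorVec (x : E d) : Fin d → ℤ := fun i => ⌊x i⌋

lemma sub_floorVec_mem (x : E d) : x + latticeVec (-floorVec x) ∈ unitCell d := by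
  intro i
  have : (x + latticeVec (-floorVec x)) i = Int.fract (x i) := by
    simp [floorVec, Int.fract, sub_eq_add_neg]
  rw [this]
  exact ⟨Int.fract_nonneg _, Int.fract_lt_one _⟩

lemma eq_neg_floorVec_of_mem {x : E d} {k : Fin d → ℤ} (h : x + latticeVec k ∈ unitCell d) :
    k = -floorVec x := by
  funext i
  have h1 := h i
  have h2 : (x + latticeVec k) i = x i + k i := by simp
  rw [h2] at h1
  have : ⌊x i + k i⌋ = 0 := Int.floor_eq_zero_iff.2 h1
  rw [Int.floor_add_intCast] at this
  simp only [Pi.neg_apply, floorVec]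
  omega

lemma measurableSet_unitCell : MeasurableSet (unitCell d) := by
  have : unitCell d = ⋂ i, (fun x : E d => x i) ⁻¹' Ico (0 : ℝ) 1 := by
    ext x; simp [unitCell]
  rw [this]
  refine MeasurableSet.iInter fun i => ?_
  exact (by fun_prop : Measurable (fun x : E d => x i)) measurableSet_Ico

/-- The closed unit cube `[0,1]^d`. -/
def closedCell (d : ℕ) : Set (E d) := {x | ∀ i, x i ∈ Icc (0 : ℝ) 1}

lemma unitCell_subset_closedCell : unitCell d ⊆ closedCell d := fun _ hx i =>
  ⟨(hx i).1, (hx i).2.le⟩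

lemma isCompact_closedCell : IsCompact (closedCell d) := by
  have h : IsCompact (Set.pi univ fun _ : Fin d => Icc (0 : ℝ) 1) :=
    isCompact_univ_pi fun _ => isCompact_Icc
  have h2 : closedCell d = (PiLp.homeomorph 2 (fun _ : Fin d => ℝ)) ⁻¹'
      (Set.pi univ fun _ : Fin d => Icc (0 : ℝ) 1) := by
    ext x; simp [closedCell, PiLp.homeomorph, Pi.le_def, forall_and]
  rw [h2]
  exact (Homeomorph.isCompact_preimage _).2 h

lemma volume_unitCell_lt_top : volume (unitCell d) < ⊤ :=
  (measure_mono unitCell_subset_closedCell).trans_lt isCompact_closedCell.measure_lt_top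

/-- The lattice `{0} × ℤ^d` of periods in space-time. -/
def lattice (d : ℕ) : AddSubgroup (ℝ × E d) where
  carrier := range fun k : Fin d → ℤ => ((0 : ℝ), latticeVec k)
  zero_mem' := ⟨0, by simp [latticeVec_zero]⟩
  add_mem' := by
    rintro _ _ ⟨k, rfl⟩ ⟨l, rfl⟩
    exact ⟨k + l, by simp [latticeVec_add]⟩
  neg_mem' := by
    rintro _ ⟨k, rfl⟩
    exact ⟨-k, by simp [latticeVec_neg]⟩

instance : Countable (lattice d) :=
  (Set.countable_range fun k : Fin d → ℤ => ((0 : ℝ), latticeVec k)).to_subtype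

/-- Lebesgue measure on `ℝ × 𝕋^d`, realised on the fundamental domain `ℝ × [0,1)^d`. -/
noncomputable def cyl (d : ℕ) : Measure (ℝ × E d) := volume.restrict (univ ×ˢ unitCell d)

instance : SigmaFinite (cyl d) := by unfold cyl; infer_instance

lemma cyl_eq_prod : cyl d = (volume : Measure ℝ).prod (volume.restrict (unitCell d)) := by
  rw [cyl, Measure.volume_eq_prod, ← Measure.prod_restrict, Measure.restrict_univ]

lemma measurableSet_slab : MeasurableSet ((univ : Set ℝ) ×ˢ unitCell d) :=
  MeasurableSet.univ.prod measurableSet_unitCell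

lemma isAddFundamentalDomain_slab :
    IsAddFundamentalDomain (lattice d) ((univ : Set ℝ) ×ˢ unitCell d) volume := by
  refine IsAddFundamentalDomain.mk' measurableSet_slab.nullMeasurableSet fun z => ?_
  refine ⟨⟨(0, latticeVec (-floorVec z.2)), ⟨_, rfl⟩⟩, ?_, ?_⟩
  · refine ⟨mem_univ _, ?_⟩
    change latticeVec (-floorVec z.2) + z.2 ∈ unitCell d
    rw [add_comm]
    exact sub_floorVec_mem z.2
  · rintro ⟨_, ⟨k, rfl⟩⟩ h
    have h' : z.2 + latticeVec k ∈ unitCell d := by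
      rw [add_comm]; exact h.2
    exact Subtype.ext (by rw [eq_neg_floorVec_of_mem h'])

variable {β : Type*}

lemma SpacePeriodic.apply_add {u : ℝ × E d → β} (hu : SpacePeriodic u) (k : Fin d → ℤ)
    (z : ℝ × E d) : u (z.1, z.2 + latticeVec k) = u z := hu z.1 k z.2

lemma SpacePeriodic.vadd {u : ℝ × E d → β} (hu : SpacePeriodic u) (g : lattice d)
    (z : ℝ × E d) : u (g +ᵥ z) = u z := by
  obtain ⟨_, ⟨k, rfl⟩⟩ := g
  have : ((⟨(0, latticeVec k), ⟨k, rfl⟩⟩ : lattice d) +ᵥ z) = (z.1, z.2 + latticeVec k) := by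
    refine Prod.ext (zero_add _) (add_comm _ _)
  rw [this, hu.apply_add]

lemma SpacePeriodic.comp_add {u : ℝ × E d → β} (hu : SpacePeriodic u) (w : ℝ × E d) :
    SpacePeriodic fun z => u (z + w) := by
  intro t k x
  have h := hu (t + w.1) k (x + w.2)
  rw [add_right_comm] at h
  exact h

lemma SpacePeriodic.comp {γ : Type*} {u : ℝ × E d → β} (hu : SpacePeriodic u) (g : β → γ) :
    SpacePeriodic fun z => g (u z) := fun t k x => congrArg g (hu t k x)

lemma SpacePeriodic.comp₂ {γ δ : Type*} {u : ℝ × E d → β} {v : ℝ × E d → γ}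
    (hu : SpacePeriodic u) (hv : SpacePeriodic v) (g : β → γ → δ) :
    SpacePeriodic fun z => g (u z) (v z) := fun t k x => by
  have h1 := hu t k x
  have h2 := hv t k x
  simp only at h1 h2 ⊢
  rw [h1, h2]

lemma TorusPeriodic.spacePeriodic {g : E d → β} (hg : TorusPeriodic g) :
    SpacePeriodic fun z : ℝ × E d => g z.2 := fun _ k x => hg k x

lemma isAddFundamentalDomain_slab_vadd (w : ℝ × E d) :
    IsAddFundamentalDomain (lattice d) (w +ᵥ ((univ : Set ℝ) ×ˢ unitCell d)) volume :=
  isAddFundamentalDomain_slab.vadd_of_comm w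

lemma vadd_slab_eq_preimage (w : ℝ × E d) (s : Set (ℝ × E d)) :
    w +ᵥ s = (fun z => z + w) '' s := by
  simp only [← image_vadd, vadd_eq_add, add_comm w]

lemma integral_cyl_add {V : Type*} [NormedAddCommGroup V] [NormedSpace ℝ V] {u : ℝ × E d → V}
    (hu : SpacePeriodic u) (w : ℝ × E d) :
    ∫ z, u (z + w) ∂cyl d = ∫ z, u z ∂cyl d := by
  rw [cyl, isAddFundamentalDomain_slab.setIntegral_eq (isAddFundamentalDomain_slab_vadd w)
    hu.vadd, vadd_slab_eq_preimage]
  exact ((measurePreserving_add_right volume w).setIntegral_image_emb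
    (measurableEmbedding_addRight w) _ _).symm

lemma aestronglyMeasurable_volume_of_cyl {V : Type*} [NormedAddCommGroup V] {u : ℝ × E d → V}
    (hu : SpacePeriodic u) (hm : AEStronglyMeasurable u (cyl d)) :
    AEStronglyMeasurable u volume := by
  have hcover : (⋃ k : Fin d → ℤ, (((0 : ℝ), latticeVec k) : ℝ × E d) +ᵥ
      ((univ : Set ℝ) ×ˢ unitCell d)) = univ := by
    refine eq_univ_of_forall fun z => mem_iUnion.2 ⟨floorVec z.2, ?_⟩
    rw [vadd_slab_eq_preimage]
    refine ⟨(z.1, z.2 + latticeVec (-floorVec z.2)), ⟨mem_univ _, sub_floorVec_mem _⟩, ?_⟩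
    simp [latticeVec_neg]
  rw [← Measure.restrict_univ (μ := volume), ← hcover]
  refine (aestronglyMeasurable_iUnion_iff).2 fun k => ?_
  exact (isAddFundamentalDomain_slab.aestronglyMeasurable_on_iff
    (isAddFundamentalDomain_slab_vadd _) hu.vadd).1 hm

lemma integrable_cyl_add {V : Type*} [NormedAddCommGroup V] [NormedSpace ℝ V] {u : ℝ × E d → V}
    (hu : SpacePeriodic u) (hi : Integrable u (cyl d)) (w : ℝ × E d) :
    Integrable (fun z => u (z + w)) (cyl d) := by
  have h := (isAddFundamentalDomain_slab.integrableOn_iff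
    (isAddFundamentalDomain_slab_vadd w) hu.vadd).1 hi
  rw [vadd_slab_eq_preimage] at h
  exact ((measurePreserving_add_right volume w).integrableOn_image
    (measurableEmbedding_addRight w)).1 h

/-- A periodic function, continuous on a closed time slab, is bounded there. -/
lemma SpacePeriodic.exists_bound {V : Type*} [NormedAddCommGroup V] {u : ℝ × E d → V}
    (hu : SpacePeriodic u) {a b : ℝ} (hc : ContinuousOn u (Icc a b ×ˢ univ)) :
    ∃ C, 0 ≤ C ∧ ∀ z : ℝ × E d, z.1 ∈ Icc a b → ‖u z‖ ≤ C := by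
  have hK : IsCompact (Icc a b ×ˢ closedCell d) := isCompact_Icc.prod isCompact_closedCell
  obtain ⟨C, hC⟩ := hK.exists_bound_of_continuousOn
    (hc.mono (prod_mono Subset.rfl (subset_univ _)))
  refine ⟨max C 0, le_max_right _ _, fun z hz => ?_⟩
  rw [← hu.apply_add (-floorVec z.2) z]
  exact (hC (z.1, z.2 + latticeVec (-floorVec z.2))
    ⟨hz, unitCell_subset_closedCell (sub_floorVec_mem z.2)⟩).trans (le_max_left _ _)

lemma TorusPeriodic.exists_bound {V : Type*} [NormedAddCommGroup V] {g : E d → V}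
    (hg : TorusPeriodic g) (hc : Continuous g) : ∃ C, 0 ≤ C ∧ ∀ x, ‖g x‖ ≤ C := by
  obtain ⟨C, h0, hC⟩ := hg.spacePeriodic.exists_bound (a := 0) (b := 0)
    (hc.comp continuous_snd).continuousOn
  exact ⟨C, h0, fun x => hC (0, x) (by simp)⟩

/-- Distance to the lattice: `y` is within `ε` of an integer vector. -/
def NearLattice (ε : ℝ) (y : E d) : Prop := ∃ k : Fin d → ℤ, ‖y + latticeVec k‖ ≤ ε

lemma TorusPeriodic.uniform {V : Type*} [NormedAddCommGroup V] {g : E d → V}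
    (hg : TorusPeriodic g) (hc : Continuous g) {δ : ℝ} (hδ : 0 < δ) :
    ∃ ε > 0, ∀ x y : E d, NearLattice ε y → ‖g (x + y) - g x‖ ≤ δ := by
  have h := isCompact_closedCell (d := d) |>.uniformContinuousAt_of_continuousAt g
    (fun a _ => hc.continuousAt) (Metric.dist_mem_uniformity hδ)
  obtain ⟨ε, hε, h⟩ := Metric.mem_uniformity_dist.1 h
  refine ⟨ε / 2, by positivity, fun x y ⟨k, hk⟩ => ?_⟩
  have h1 := h (a := x + latticeVec (-floorVec x))
    (b := x + latticeVec (-floorVec x) + (y + latticeVec k))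
    (by rw [dist_self_add_right]; linarith)
    (unitCell_subset_closedCell (sub_floorVec_mem x))
  have h2 : x + latticeVec (-floorVec x) + (y + latticeVec k)
      = x + y + latticeVec (-floorVec x + k) := by rw [latticeVec_add]; abel
  rw [h2] at h1
  have h1' : dist (g (x + latticeVec (-floorVec x))) (g (x + y + latticeVec (-floorVec x + k))) < δ :=
    h1
  rw [hg, hg, dist_comm, dist_eq_norm] at h1'
  exact h1'.le

end MFG

namespace MFG

/-! ### A one-sided mollifier on the cylinder -/

variable {d : ℕ}

/-- Smooth step in time: `0` for `s ≤ ε/2` and `1` for `s ≥ ε`. -/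
noncomputable def timeStep (ε s : ℝ) : ℝ := Real.smoothTransition (2 * s / ε - 1)

/-- Probability density on the line, supported in `[ε/2, ε]`. -/
noncomputable def timeKernel (ε s : ℝ) : ℝ := deriv (timeStep ε) s

lemma contDiff_timeStep (ε : ℝ) : ContDiff ℝ ∞ (timeStep ε) := by
  unfold timeStep
  exact Real.smoothTransition.contDiff.comp (by fun_prop)

lemma hasDerivAt_timeStep (ε s : ℝ) : HasDerivAt (timeStep ε) (timeKernel ε s) s :=
  ((contDiff_timeStep ε).differentiable (by simp) s).hasDerivAt

lemma contDiff_timeKernel (ε : ℝ) : ContDiff ℝ ∞ (timeKernel ε) := by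
  have : ContDiff ℝ (((⊤ : ℕ∞) : ℕ∞ω) + 1) (timeStep ε) := by simpa using contDiff_timeStep ε
  exact (contDiff_succ_iff_deriv.1 this).2.2

lemma timeStep_nonneg (ε s : ℝ) : 0 ≤ timeStep ε s := Real.smoothTransition.nonneg _

lemma timeStep_le_one (ε s : ℝ) : timeStep ε s ≤ 1 := Real.smoothTransition.le_one _

lemma timeStep_eq_zero {ε s : ℝ} (hε : 0 < ε) (hs : s ≤ ε / 2) : timeStep ε s = 0 := by
  refine Real.smoothTransition.zero_of_nonpos ?_
  have : 2 * s / ε ≤ 1 := by rw [div_le_one hε]; linarith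
  linarith

lemma timeStep_eq_one {ε s : ℝ} (hε : 0 < ε) (hs : ε ≤ s) : timeStep ε s = 1 := by
  refine Real.smoothTransition.one_of_one_le ?_
  have : 2 ≤ 2 * s / ε := by rw [le_div_iff₀ hε]; linarith
  linarith

lemma monotone_timeStep {ε : ℝ} (hε : 0 < ε) : Monotone (timeStep ε) := by
  intro s t hst
  refine Real.smoothTransition.monotone ?_
  gcongr

lemma timeKernel_nonneg {ε : ℝ} (hε : 0 < ε) (s : ℝ) : 0 ≤ timeKernel ε s :=
  (monotone_timeStep hε).deriv_nonneg

lemma timeKernel_eq_zero {ε s : ℝ} (hε : 0 < ε) (hs : s ∉ Icc (ε / 2) ε) : timeKernel ε s = 0 := by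
  rw [mem_Icc, not_and_or, not_le, not_le] at hs
  rcases hs with hs | hs
  · have : timeStep ε =ᶠ[𝓝 s] fun _ => 0 := by
      filter_upwards [Iio_mem_nhds hs] with x hx using timeStep_eq_zero hε (le_of_lt hx)
    rw [timeKernel, this.deriv_eq, deriv_const]
  · have : timeStep ε =ᶠ[𝓝 s] fun _ => 1 := by
      filter_upwards [Ioi_mem_nhds hs] with x hx using timeStep_eq_one hε (le_of_lt hx)
    rw [timeKernel, this.deriv_eq, deriv_const]

lemma hasCompactSupport_timeKernel {ε : ℝ} (hε : 0 < ε) : HasCompactSupport (timeKernel ε) :=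
  HasCompactSupport.intro isCompact_Icc fun _ hx => timeKernel_eq_zero hε hx

lemma timeKernel_eq (ε s : ℝ) :
    timeKernel ε s = 2 / ε * deriv Real.smoothTransition (2 * s / ε - 1) := by
  have h1 : HasDerivAt (fun s : ℝ => 2 * s / ε - 1) (2 / ε) s := by
    have := (((hasDerivAt_id s).const_mul 2).div_const ε).sub_const 1
    simpa using this
  have h2 : HasDerivAt Real.smoothTransition (deriv Real.smoothTransition (2 * s / ε - 1))
      (2 * s / ε - 1) :=
    (((Real.smoothTransition.contDiff (n := 1)).differentiable (by simp)) _).hasDerivAt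
  have h3 := h2.comp s h1
  rw [mul_comm]
  exact h3.deriv

lemma exists_timeKernel_le : ∃ L > 0, ∀ ε > 0, ∀ s, timeKernel ε s ≤ L / ε := by
  have hc : Continuous (timeKernel 1) := (contDiff_timeKernel 1).continuous
  obtain ⟨C, hC⟩ := (hasCompactSupport_timeKernel one_pos).exists_bound_of_continuous hc
  refine ⟨max C 1, by positivity, fun ε hε s => ?_⟩
  have h : timeKernel ε s = timeKernel 1 (s / ε) / ε := by
    rw [timeKernel_eq, timeKernel_eq]
    have : 2 * s / ε - 1 = 2 * (s / ε) / 1 - 1 := by ring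
    rw [this]; ring
  rw [h]
  gcongr
  exact (le_abs_self _).trans ((hC _).trans (le_max_left _ _))

lemma integrable_timeKernel {ε : ℝ} (hε : 0 < ε) : Integrable (timeKernel ε) :=
  (contDiff_timeKernel ε).continuous.integrable_of_hasCompactSupport
    (hasCompactSupport_timeKernel hε)

lemma integral_timeKernel {ε : ℝ} (hε : 0 < ε) : ∫ s, timeKernel ε s = 1 := by
  have := integral_of_hasDerivAt_of_tendsto (hasDerivAt_timeStep ε) (integrable_timeKernel hε)
    (m := 0) (n := 1) (tendsto_const_nhds.congr' ?_) (tendsto_const_nhds.congr' ?_)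
  · simpa using this
  · filter_upwards [eventually_le_atBot (ε / 2)] with s hs using (timeStep_eq_zero hε hs).symm
  · filter_upwards [eventually_ge_atTop ε] with s hs using (timeStep_eq_one hε hs).symm

/-- Unnormalised smooth periodic bump in space. The sum of squared sines is comparable to the
squared distance to the lattice `ℤ^d`. -/
noncomputable def spaceBump (ε : ℝ) (y : E d) : ℝ :=
  Real.smoothTransition (2 - (∑ i, Real.sin (Real.pi * y i) ^ 2) / ε ^ 2)

/-- Smooth periodic probability density on the torus, supported near the lattice. -/
noncomputable def spaceKernel (ε : ℝ) (y : E d) : ℝ :=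
  spaceBump ε y / ∫ x in unitCell d, spaceBump ε x

lemma contDiff_spaceBump (ε : ℝ) : ContDiff ℝ ∞ (spaceBump (d := d) ε) := by
  unfold spaceBump
  refine Real.smoothTransition.contDiff.comp ?_
  refine contDiff_const.sub (ContDiff.div_const (ContDiff.sum fun i _ => ?_) _)
  exact (Real.contDiff_sin.comp (contDiff_const.mul (by fun_prop))).pow 2

lemma spaceBump_nonneg (ε : ℝ) (y : E d) : 0 ≤ spaceBump ε y := Real.smoothTransition.nonneg _

lemma spaceBump_periodic (ε : ℝ) : TorusPeriodic (spaceBump (d := d) ε) := by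
  intro k x
  unfold spaceBump
  congr 3
  refine Finset.sum_congr rfl fun i _ => ?_
  have : Real.pi * (x + latticeVec k) i = Real.pi * x i + k i * Real.pi := by
    simp; ring
  rw [this, Real.sin_add_int_mul_pi, mul_pow]
  have : ((-1 : ℝ) ^ (k i)) ^ 2 = 1 := by
    rw [← zpow_natCast, ← zpow_mul, mul_comm, zpow_mul]; simp
  rw [this, one_mul]

lemma spaceBump_eq_one {ε : ℝ} (hε : 0 < ε) {y : E d}
    (hy : ∑ i, Real.sin (Real.pi * y i) ^ 2 ≤ ε ^ 2) : spaceBump ε y = 1 := by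
  refine Real.smoothTransition.one_of_one_le ?_
  have : (∑ i, Real.sin (Real.pi * y i) ^ 2) / ε ^ 2 ≤ 1 := by
    rw [div_le_one (by positivity)]; exact hy
  linarith

lemma two_mul_abs_sub_round_le_abs_sin (a : ℝ) :
    2 * |a - round a| ≤ |Real.sin (Real.pi * a)| := by
  have h1 : |a - round a| ≤ 1 / 2 := abs_sub_round a
  have h2 : |Real.pi * (a - round a)| ≤ Real.pi / 2 := by
    rw [abs_mul, abs_of_pos Real.pi_pos]; nlinarith [Real.pi_pos]
  have h3 := Real.mul_abs_le_abs_sin h2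
  have h4 : Real.sin (Real.pi * (a - round a)) = (-1) ^ (round a) * Real.sin (Real.pi * a) := by
    rw [← Real.sin_sub_int_mul_pi]; congr 1; ring
  rw [h4, abs_mul, abs_of_pos Real.pi_pos, abs_mul, abs_zpow, abs_neg, abs_one, one_zpow,
    one_mul] at h3
  calc 2 * |a - round a| = 2 / Real.pi * (Real.pi * |a - round a|) := by
        field_simp
    _ ≤ _ := h3

lemma nearLattice_of_spaceBump_ne_zero {ε : ℝ} (hε : 0 < ε) {y : E d} (hy : spaceBump ε y ≠ 0) :
    NearLattice ε y := by
  have h1 : ∑ i, Real.sin (Real.pi * y i) ^ 2 < 2 * ε ^ 2 := by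
    by_contra! h
    refine hy (Real.smoothTransition.zero_of_nonpos ?_)
    have : 2 ≤ (∑ i, Real.sin (Real.pi * y i) ^ 2) / ε ^ 2 := by
      rw [le_div_iff₀ (by positivity)]; exact h
    linarith
  refine ⟨fun i => -round (y i), ?_⟩
  have h2 : ‖y + latticeVec (fun i => -round (y i))‖ ^ 2 ≤ ε ^ 2 := by
    rw [EuclideanSpace.norm_sq_eq]
    have h3 : ∀ i, 4 * ‖(y + latticeVec (fun i => -round (y i))) i‖ ^ 2
        ≤ Real.sin (Real.pi * y i) ^ 2 := by
      intro i
      have h5 := two_mul_abs_sub_round_le_abs_sin (y i)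
      have h6 : (y + latticeVec (fun i => -round (y i))) i = y i - round (y i) := by
        simp [sub_eq_add_neg]
      rw [h6, Real.norm_eq_abs, ← sq_abs (Real.sin _)]
      nlinarith [abs_nonneg (y i - round (y i))]
    have h4 := Finset.sum_le_sum fun i (_ : i ∈ Finset.univ) => h3 i
    rw [← Finset.mul_sum] at h4
    nlinarith [sq_nonneg ε]
  exact le_of_sq_le_sq h2 hε.le

lemma le_integral_spaceBump {ε : ℝ} (hε : 0 < ε) (hε1 : ε ≤ 1) :
    (ε / (Real.pi * (d + 1))) ^ d ≤ ∫ x in unitCell d, spaceBump ε x := by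
  set δ := ε / (Real.pi * (d + 1)) with hδ
  have hd : (0 : ℝ) ≤ d := Nat.cast_nonneg d
  have hδ0 : 0 < δ := by positivity
  have hδ1 : δ ≤ 1 := by
    rw [hδ, div_le_one (by positivity)]
    nlinarith [Real.pi_gt_three]
  have hpre : (@WithLp.ofLp 2 (Fin d → ℝ)) ⁻¹' (Set.pi univ fun _ => Ico 0 δ) ⊆ unitCell d := by
    intro x hx i
    have := hx i (mem_univ i)
    exact ⟨this.1, this.2.trans_le hδ1⟩
  have hvol : volume ((@WithLp.ofLp 2 (Fin d → ℝ)) ⁻¹' (Set.pi univ fun _ => Ico 0 δ))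
      = ENNReal.ofReal (δ ^ d) := by
    rw [(PiLp.volume_preserving_ofLp (Fin d)).measure_preimage
      (MeasurableSet.univ_pi fun _ => measurableSet_Ico).nullMeasurableSet, Real.volume_pi_Ico]
    simp [ENNReal.ofReal_pow hδ0.le]
  have hint : IntegrableOn (spaceBump (d := d) ε) (unitCell d) :=
    ((contDiff_spaceBump ε).continuous.continuousOn.integrableOn_compact isCompact_closedCell).mono_set
      unitCell_subset_closedCell
  have hone : ∀ x ∈ (@WithLp.ofLp 2 (Fin d → ℝ)) ⁻¹' (Set.pi univ fun _ => Ico 0 δ),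
      spaceBump ε x = 1 := by
    intro x hx
    refine spaceBump_eq_one hε ?_
    have h1 : ∀ i, Real.sin (Real.pi * x i) ^ 2 ≤ (Real.pi * δ) ^ 2 := by
      intro i
      have h2 := hx i (mem_univ i)
      rw [← sq_abs]
      have h3 : |Real.sin (Real.pi * x i)| ≤ Real.pi * δ := by
        refine (Real.abs_sin_le_abs).trans ?_
        have : 0 ≤ Real.pi * x i := mul_nonneg Real.pi_pos.le h2.1
        rw [abs_of_nonneg this]
        exact mul_le_mul_of_nonneg_left h2.2.le Real.pi_pos.le
      exact pow_le_pow_left₀ (abs_nonneg _) h3 2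
    refine (Finset.sum_le_sum fun i _ => h1 i).trans ?_
    have h4 : Real.pi * δ = ε / (d + 1) := by
      rw [hδ]; field_simp
    rw [h4, Finset.sum_const, Finset.card_univ, Fintype.card_fin, nsmul_eq_mul, div_pow,
      ← mul_div_assoc, div_le_iff₀ (by positivity), mul_comm]
    have : (d : ℝ) ≤ (d + 1) ^ 2 := by nlinarith
    exact mul_le_mul_of_nonneg_left this (by positivity)
  have hm : MeasurableSet ((@WithLp.ofLp 2 (Fin d → ℝ)) ⁻¹' (Set.pi univ fun _ => Ico 0 δ)) :=
    (PiLp.volume_preserving_ofLp (Fin d)).measurable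
      (MeasurableSet.univ_pi fun _ => measurableSet_Ico)
  calc δ ^ d = ∫ x in (@WithLp.ofLp 2 (Fin d → ℝ)) ⁻¹' (Set.pi univ fun _ => Ico 0 δ),
        spaceBump ε x := by
        rw [setIntegral_congr_fun hm hone, setIntegral_const, Measure.real, hvol,
          ENNReal.toReal_ofReal (by positivity)]
        simp
    _ ≤ _ := setIntegral_mono_set hint (ae_of_all _ (spaceBump_nonneg ε))
        (LE.le.eventuallyLE hpre)

lemma integral_spaceBump_pos {ε : ℝ} (hε : 0 < ε) (hε1 : ε ≤ 1) :
    0 < ∫ x in unitCell d, spaceBump ε x := by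
  refine lt_of_lt_of_le ?_ (le_integral_spaceBump hε hε1)
  have := Real.pi_pos
  positivity

lemma spaceBump_le_one (ε : ℝ) (y : E d) : spaceBump ε y ≤ 1 := Real.smoothTransition.le_one _

lemma spaceKernel_nonneg (ε : ℝ) (y : E d) : 0 ≤ spaceKernel ε y :=
  div_nonneg (spaceBump_nonneg _ _) (integral_nonneg fun _ => spaceBump_nonneg _ _)

lemma spaceKernel_le {ε : ℝ} (hε : 0 < ε) (hε1 : ε ≤ 1) (y : E d) :
    spaceKernel ε y ≤ (Real.pi * (d + 1)) ^ d / ε ^ d := by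
  have h := le_integral_spaceBump (d := d) hε hε1
  have hpi := Real.pi_pos
  rw [div_pow] at h
  calc spaceKernel ε y ≤ 1 / (ε ^ d / (Real.pi * (d + 1)) ^ d) := by
        unfold spaceKernel
        exact div_le_div₀ zero_le_one (spaceBump_le_one _ _) (by positivity) h
    _ = _ := one_div_div _ _

/-- The mollifying kernel on `ℝ × 𝕋^d`. -/
noncomputable def kern (ε : ℝ) (w : ℝ × E d) : ℝ := timeKernel ε w.1 * spaceKernel ε w.2

lemma contDiff_kern (ε : ℝ) : ContDiff ℝ ∞ (kern (d := d) ε) :=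
  ((contDiff_timeKernel ε).comp contDiff_fst).mul
    (((contDiff_spaceBump ε).div_const _).comp contDiff_snd)

lemma kern_nonneg {ε : ℝ} (hε : 0 < ε) (w : ℝ × E d) : 0 ≤ kern ε w :=
  mul_nonneg (timeKernel_nonneg hε _) (spaceKernel_nonneg _ _)

lemma kern_periodic (ε : ℝ) : SpacePeriodic (kern (d := d) ε) := fun t k x => by
  simp only [kern, spaceKernel, spaceBump_periodic ε k x]

lemma kern_eq_zero {ε : ℝ} (hε : 0 < ε) {w : ℝ × E d} (hw : w.1 ∉ Icc (ε / 2) ε) :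
    kern ε w = 0 := by simp [kern, timeKernel_eq_zero hε hw]

lemma nearLattice_of_kern_ne_zero {ε : ℝ} (hε : 0 < ε) {w : ℝ × E d} (hw : kern ε w ≠ 0) :
    NearLattice ε w.2 := by
  refine nearLattice_of_spaceBump_ne_zero hε fun h => hw ?_
  simp [kern, spaceKernel, h]

/-- The kernel at scale `ε` is bounded by a multiple of `ε^{-(d+1)}`. -/
lemma exists_kern_le (d : ℕ) :
    ∃ C > 0, ∀ ε : ℝ, 0 < ε → ε ≤ 1 → ∀ w : ℝ × E d, kern ε w ≤ C / ε ^ (d + 1) := by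
  obtain ⟨L, hL, h⟩ := exists_timeKernel_le
  have hpi := Real.pi_pos
  refine ⟨L * (Real.pi * (d + 1)) ^ d, by positivity, fun ε hε hε1 w => ?_⟩
  calc kern ε w ≤ L / ε * ((Real.pi * (d + 1)) ^ d / ε ^ d) :=
        mul_le_mul (h ε hε _) (spaceKernel_le hε hε1 _) (spaceKernel_nonneg _ _) (by positivity)
    _ = _ := by rw [pow_succ]; field_simp

lemma integral_kern {ε : ℝ} (hε : 0 < ε) (hε1 : ε ≤ 1) : ∫ w, kern (d := d) ε w ∂cyl d = 1 := by
  rw [cyl_eq_prod]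
  have := integral_prod_mul (μ := (volume : Measure ℝ)) (ν := volume.restrict (unitCell d))
    (timeKernel ε) (spaceKernel ε)
  refine this.trans ?_
  rw [integral_timeKernel hε, one_mul]
  simp only [spaceKernel]
  rw [integral_div, div_self (integral_spaceBump_pos hε hε1).ne']

lemma cyl_time_lt_top (a b : ℝ) : cyl d (Icc a b ×ˢ univ) < ⊤ := by
  rw [cyl_eq_prod, Measure.prod_prod]
  refine ENNReal.mul_lt_top ?_ ?_
  · simp
  · rw [Measure.restrict_apply_univ]; exact volume_unitCell_lt_top

/-- Bounded measurable functions with bounded support in time are integrable on the cylinder. -/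
lemma integrable_cyl_of_bounded {V : Type*} [NormedAddCommGroup V] {u : ℝ × E d → V}
    (hu : AEStronglyMeasurable u (cyl d)) {C a b : ℝ} (hC : ∀ z, ‖u z‖ ≤ C)
    (h0 : ∀ z, z.1 ∉ Icc a b → u z = 0) : Integrable u (cyl d) := by
  have h1 : IntegrableOn u (Icc a b ×ˢ univ) (cyl d) := by
    refine Measure.integrableOn_of_bounded (M := C) (cyl_time_lt_top a b).ne hu ?_
    exact ae_of_all _ hC
  refine (integrableOn_iff_integrable_of_support_subset ?_).1 h1
  intro z hz
  by_contra h
  exact hz (h0 z fun h' => h ⟨h', mem_univ _⟩)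

lemma kern_bound {ε : ℝ} (hε : 0 < ε) : ∃ C, ∀ w : ℝ × E d, ‖kern ε w‖ ≤ C := by
  obtain ⟨C, h0, hC⟩ := (kern_periodic (d := d) ε).exists_bound (a := ε / 2) (b := ε)
    (contDiff_kern ε).continuous.continuousOn
  refine ⟨C, fun w => ?_⟩
  by_cases hw : w.1 ∈ Icc (ε / 2) ε
  · exact hC w hw
  · rw [kern_eq_zero hε hw]; simpa using h0

lemma integrable_kern {ε : ℝ} (hε : 0 < ε) : Integrable (kern (d := d) ε) (cyl d) := by
  obtain ⟨C, hC⟩ := kern_bound (d := d) hε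
  exact integrable_cyl_of_bounded (contDiff_kern ε).continuous.aestronglyMeasurable hC
    fun z hz => kern_eq_zero hε hz

/-- The probability measure on space-time with density `kern ε`. -/
noncomputable def mollifier (d : ℕ) (ε : ℝ) : Measure (ℝ × E d) :=
  (cyl d).withDensity fun w => ENNReal.ofReal (kern ε w)

lemma measurable_ofReal_kern (ε : ℝ) :
    Measurable fun w : ℝ × E d => ENNReal.ofReal (kern ε w) :=
  (contDiff_kern ε).continuous.measurable.ennreal_ofReal

lemma isProbabilityMeasure_mollifier {ε : ℝ} (hε : 0 < ε) (hε1 : ε ≤ 1) :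
    IsProbabilityMeasure (mollifier d ε) := by
  constructor
  rw [mollifier, withDensity_apply _ MeasurableSet.univ, Measure.restrict_univ,
    ← ofReal_integral_eq_lintegral_ofReal (integrable_kern hε) (ae_of_all _ (kern_nonneg hε)),
    integral_kern hε hε1, ENNReal.ofReal_one]

instance (ε : ℝ) : SFinite (mollifier d ε) := by unfold mollifier; infer_instance

lemma integral_mollifier {V : Type*} [NormedAddCommGroup V] [NormedSpace ℝ V]
    {ε : ℝ} (hε : 0 < ε) (g : ℝ × E d → V) :
    ∫ w, g w ∂mollifier d ε = ∫ w, kern ε w • g w ∂cyl d := by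
  rw [mollifier, integral_withDensity_eq_integral_toReal_smul (measurable_ofReal_kern ε)
    (ae_of_all _ fun _ => ENNReal.ofReal_lt_top)]
  simp only [ENNReal.toReal_ofReal (kern_nonneg hε _)]

lemma ae_mollifier {ε : ℝ} (hε : 0 < ε) :
    ∀ᵐ w ∂mollifier d ε, w.1 ∈ Icc (ε / 2) ε ∧ NearLattice ε w.2 := by
  rw [mollifier, ae_withDensity_iff (measurable_ofReal_kern ε)]
  refine ae_of_all _ fun w hw => ?_
  have hw' : kern ε w ≠ 0 := fun h => hw (by simp [h])
  exact ⟨by_contra fun h => hw' (kern_eq_zero hε h), nearLattice_of_kern_ne_zero hε hw'⟩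

lemma mollifier_absolutelyContinuous (ε : ℝ) : mollifier d ε ≪ volume :=
  (withDensity_absolutelyContinuous _ _).trans Measure.absolutelyContinuous_restrict

lemma integrable_mollifier_of_cyl {V : Type*} [NormedAddCommGroup V] [NormedSpace ℝ V]
    {ε : ℝ} (hε : 0 < ε) {g : ℝ × E d → V} (hg : Integrable g (cyl d)) :
    Integrable g (mollifier d ε) := by
  rw [mollifier, integrable_withDensity_iff_integrable_smul' (measurable_ofReal_kern ε)
    (ae_of_all _ fun _ => ENNReal.ofReal_lt_top)]
  obtain ⟨C, hC⟩ := kern_bound (d := d) hε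
  refine hg.bdd_smul (C := C) ?_ ?_
  · exact (measurable_ofReal_kern ε).ennreal_toReal.aestronglyMeasurable
  · refine ae_of_all _ fun w => ?_
    rw [ENNReal.toReal_ofReal (kern_nonneg hε w)]
    exact hC w

/-- Forward average of `u` at scale `ε`: the values of `u` at times in `[t + ε/2, t + ε]` enter the
average at time `t`. -/
noncomputable def avg {V : Type*} [NormedAddCommGroup V] [NormedSpace ℝ V] (ε : ℝ)
    (u : ℝ × E d → V) (z : ℝ × E d) : V :=
  ∫ w, u (z + w) ∂mollifier d ε

/-- The forward average of a periodic function, as an integral against a translated kernel. -/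
lemma avg_eq {V : Type*} [NormedAddCommGroup V] [NormedSpace ℝ V] {ε : ℝ} (hε : 0 < ε)
    {u : ℝ × E d → V} (hu : SpacePeriodic u) (z : ℝ × E d) :
    avg ε u z = ∫ w, kern ε (w - z) • u w ∂cyl d := by
  rw [avg, integral_mollifier hε]
  have hp : SpacePeriodic fun w : ℝ × E d => kern ε (w - z) • u w := by
    have := (kern_periodic (d := d) ε).comp_add (-z)
    simp only [← sub_eq_add_neg] at this
    exact this.comp₂ hu (· • ·)
  rw [← integral_cyl_add hp z]
  refine integral_congr_ae (ae_of_all _ fun w => ?_)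
  simp only [add_sub_cancel_right]
  rw [add_comm z w]

lemma avg_periodic {V : Type*} [NormedAddCommGroup V] [NormedSpace ℝ V] (ε : ℝ)
    {u : ℝ × E d → V} (hu : SpacePeriodic u) : SpacePeriodic (avg ε u) := by
  intro t k x
  simp only [avg]
  refine integral_congr_ae (ae_of_all _ fun w => ?_)
  exact (hu.comp_add w) t k x

lemma integrable_mollifier_add {V : Type*} [NormedAddCommGroup V] [NormedSpace ℝ V] {ε : ℝ}
    (hε : 0 < ε) {u : ℝ × E d → V} (hu : SpacePeriodic u) (hi : Integrable u (cyl d))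
    (z : ℝ × E d) : Integrable (fun w => u (z + w)) (mollifier d ε) := by
  refine integrable_mollifier_of_cyl hε ?_
  simpa only [add_comm] using integrable_cyl_add hu hi z

end MFG

namespace MFG

open scoped Pointwise

/-! ### Convergence of forward averages in `L^s` -/

variable {d : ℕ} {V : Type*} [NormedAddCommGroup V]

lemma memLp_indicator_big {s : ℝ} (hs : 1 ≤ s) {u : ℝ × E d → V} (hu : SpacePeriodic u)
    (hm : MemLp u (ENNReal.ofReal s) (cyl d)) :
    MemLp (indicator (univ ×ˢ {y | ∀ i, floorVec y i ∈ Icc (-1 : ℤ) 1}) u)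
      (ENNReal.ofReal s) volume := by
  have hs0 : ENNReal.ofReal s ≠ 0 := by simp; linarith
  have hbig : MeasurableSet ((univ : Set ℝ) ×ˢ
      {y : E d | ∀ i, floorVec y i ∈ Icc (-1 : ℤ) 1}) := by
    refine MeasurableSet.univ.prod ?_
    have : {y : E d | ∀ i, floorVec y i ∈ Icc (-1 : ℤ) 1}
        = ⋂ i, (fun y : E d => ⌊y i⌋) ⁻¹' Icc (-1 : ℤ) 1 := by ext; simp [floorVec]
    rw [this]
    refine MeasurableSet.iInter fun i => ?_
    exact (by fun_prop : Measurable fun y : E d => ⌊y i⌋) (MeasurableSet.of_discrete)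
  have hae := aestronglyMeasurable_volume_of_cyl hu hm.1
  rw [memLp_indicator_iff_restrict hbig]
  rw [← integrable_norm_rpow_iff hae.restrict hs0 ENNReal.ofReal_ne_top]
  have hint := (integrable_norm_rpow_iff hm.1 hs0 ENNReal.ofReal_ne_top).2 hm
  set v : ℝ × E d → ℝ := fun z => ‖u z‖ ^ (ENNReal.ofReal s).toReal with hv
  have hvp : SpacePeriodic v := hu.comp (fun a => ‖a‖ ^ (ENNReal.ofReal s).toReal)
  have hfin : IntegrableOn v (⋃ k ∈ Fintype.piFinset fun _ : Fin d => Finset.Icc (-1 : ℤ) 1,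
      (((0 : ℝ), latticeVec k) : ℝ × E d) +ᵥ ((univ : Set ℝ) ×ˢ unitCell d)) volume := by
    rw [integrableOn_finset_iUnion]
    intro k _
    exact (isAddFundamentalDomain_slab.integrableOn_iff (isAddFundamentalDomain_slab_vadd _)
      hvp.vadd).1 hint
  refine hfin.mono_set ?_
  rintro z ⟨-, hz⟩
  refine mem_biUnion (x := floorVec z.2) ?_ ?_
  · simpa [Pi.le_def, forall_and] using hz
  · rw [vadd_slab_eq_preimage]
    refine ⟨(z.1, z.2 + latticeVec (-floorVec z.2)), ⟨mem_univ _, sub_floorVec_mem _⟩, ?_⟩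
    simp [latticeVec_neg]

lemma tendsto_eLpNorm_translate {p : ℝ≥0∞} (hp1 : 1 ≤ p) (hp : p ≠ ⊤) {u : ℝ × E d → V}
    (hu : MemLp u p volume) :
    Tendsto (fun w : ℝ × E d => eLpNorm (fun z => u (z + w) - u z) p volume) (𝓝 0) (𝓝 0) := by
  have : Fact (1 ≤ p) := ⟨hp1⟩
  set g : ℝ × E d → C(ℝ × E d, ℝ × E d) := fun w => ⟨fun z => z + w, by fun_prop⟩ with hg
  have hgc : Continuous g := by
    let G : C((ℝ × E d) × (ℝ × E d), ℝ × E d) := ⟨fun q => q.2 + q.1, by fun_prop⟩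
    exact G.curry.continuous
  have hgm : ∀ w, MeasurePreserving (g w) volume volume := fun w =>
    measurePreserving_add_right volume w
  have hcont : Continuous fun w => Lp.compMeasurePreserving (g w) (hgm w) (hu.toLp u) :=
    continuous_const.compMeasurePreservingLp hgc hgm hp
  have h0 := ((hcont.edist (continuous_const (y := hu.toLp u))).tendsto 0)
  have h1 : ∀ w, edist (Lp.compMeasurePreserving (g w) (hgm w) (hu.toLp u)) (hu.toLp u)
      = eLpNorm (fun z => u (z + w) - u z) p volume := by
    intro w
    rw [Lp.toLp_compMeasurePreserving, Lp.edist_toLp_toLp]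
    rfl
  simp only [h1] at h0
  simpa using h0

/-- Continuity of translations in `L^s` of the cylinder, for periodic functions. -/
lemma exists_lintegral_translate_le {s : ℝ} (hs : 1 ≤ s) {u : ℝ × E d → V}
    (hu : SpacePeriodic u) (hm : MemLp u (ENNReal.ofReal s) (cyl d)) {δ : ℝ} (hδ : 0 < δ) :
    ∃ ε > 0, ∀ w : ℝ × E d, |w.1| ≤ ε → NearLattice ε w.2 →
      ∫⁻ z, ‖u (z + w) - u z‖ₑ ^ s ∂cyl d ≤ ENNReal.ofReal δ := by
  have hs0 : 0 < s := by linarith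
  set big : Set (ℝ × E d) := univ ×ˢ {y | ∀ i, floorVec y i ∈ Icc (-1 : ℤ) 1} with hbig
  have hû := memLp_indicator_big hs hu hm
  have ht := tendsto_eLpNorm_translate (by simpa using hs) ENNReal.ofReal_ne_top hû
  have hδ' : (0 : ℝ≥0∞) < ENNReal.ofReal (δ ^ (1 / s)) := by
    rw [ENNReal.ofReal_pos]; positivity
  obtain ⟨ε, hε, h⟩ := Metric.eventually_nhds_iff.1 (ht.eventually (gt_mem_nhds hδ'))
  refine ⟨min (ε / 2) (1 / 2), by positivity, fun w hw1 hw2 => ?_⟩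
  obtain ⟨k, hk⟩ := hw2
  set w' : ℝ × E d := (w.1, w.2 + latticeVec k) with hw'
  have hw'ε : dist w' 0 < ε := by
    rw [dist_zero_right, Prod.norm_def, max_lt_iff]
    constructor
    · exact (hw1.trans (min_le_left _ _)).trans_lt (by linarith)
    · exact (hk.trans (min_le_left _ _)).trans_lt (by linarith)
  have hlt := (h hw'ε).le
  have hmem : ∀ z : ℝ × E d, z.2 ∈ unitCell d → z ∈ big ∧ z + w' ∈ big := by
    intro z hz
    refine ⟨⟨mem_univ _, fun i => ?_⟩, ⟨mem_univ _, fun i => ?_⟩⟩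
    · have : ⌊z.2 i⌋ = 0 := Int.floor_eq_zero_iff.2 (hz i)
      simp [floorVec, this]
    · have h1 : |w'.2 i| ≤ 1 / 2 :=
        ((PiLp.norm_apply_le w'.2 i).trans hk).trans (min_le_right _ _)
      rw [abs_le] at h1
      have h2 := hz i
      change ⌊z.2 i + w'.2 i⌋ ∈ Icc (-1 : ℤ) 1
      rw [mem_Icc, Int.le_floor, ← Int.lt_add_one_iff, Int.floor_lt]
      push_cast
      constructor
      · linarith [h2.1]
      · linarith [h2.2]
  rw [eLpNorm_eq_lintegral_rpow_enorm_toReal (by simpa using hs0) ENNReal.ofReal_ne_top,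
    ENNReal.toReal_ofReal hs0.le] at hlt
  have h3 : ∫⁻ z, ‖indicator big u (z + w') - indicator big u z‖ₑ ^ s ≤ ENNReal.ofReal δ := by
    have h4 := ENNReal.rpow_le_rpow hlt hs0.le
    rw [← ENNReal.rpow_mul, one_div_mul_cancel hs0.ne', ENNReal.rpow_one,
      ENNReal.ofReal_rpow_of_nonneg (by positivity) hs0.le, ← Real.rpow_mul hδ.le,
      one_div_mul_cancel hs0.ne', Real.rpow_one] at h4
    exact h4
  refine le_trans ?_ h3
  rw [cyl]
  refine le_trans (setLIntegral_mono' measurableSet_slab fun z hz => ?_)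
    (setLIntegral_le_lintegral _ _)
  rw [indicator_of_mem (hmem z hz.2).2, indicator_of_mem (hmem z hz.2).1]
  have : u (z + w') = u (z + w) := by
    rw [← hu.apply_add k (z + w)]
    congr 1
    exact Prod.ext rfl (by simp [hw', add_assoc])
  rw [this]

lemma rpow_lintegral_le {Ω : Type*} [MeasurableSpace Ω] {μ : Measure Ω} [IsProbabilityMeasure μ]
    {s : ℝ} (hs : 1 ≤ s) {f : Ω → V} (hf : AEStronglyMeasurable f μ) :
    (∫⁻ x, ‖f x‖ₑ ∂μ) ^ s ≤ ∫⁻ x, ‖f x‖ₑ ^ s ∂μ := by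
  have hs0 : 0 < s := by linarith
  have h := eLpNorm_le_eLpNorm_of_exponent_le (p := 1) (q := ENNReal.ofReal s)
    (by simpa using hs) hf
  rw [eLpNorm_one_eq_lintegral_enorm, eLpNorm_eq_lintegral_rpow_enorm_toReal (by simpa using hs0)
    ENNReal.ofReal_ne_top, ENNReal.toReal_ofReal hs0.le] at h
  have h4 := ENNReal.rpow_le_rpow h hs0.le
  rwa [← ENNReal.rpow_mul, one_div_mul_cancel hs0.ne', ENNReal.rpow_one] at h4

lemma aestronglyMeasurable_add_prod {u : ℝ × E d → V} (hu : SpacePeriodic u)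
    (hm : AEStronglyMeasurable u (cyl d)) (ε : ℝ) :
    AEStronglyMeasurable (fun q : (ℝ × E d) × (ℝ × E d) => u (q.1 + q.2))
      ((cyl d).prod (mollifier d ε)) := by
  have h := (aestronglyMeasurable_volume_of_cyl hu hm).comp_quasiMeasurePreserving
    (quasiMeasurePreserving_add (volume : Measure (ℝ × E d)) (volume : Measure (ℝ × E d)))
  exact h.mono_ac (Measure.absolutelyContinuous_restrict.prod (mollifier_absolutelyContinuous ε))

variable [NormedSpace ℝ V] [CompleteSpace V]

/-- Forward averages converge in `L^s`. -/
lemma exists_lintegral_avg_sub_le {s : ℝ} (hs : 1 ≤ s) {u : ℝ × E d → V}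
    (hu : SpacePeriodic u) (hi : Integrable u (cyl d))
    (hm : MemLp u (ENNReal.ofReal s) (cyl d)) {δ : ℝ} (hδ : 0 < δ) :
    ∃ ε₀ > 0, ∀ ε : ℝ, 0 < ε → ε ≤ 1 → ε ≤ ε₀ →
      ∫⁻ z, ‖avg ε u z - u z‖ₑ ^ s ∂cyl d ≤ ENNReal.ofReal δ := by
  obtain ⟨ε₀, hε₀, h⟩ := exists_lintegral_translate_le hs hu hm hδ
  refine ⟨ε₀, hε₀, fun ε hε hε1 hεε => ?_⟩
  have := isProbabilityMeasure_mollifier (d := d) hε hε1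
  have hmeas : AEMeasurable (fun q : (ℝ × E d) × (ℝ × E d) => ‖u (q.1 + q.2) - u q.1‖ₑ ^ s)
      ((cyl d).prod (mollifier d ε)) :=
    ((aestronglyMeasurable_add_prod hu hi.1 ε).sub hi.1.comp_fst).enorm.pow_const s
  calc ∫⁻ z, ‖avg ε u z - u z‖ₑ ^ s ∂cyl d
      ≤ ∫⁻ z, ∫⁻ w, ‖u (z + w) - u z‖ₑ ^ s ∂mollifier d ε ∂cyl d := by
        refine lintegral_mono fun z => ?_
        have hiz := integrable_mollifier_add hε hu hi z
        have h1 : avg ε u z - u z = ∫ w, (u (z + w) - u z) ∂mollifier d ε := by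
          rw [integral_sub hiz (integrable_const _), integral_const]
          simp [avg]
        rw [h1]
        refine le_trans ?_ (rpow_lintegral_le hs (hiz.sub (integrable_const _)).1)
        exact ENNReal.rpow_le_rpow (enorm_integral_le_lintegral_enorm _) (by linarith)
    _ = ∫⁻ w, ∫⁻ z, ‖u (z + w) - u z‖ₑ ^ s ∂cyl d ∂mollifier d ε :=
        lintegral_lintegral_swap hmeas
    _ ≤ ∫⁻ w, ENNReal.ofReal δ ∂mollifier d ε := by
        refine lintegral_mono_ae ?_
        filter_upwards [ae_mollifier hε] with w ⟨hw1, k, hk⟩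
        refine h w ?_ ⟨k, hk.trans hεε⟩
        rw [abs_of_nonneg (by linarith [hw1.1])]
        exact hw1.2.trans hεε
    _ = ENNReal.ofReal δ := by simp

end MFG

namespace MFG

/-! ### Calculus of periodic functions and integration by parts -/

variable {d : ℕ}

/-- The space gradient encoded in a space-time differential. -/
noncomputable def spaceGrad (L : (ℝ × E d) →L[ℝ] ℝ) : E d :=
  (InnerProductSpace.toDual ℝ (E d)).symm (L.comp (ContinuousLinearMap.inr ℝ ℝ (E d)))

lemma inner_spaceGrad (L : (ℝ × E d) →L[ℝ] ℝ) (v : E d) :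
    inner ℝ (spaceGrad L) v = L (0, v) := by
  simp [spaceGrad]

lemma norm_spaceGrad_le (L : (ℝ × E d) →L[ℝ] ℝ) : ‖spaceGrad L‖ ≤ ‖L‖ := by
  rw [spaceGrad, LinearIsometryEquiv.norm_map]
  refine (ContinuousLinearMap.opNorm_comp_le _ _).trans ?_
  have := ContinuousLinearMap.norm_inr_le_one ℝ ℝ (E d)
  exact mul_le_of_le_one_right (norm_nonneg _) this

lemma continuous_spaceGrad : Continuous (spaceGrad (d := d)) := by
  unfold spaceGrad
  fun_prop

lemma hasDerivAt_slice {u : ℝ × E d → ℝ} {z : ℝ × E d} (hu : DifferentiableAt ℝ u z) :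
    HasDerivAt (fun t => u (t, z.2)) (fderiv ℝ u z (1, 0)) z.1 := by
  have h : HasDerivAt (fun t : ℝ => (t, z.2)) ((1 : ℝ), (0 : E d)) z.1 :=
    (hasDerivAt_id _).prodMk (hasDerivAt_const _ _)
  exact hu.hasFDerivAt.comp_hasDerivAt z.1 h

lemma dt_eq {u : ℝ × E d → ℝ} {z : ℝ × E d} (hu : DifferentiableAt ℝ u z) :
    dt u z = fderiv ℝ u z (1, 0) := (hasDerivAt_slice hu).deriv

lemma hasFDerivAt_space_slice {V : Type*} [NormedAddCommGroup V] [NormedSpace ℝ V]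
    {u : ℝ × E d → V} {z : ℝ × E d} (hu : DifferentiableAt ℝ u z) :
    HasFDerivAt (fun x => u (z.1, x)) ((fderiv ℝ u z).comp (ContinuousLinearMap.inr ℝ ℝ (E d)))
      z.2 :=
  hu.hasFDerivAt.comp z.2 (hasFDerivAt_prodMk_right z.1 z.2)

lemma Dx_eq {u : ℝ × E d → ℝ} {z : ℝ × E d} (hu : DifferentiableAt ℝ u z) :
    Dx u z = spaceGrad (fderiv ℝ u z) := by
  rw [Dx, gradient, (hasFDerivAt_space_slice hu).fderiv, spaceGrad]

lemma inner_Dx {u : ℝ × E d → ℝ} {z : ℝ × E d} (hu : DifferentiableAt ℝ u z) (v : E d) :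
    inner ℝ (Dx u z) v = fderiv ℝ u z (0, v) := by
  rw [Dx_eq hu, inner_spaceGrad]

lemma divx_eq {Ψ : ℝ × E d → E d} {z : ℝ × E d} (hΨ : DifferentiableAt ℝ Ψ z) :
    divx Ψ z = ∑ i, fderiv ℝ (fun z => Ψ z i) z (0, EuclideanSpace.single i 1) := by
  rw [divx]
  refine Finset.sum_congr rfl fun i _ => ?_
  rw [(hasFDerivAt_space_slice hΨ).fderiv]
  have h := (EuclideanSpace.proj (𝕜 := ℝ) i).hasFDerivAt.comp z hΨ.hasFDerivAt
  have h2 : HasFDerivAt (fun z => Ψ z i)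
    ((EuclideanSpace.proj (𝕜 := ℝ) i).comp (fderiv ℝ Ψ z)) z := h
  rw [h2.fderiv]
  simp

lemma fderiv_periodic {V : Type*} [NormedAddCommGroup V] [NormedSpace ℝ V] {u : ℝ × E d → V}
    (hu : SpacePeriodic u) : SpacePeriodic (fderiv ℝ u) := by
  intro t k x
  have h : (fun z : ℝ × E d => u (z + (0, latticeVec k))) = u := by
    funext z
    rw [← hu.apply_add k z]
    exact congrArg u (Prod.ext (add_zero _) rfl)
  have h2 := fderiv_comp_add_right (𝕜 := ℝ) (f := u) (x := (t, x)) ((0 : ℝ), latticeVec k)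
  rw [h] at h2
  simp only
  rw [h2]
  exact congrArg (fderiv ℝ u) (Prod.ext (add_zero _).symm rfl)

lemma dt_periodic {u : ℝ × E d → ℝ} (hu : SpacePeriodic u) : SpacePeriodic (dt u) := by
  intro t k x
  have h : (fun s => u (s, x + latticeVec k)) = fun s => u (s, x) := funext fun s => hu s k x
  simp only [dt, h]

lemma gradient_periodic {g : E d → ℝ} (hg : TorusPeriodic g) : TorusPeriodic (gradient g) := by
  intro k x
  have h : (fun y => g (y + latticeVec k)) = g := funext fun y => hg k y
  have h2 := fderiv_comp_add_right (𝕜 := ℝ) (f := g) (x := x) (latticeVec k)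
  rw [h] at h2
  simp only [gradient, h2]

lemma Dx_periodic {u : ℝ × E d → ℝ} (hu : SpacePeriodic u) : SpacePeriodic (Dx u) :=
  fun t => gradient_periodic (hu t)

lemma fderiv_eq_zero_of_time {V : Type*} [NormedAddCommGroup V] [NormedSpace ℝ V]
    {u : ℝ × E d → V} {a b : ℝ} (h : ∀ z, z.1 ∉ Icc a b → u z = 0) (z : ℝ × E d)
    (hz : z.1 ∉ Icc a b) : fderiv ℝ u z = 0 := by
  have hev : u =ᶠ[𝓝 z] fun _ => 0 := by
    have : (Prod.fst ⁻¹' (Icc a b)ᶜ : Set (ℝ × E d)) ∈ 𝓝 z :=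
      (isClosed_Icc.isOpen_compl.preimage continuous_fst).mem_nhds hz
    filter_upwards [this] with y hy using h y hy
  rw [hev.fderiv_eq]
  simp

lemma exists_bound_of_time {V : Type*} [NormedAddCommGroup V] {u : ℝ × E d → V}
    (hu : SpacePeriodic u) (hc : Continuous u) {a b : ℝ} (h : ∀ z, z.1 ∉ Icc a b → u z = 0) :
    ∃ C, 0 ≤ C ∧ ∀ z, ‖u z‖ ≤ C := by
  obtain ⟨C, h0, hC⟩ := hu.exists_bound (a := a) (b := b) hc.continuousOn
  refine ⟨C, h0, fun z => ?_⟩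
  by_cases hz : z.1 ∈ Icc a b
  · exact hC z hz
  · rw [h z hz, norm_zero]; exact h0

/-- Derivatives of periodic functions with bounded support in time have vanishing integral:
the integral over the cylinder is invariant under translations. -/
lemma integral_fderiv_eq_zero {g : ℝ × E d → ℝ} (hg : SpacePeriodic g) (hc : ContDiff ℝ 1 g)
    {a b : ℝ} (h : ∀ z, z.1 ∉ Icc a b → g z = 0) (v : ℝ × E d) :
    ∫ z, fderiv ℝ g z v ∂cyl d = 0 := by
  have hfc : Continuous (fderiv ℝ g) := hc.continuous_fderiv (by simp)
  obtain ⟨C, h0, hC⟩ := exists_bound_of_time (fderiv_periodic hg) hfc (fderiv_eq_zero_of_time h)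
  have hint : Integrable g (cyl d) := by
    obtain ⟨C', -, hC'⟩ := exists_bound_of_time hg hc.continuous h
    exact integrable_cyl_of_bounded hc.continuous.aestronglyMeasurable hC' h
  set bound : ℝ × E d → ℝ :=
    indicator (Icc (a - |v.1|) (b + |v.1|) ×ˢ univ) fun _ => C * ‖v‖ with hbound
  have hbi : Integrable bound (cyl d) := by
    rw [hbound, integrable_indicator_iff (measurableSet_Icc.prod MeasurableSet.univ)]
    exact integrableOn_const (cyl_time_lt_top _ _).ne
  have hder : ∀ z (τ : ℝ), HasDerivAt (fun τ : ℝ => g (z + τ • v)) (fderiv ℝ g (z + τ • v) v) τ := by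
    intro z τ
    have h1 : HasDerivAt (fun τ : ℝ => z + τ • v) v τ := by
      simpa using ((hasDerivAt_id τ).smul_const v).const_add z
    exact ((hc.differentiable (by simp)) _).hasFDerivAt.comp_hasDerivAt τ h1
  have key := hasDerivAt_integral_of_dominated_loc_of_deriv_le (μ := cyl d)
    (F := fun (τ : ℝ) z => g (z + τ • v)) (F' := fun τ z => fderiv ℝ g (z + τ • v) v)
    (x₀ := (0 : ℝ)) (s := Icc (-1) 1) (bound := bound) (Icc_mem_nhds (by norm_num) (by norm_num))
    (Eventually.of_forall fun τ =>
      (hc.continuous.comp (continuous_id.add continuous_const)).aestronglyMeasurable)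
    (by simpa using hint)
    ((hfc.comp (continuous_id.add continuous_const)).clm_apply
      continuous_const).aestronglyMeasurable
    (ae_of_all _ fun z τ hτ => ?_) hbi (ae_of_all _ fun z τ _ => hder z τ)
  · have h2 : (fun τ : ℝ => ∫ z, g (z + τ • v) ∂cyl d) = fun _ => ∫ z, g z ∂cyl d := by
      funext τ; exact integral_cyl_add hg _
    have h3 := key.2
    rw [h2] at h3
    simpa using h3.unique (hasDerivAt_const _ _)
  · by_cases hz : z.1 ∈ Icc (a - |v.1|) (b + |v.1|)
    · rw [hbound, indicator_of_mem (by exact ⟨hz, mem_univ _⟩)]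
      exact (ContinuousLinearMap.le_opNorm _ _).trans
        (mul_le_mul_of_nonneg_right (hC _) (norm_nonneg _))
    · have hτ' : |τ * v.1| ≤ |v.1| := by
        rw [abs_mul]
        exact mul_le_of_le_one_left (abs_nonneg _) (abs_le.2 hτ)
      have h5 : (z + τ • v).1 ∉ Icc a b := by
        intro h6
        refine hz ?_
        have h7 : (z + τ • v).1 = z.1 + τ * v.1 := by simp
        rw [h7] at h6
        rw [abs_le] at hτ'
        exact ⟨by linarith [h6.1], by linarith [h6.2]⟩
      rw [fderiv_eq_zero_of_time h _ h5, hbound,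
        indicator_of_notMem (by exact fun h => hz h.1)]
      simp

lemma volume_restrict_spaceTime (T : ℝ) :
    volume.restrict (spaceTime d T) = (cyl d).restrict (Ioo 0 T ×ˢ univ) := by
  rw [cyl, Measure.restrict_restrict (measurableSet_Ioo.prod MeasurableSet.univ), prod_inter_prod,
    inter_univ, univ_inter, spaceTime]

lemma measurableSet_spaceTime (T : ℝ) : MeasurableSet (spaceTime d T) :=
  measurableSet_Ioo.prod measurableSet_unitCell

lemma volume_spaceTime_lt_top (T : ℝ) : volume (spaceTime d T) < ⊤ := by
  rw [spaceTime, Measure.volume_eq_prod, Measure.prod_prod]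
  exact ENNReal.mul_lt_top (by simp) volume_unitCell_lt_top

lemma isFiniteMeasure_spaceTime (T : ℝ) : IsFiniteMeasure (volume.restrict (spaceTime d T)) :=
  ⟨by rw [Measure.restrict_apply_univ]; exact volume_spaceTime_lt_top T⟩

lemma setIntegral_spaceTime_eq {V : Type*} [NormedAddCommGroup V] [NormedSpace ℝ V] {T : ℝ}
    {u : ℝ × E d → V} (h : ∀ z, z.1 ∉ Ioo 0 T → u z = 0) :
    ∫ z in spaceTime d T, u z = ∫ z, u z ∂cyl d := by
  rw [volume_restrict_spaceTime]
  exact setIntegral_eq_integral_of_forall_compl_eq_zero fun z hz =>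
    h z fun h' => hz ⟨h', mem_univ _⟩

lemma integrableOn_spaceTime_of_bounded {V : Type*} [NormedAddCommGroup V] {T : ℝ}
    {u : ℝ × E d → V} (hu : ContinuousOn u (Ioo 0 T ×ˢ univ)) {C : ℝ}
    (hC : ∀ z, z.1 ∈ Ioo 0 T → ‖u z‖ ≤ C) : IntegrableOn u (spaceTime d T) := by
  have := isFiniteMeasure_spaceTime (d := d) T
  refine Integrable.of_bound ?_ C ?_
  · exact (hu.mono (prod_mono Subset.rfl (subset_univ _))).aestronglyMeasurable
      (measurableSet_spaceTime T)
  · filter_upwards [ae_restrict_mem (measurableSet_spaceTime T)] with z hz using hC z hz.1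

section Test

variable {T : ℝ} {V : Type*} [NormedAddCommGroup V] [NormedSpace ℝ V]

lemma IsTest.contDiff_one {ψ : ℝ × E d → V} (hψ : IsTest T ψ) : ContDiff ℝ 1 ψ :=
  hψ.contDiff.of_le (by exact_mod_cast le_top)

lemma IsTest.differentiable {ψ : ℝ × E d → V} (hψ : IsTest T ψ) : Differentiable ℝ ψ :=
  hψ.contDiff_one.differentiable (by simp)

lemma IsTest.eq_zero {ψ : ℝ × E d → V} (hψ : IsTest T ψ) {z : ℝ × E d} (hz : z.1 ∉ Ioo 0 T) :
    ψ z = 0 := by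
  obtain ⟨a, b, ha, hb, h⟩ := hψ.support
  exact h z fun h' => hz ⟨ha.trans_le h'.1, h'.2.trans_lt hb⟩

lemma IsTest.fderiv_eq_zero {ψ : ℝ × E d → V} (hψ : IsTest T ψ) {z : ℝ × E d}
    (hz : z.1 ∉ Ioo 0 T) : fderiv ℝ ψ z = 0 := by
  obtain ⟨a, b, ha, hb, h⟩ := hψ.support
  exact fderiv_eq_zero_of_time h z fun h' => hz ⟨ha.trans_le h'.1, h'.2.trans_lt hb⟩

lemma IsTest.exists_bound {ψ : ℝ × E d → V} (hψ : IsTest T ψ) :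
    ∃ C, 0 ≤ C ∧ ∀ z, ‖ψ z‖ ≤ C := by
  obtain ⟨a, b, ha, hb, h⟩ := hψ.support
  exact exists_bound_of_time hψ.periodic hψ.contDiff.continuous h

lemma IsTest.continuous_fderiv {ψ : ℝ × E d → V} (hψ : IsTest T ψ) : Continuous (fderiv ℝ ψ) :=
  hψ.contDiff_one.continuous_fderiv (by simp)

lemma IsTest.exists_bound_fderiv {ψ : ℝ × E d → V} (hψ : IsTest T ψ) :
    ∃ C, 0 ≤ C ∧ ∀ z, ‖fderiv ℝ ψ z‖ ≤ C := by
  obtain ⟨a, b, ha, hb, h⟩ := hψ.support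
  exact exists_bound_of_time (fderiv_periodic hψ.periodic) hψ.continuous_fderiv
    (fderiv_eq_zero_of_time h)

lemma IsTest.dt_eq {ψ : ℝ × E d → ℝ} (hψ : IsTest T ψ) (z : ℝ × E d) :
    dt ψ z = fderiv ℝ ψ z (1, 0) := MFG.dt_eq (hψ.differentiable z)

lemma IsTest.Dx_eq {ψ : ℝ × E d → ℝ} (hψ : IsTest T ψ) (z : ℝ × E d) :
    Dx ψ z = spaceGrad (fderiv ℝ ψ z) := MFG.Dx_eq (hψ.differentiable z)

lemma norm_one_zero : ‖((1 : ℝ), (0 : E d))‖ = 1 := by simp [Prod.norm_def]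

lemma IsTest.exists_bound_dt {ψ : ℝ × E d → ℝ} (hψ : IsTest T ψ) :
    ∃ C, 0 ≤ C ∧ ∀ z, |dt ψ z| ≤ C := by
  obtain ⟨C, h0, h⟩ := hψ.exists_bound_fderiv
  refine ⟨C, h0, fun z => ?_⟩
  rw [hψ.dt_eq]
  have := (fderiv ℝ ψ z).le_opNorm (1, 0)
  rw [norm_one_zero, mul_one] at this
  exact this.trans (h z)

lemma IsTest.continuous_dt {ψ : ℝ × E d → ℝ} (hψ : IsTest T ψ) : Continuous (dt ψ) := by
  have : dt ψ = fun z => fderiv ℝ ψ z (1, 0) := funext hψ.dt_eq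
  rw [this]
  exact hψ.continuous_fderiv.clm_apply continuous_const

lemma IsTest.continuous_Dx {ψ : ℝ × E d → ℝ} (hψ : IsTest T ψ) : Continuous (Dx ψ) := by
  have : Dx ψ = fun z => spaceGrad (fderiv ℝ ψ z) := funext hψ.Dx_eq
  rw [this]
  exact continuous_spaceGrad.comp hψ.continuous_fderiv

lemma IsTest.exists_bound_Dx {ψ : ℝ × E d → ℝ} (hψ : IsTest T ψ) :
    ∃ C, 0 ≤ C ∧ ∀ z, ‖Dx ψ z‖ ≤ C := by
  obtain ⟨C, h0, h⟩ := hψ.exists_bound_fderiv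
  refine ⟨C, h0, fun z => ?_⟩
  rw [hψ.Dx_eq]
  exact (norm_spaceGrad_le _).trans (h z)

end Test

/-- Integration by parts against a test function, for functions of class `C¹` inside
`(0,T) × 𝕋^d`. -/
lemma setIntegral_mul_fderiv {T : ℝ} {φ ψ : ℝ × E d → ℝ} (hφ : SpacePeriodic φ)
    (hc : ContDiffOn ℝ 1 φ (Ioo 0 T ×ˢ univ)) (hψ : IsTest T ψ) (v : ℝ × E d)
    (h1 : IntegrableOn (fun z => φ z * fderiv ℝ ψ z v) (spaceTime d T))
    (h2 : IntegrableOn (fun z => fderiv ℝ φ z v * ψ z) (spaceTime d T)) :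
    ∫ z in spaceTime d T, φ z * fderiv ℝ ψ z v
      = - ∫ z in spaceTime d T, fderiv ℝ φ z v * ψ z := by
  have hop : IsOpen (Ioo 0 T ×ˢ (univ : Set (E d))) := isOpen_Ioo.prod isOpen_univ
  obtain ⟨a, b, ha, hb, h⟩ := hψ.support
  have hat : ∀ z : ℝ × E d, z.1 ∈ Ioo 0 T → ContDiffAt ℝ 1 φ z := fun z hz =>
    hc.contDiffAt (hop.mem_nhds ⟨hz, mem_univ _⟩)
  have hg : ContDiff ℝ 1 fun z => φ z * ψ z := by
    rw [contDiff_iff_contDiffAt]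
    intro z
    by_cases hz : z.1 ∈ Ioo 0 T
    · exact (hat z hz).mul hψ.contDiff_one.contDiffAt
    · have : (Prod.fst ⁻¹' (Icc a b)ᶜ : Set (ℝ × E d)) ∈ 𝓝 z :=
        (isClosed_Icc.isOpen_compl.preimage continuous_fst).mem_nhds
          fun h' => hz ⟨ha.trans_le h'.1, h'.2.trans_lt hb⟩
      have hev : (fun z => φ z * ψ z) =ᶠ[𝓝 z] fun _ => 0 := by
        filter_upwards [this] with y hy
        rw [h y hy, mul_zero]
      exact contDiffAt_const.congr_of_eventuallyEq hev
  have h0 := integral_fderiv_eq_zero (hφ.comp₂ hψ.periodic (· * ·)) hg (a := a) (b := b)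
    (fun z hz => by rw [h z hz, mul_zero]) v
  have hzero : ∀ z : ℝ × E d, z.1 ∉ Ioo 0 T → fderiv ℝ (fun z => φ z * ψ z) z v = 0 := by
    intro z hz
    rw [fderiv_eq_zero_of_time (a := a) (b := b) (fun z hz => by rw [h z hz, mul_zero]) z
      fun h' => hz ⟨ha.trans_le h'.1, h'.2.trans_lt hb⟩]
    rfl
  rw [← setIntegral_spaceTime_eq hzero] at h0
  have h3 : ∫ z in spaceTime d T, fderiv ℝ (fun z => φ z * ψ z) z v
      = ∫ z in spaceTime d T, (φ z * fderiv ℝ ψ z v + fderiv ℝ φ z v * ψ z) := by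
    refine setIntegral_congr_fun (measurableSet_spaceTime T) fun z hz => ?_
    have : HasFDerivAt (fun z => φ z * ψ z) (φ z • fderiv ℝ ψ z + ψ z • fderiv ℝ φ z) z :=
      ((hat z hz.1).differentiableAt (by simp)).hasFDerivAt.mul
      (hψ.differentiable z).hasFDerivAt
    rw [this.fderiv]
    simp [mul_comm]
  rw [h3, integral_add h1 h2] at h0
  linarith

end MFG

namespace MFG

/-! ### Smooth competitors are relaxed competitors -/

variable {d : ℕ}

lemma HamiltonianAssumption.r_pos {q r : ℝ} {H : E d → E d → ℝ} (hH : HamiltonianAssumption q r H) :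
    1 < r := (le_max_right _ _).trans_lt hH.r_gt

/-- Two-sided growth of the Hamiltonian in absolute value. -/
lemma HamiltonianAssumption.exists_abs_le {q r : ℝ} {H : E d → E d → ℝ}
    (hH : HamiltonianAssumption q r H) : ∃ C > 0, ∀ x ξ, |H x ξ| ≤ C * ‖ξ‖ ^ r + C := by
  obtain ⟨C, hC, h⟩ := hH.growth
  have hr := hH.r_pos
  refine ⟨C, hC, fun x ξ => ?_⟩
  have h1 := h x ξ
  have h2 : 0 ≤ ‖ξ‖ ^ r := by positivity
  have h3 : 0 ≤ 1 / (r * C) * ‖ξ‖ ^ r := by positivity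
  have h4 : C / r * ‖ξ‖ ^ r ≤ C * ‖ξ‖ ^ r := by
    gcongr
    exact div_le_self hC.le hr.le
  have h5 : 0 ≤ C * ‖ξ‖ ^ r := by positivity
  rw [abs_le]
  constructor <;> linarith [h1.1, h1.2]

/-- Traces at time `0` are unique. -/
lemma IsTraceRight.ae_eq {φ : ℝ × E d → ℝ} {T : ℝ} (hT : 0 < T)
    (hφ : AEStronglyMeasurable φ (volume.restrict (spaceTime d T))) {g₁ g₂ : E d → ℝ}
    (h₁ : IsTraceRight φ 0 g₁) (h₂ : IsTraceRight φ 0 g₂) :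
    g₁ =ᵐ[volume.restrict (unitCell d)] g₂ := by
  have hle : ∀ᶠ h : ℝ in 𝓝[>] 0, ∫⁻ x in unitCell d, ‖g₁ x - g₂ x‖ₑ ≤
      (∫⁻ z in Ioo 0 (0 + h) ×ˢ unitCell d, ‖φ z - g₁ z.2‖ₑ) / ENNReal.ofReal h
      + (∫⁻ z in Ioo 0 (0 + h) ×ˢ unitCell d, ‖φ z - g₂ z.2‖ₑ) / ENNReal.ofReal h := by
    filter_upwards [Ioo_mem_nhdsGT hT] with h hh
    have hsub : Ioo 0 (0 + h) ×ˢ unitCell d ⊆ spaceTime d T :=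
      prod_mono (Ioo_subset_Ioo le_rfl (by linarith [hh.2])) Subset.rfl
    have hprod : (volume : Measure (ℝ × E d)).restrict (Ioo 0 (0 + h) ×ˢ unitCell d)
        = ((volume : Measure ℝ).restrict (Ioo 0 (0 + h))).prod
          (volume.restrict (unitCell d)) := by
      rw [Measure.volume_eq_prod, Measure.prod_restrict]
    have hconst : ∫⁻ z in Ioo 0 (0 + h) ×ˢ unitCell d, ‖g₁ z.2 - g₂ z.2‖ₑ
        = ENNReal.ofReal h * ∫⁻ x in unitCell d, ‖g₁ x - g₂ x‖ₑ := by
      have hm : AEMeasurable (fun x => ‖g₁ x - g₂ x‖ₑ) (volume.restrict (unitCell d)) :=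
        (h₁.2.1.1.sub h₂.2.1.1).enorm
      rw [hprod, lintegral_prod _ hm.comp_snd]
      simp [mul_comm]
    have h0 : ENNReal.ofReal h ≠ 0 := by simpa using hh.1
    rw [← ENNReal.add_div, ENNReal.le_div_iff_mul_le (Or.inl h0) (Or.inl ENNReal.ofReal_ne_top),
      mul_comm, ← hconst, ← lintegral_add_left']
    · refine lintegral_mono fun z => ?_
      have : g₁ z.2 - g₂ z.2 = (φ z - g₂ z.2) - (φ z - g₁ z.2) := by ring
      rw [this, add_comm]
      exact enorm_sub_le
    · refine ((hφ.mono_measure (Measure.restrict_mono hsub le_rfl)).sub ?_).enorm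
      rw [hprod]
      exact h₁.2.1.1.comp_snd
  have h0 : ∫⁻ x in unitCell d, ‖g₁ x - g₂ x‖ₑ = 0 := by
    have := ge_of_tendsto (h₁.2.2.add h₂.2.2) hle
    simpa using this
  have hm : AEMeasurable (fun x => ‖g₁ x - g₂ x‖ₑ) (volume.restrict (unitCell d)) :=
    (h₁.2.1.1.sub h₂.2.1.1).enorm
  rw [lintegral_eq_zero_iff' hm] at h0
  filter_upwards [h0] with x hx
  have : ‖g₁ x - g₂ x‖ₑ = 0 := hx
  rw [enorm_eq_zero, sub_eq_zero] at this
  exact this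

lemma initialTrace_spec {φ : ℝ × E d → ℝ} {g : E d → ℝ} (h : IsTraceRight φ 0 g) :
    IsTraceRight φ 0 (initialTrace φ) := by
  have h' : ∃ g, IsTraceRight φ 0 g := ⟨g, h⟩
  rw [initialTrace, dif_pos h']
  exact h'.choose_spec

/-- Linear control of `φ(t,·) - g` in the distance to the initial or terminal time gives the
averaged `L¹` convergence in the definition of traces. -/
lemma tendsto_average_of_le {I : ℝ → Set ℝ} (hI : ∀ h, MeasurableSet (I h))
    (hvol : ∀ h > 0, volume (I h) ≤ ENNReal.ofReal h) {u : ℝ × E d → ℝ} {L T : ℝ} (hT : 0 < T)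
    (hu : ∀ h > 0, h < T → ∀ t ∈ I h, ∀ x, ‖u (t, x)‖ ≤ L * h) :
    Tendsto (fun h : ℝ => (∫⁻ z in I h ×ˢ unitCell d, ‖u z‖ₑ) / ENNReal.ofReal h)
      (𝓝[>] 0) (𝓝 0) := by
  have hlim : Tendsto (fun h : ℝ => ENNReal.ofReal (L * h) * volume (unitCell d))
      (𝓝[>] 0) (𝓝 0) := by
    have h1 : Tendsto (fun h : ℝ => ENNReal.ofReal (L * h)) (𝓝[>] 0) (𝓝 (ENNReal.ofReal (L * 0))) :=
      (ENNReal.continuous_ofReal.comp (continuous_const.mul continuous_id)).continuousWithinAt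
    have h2 := ENNReal.Tendsto.mul_const (b := volume (unitCell d)) h1
      (Or.inr volume_unitCell_lt_top.ne)
    simpa using h2
  refine tendsto_of_tendsto_of_tendsto_of_le_of_le' tendsto_const_nhds hlim
    (Eventually.of_forall fun _ => zero_le) ?_
  filter_upwards [Ioo_mem_nhdsGT hT] with h hh
  refine ENNReal.div_le_of_le_mul ?_
  calc ∫⁻ z in I h ×ˢ unitCell d, ‖u z‖ₑ
      ≤ ∫⁻ z in I h ×ˢ unitCell d, ENNReal.ofReal (L * h) := by
        refine setLIntegral_mono' ((hI h).prod measurableSet_unitCell) fun z hz => ?_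
        rw [← ofReal_norm]
        exact ENNReal.ofReal_le_ofReal (hu h hh.1 hh.2 z.1 hz.1 z.2)
    _ ≤ _ := by
        rw [setLIntegral_const, Measure.volume_eq_prod, Measure.prod_prod, mul_assoc]
        rw [mul_comm (volume (I h))]
        gcongr
        exact hvol h hh.1

section K0

variable {T : ℝ} {φT : E d → ℝ} {φ : ℝ × E d → ℝ}

lemma isOpen_timeStrip (T : ℝ) : IsOpen (Ioo 0 T ×ˢ (univ : Set (E d))) :=
  isOpen_Ioo.prod isOpen_univ

lemma K0.contDiffOn (hφ : φ ∈ K0 T φT) : ContDiffOn ℝ 1 φ (Ioo 0 T ×ˢ univ) :=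
  hφ.2.1.mono (prod_mono Ioo_subset_Icc_self Subset.rfl)

lemma K0.differentiableAt (hφ : φ ∈ K0 T φT) {z : ℝ × E d} (hz : z.1 ∈ Ioo 0 T) :
    DifferentiableAt ℝ φ z :=
  ((K0.contDiffOn hφ).contDiffAt ((isOpen_timeStrip T).mem_nhds
    ⟨hz, mem_univ _⟩)).differentiableAt (by simp)

lemma K0.continuousOn_fderiv (hφ : φ ∈ K0 T φT) :
    ContinuousOn (fderiv ℝ φ) (Ioo 0 T ×ˢ univ) :=
  (K0.contDiffOn hφ).continuousOn_fderiv_of_isOpen (isOpen_timeStrip T) (by simp)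

lemma K0.exists_bound (hφ : φ ∈ K0 T φT) :
    ∃ C, 0 ≤ C ∧ ∀ z : ℝ × E d, z.1 ∈ Icc 0 T → ‖φ z‖ ≤ C :=
  hφ.1.exists_bound hφ.2.1.continuousOn

lemma K0.exists_bound_fderiv (hT : 0 < T) (hφ : φ ∈ K0 T φT) :
    ∃ C, 0 ≤ C ∧ ∀ z : ℝ × E d, z.1 ∈ Ioo 0 T → ‖fderiv ℝ φ z‖ ≤ C := by
  have hK : IsCompact (Icc 0 T ×ˢ closedCell d) := isCompact_Icc.prod isCompact_closedCell
  have huniq : UniqueDiffOn ℝ (Icc 0 T ×ˢ (univ : Set (E d))) :=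
    (uniqueDiffOn_Icc hT).prod uniqueDiffOn_univ
  obtain ⟨C, hC⟩ := hK.exists_bound_of_continuousOn
    ((hφ.2.1.continuousOn_fderivWithin huniq (by simp)).mono
      (prod_mono Subset.rfl (subset_univ _)))
  refine ⟨max C 0, le_max_right _ _, fun z hz => ?_⟩
  have h1 := hC (z.1, z.2 + latticeVec (-floorVec z.2))
    ⟨Ioo_subset_Icc_self hz, unitCell_subset_closedCell (sub_floorVec_mem z.2)⟩
  have hnhds : Icc 0 T ×ˢ univ ∈ 𝓝 (z.1, z.2 + latticeVec (-floorVec z.2)) :=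
    mem_of_superset ((isOpen_timeStrip T).mem_nhds ⟨hz, mem_univ _⟩)
      (prod_mono Ioo_subset_Icc_self Subset.rfl)
  rw [fderivWithin_of_mem_nhds hnhds, (fderiv_periodic hφ.1).apply_add] at h1
  exact h1.trans (le_max_left _ _)

lemma K0.lipschitz_time (hφ : φ ∈ K0 T φT) {L : ℝ}
    (hL : ∀ z : ℝ × E d, z.1 ∈ Ioo 0 T → ‖fderiv ℝ φ z‖ ≤ L) {s t : ℝ} (hs : 0 ≤ s) (hst : s < t)
    (ht : t ≤ T) (x : E d) : |φ (t, x) - φ (s, x)| ≤ L * (t - s) := by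
  have hd : ∀ τ ∈ Ioo s t, HasDerivAt (fun τ => φ (τ, x)) (fderiv ℝ φ (τ, x) (1, 0)) τ :=
    fun τ hτ => hasDerivAt_slice (z := (τ, x))
      (K0.differentiableAt hφ ⟨hs.trans_lt hτ.1, hτ.2.trans_le ht⟩)
  have hc : ContinuousOn (fun τ => φ (τ, x)) (Icc s t) := by
    refine hφ.2.1.continuousOn.comp (by fun_prop) fun τ hτ => ?_
    exact ⟨⟨hs.trans hτ.1, hτ.2.trans ht⟩, mem_univ _⟩
  obtain ⟨τ, hτ, h⟩ := exists_hasDerivAt_eq_slope _ _ hst hc hd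
  have hts : 0 < t - s := by linarith
  rw [eq_div_iff hts.ne'] at h
  rw [← h, abs_mul, abs_of_pos hts]
  gcongr
  have h2 := (fderiv ℝ φ (τ, x)).le_opNorm (1, 0)
  rw [norm_one_zero, mul_one] at h2
  exact h2.trans (hL _ ⟨hs.trans_lt hτ.1, hτ.2.trans_le ht⟩)

lemma integrableOn_unitCell_of_continuous {g : E d → ℝ} (hc : Continuous g) :
    IntegrableOn g (unitCell d) :=
  (hc.continuousOn.integrableOn_compact isCompact_closedCell).mono_set
    unitCell_subset_closedCell

lemma K0.isTraceLeft (hT : 0 < T) (hφ : φ ∈ K0 T φT) (hp : TorusPeriodic φT)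
    (hc : Continuous φT) : IsTraceLeft φ T φT := by
  obtain ⟨L, h0, hL⟩ := K0.exists_bound_fderiv hT hφ
  refine ⟨hp, integrableOn_unitCell_of_continuous hc, ?_⟩
  refine tendsto_average_of_le (I := fun h => Ioo (T - h) T) (L := L) (fun _ => measurableSet_Ioo)
    (fun h _ => by simp) hT (u := fun z => φ z - φT z.2) ?_
  intro h h0 hT' t ht x
  have := K0.lipschitz_time hφ hL (s := t) (t := T) (by linarith [ht.1]) ht.2 le_rfl x
  rw [hφ.2.2, abs_sub_comm] at this
  refine this.trans ?_
  gcongr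
  linarith [ht.1]

lemma K0.isTraceRight (hT : 0 < T) (hφ : φ ∈ K0 T φT) :
    IsTraceRight φ 0 (fun x => φ (0, x)) := by
  obtain ⟨L, h0, hL⟩ := K0.exists_bound_fderiv hT hφ
  refine ⟨hφ.1 0, integrableOn_unitCell_of_continuous ?_, ?_⟩
  · refine continuousOn_univ.1 (hφ.2.1.continuousOn.comp (by fun_prop) fun x _ => ?_)
    exact ⟨⟨le_rfl, hT.le⟩, mem_univ _⟩
  refine tendsto_average_of_le (I := fun h => Ioo 0 (0 + h)) (L := L) (fun _ => measurableSet_Ioo)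
    (fun h _ => by simp) hT (u := fun z => φ z - φ (0, z.2)) ?_
  intro h h0 hT' t ht x
  have := K0.lipschitz_time hφ hL (s := 0) (t := t) le_rfl ht.1 (by linarith [ht.2]) x
  refine this.trans ?_
  gcongr
  linarith [ht.2]

lemma K0.integrableOn_mul_fderiv (hφ : φ ∈ K0 T φT) {ψ : ℝ × E d → ℝ} (hψ : IsTest T ψ)
    (v : ℝ × E d) : IntegrableOn (fun z => φ z * fderiv ℝ ψ z v) (spaceTime d T) := by
  obtain ⟨C, hC0, hC⟩ := K0.exists_bound hφ
  obtain ⟨C', hC0', hC'⟩ := hψ.exists_bound_fderiv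
  refine integrableOn_spaceTime_of_bounded (C := C * (C' * ‖v‖)) ?_ fun z hz => ?_
  · exact (K0.contDiffOn hφ).continuousOn.mul
      (hψ.continuous_fderiv.clm_apply continuous_const).continuousOn
  · rw [norm_mul]
    refine mul_le_mul (hC z (Ioo_subset_Icc_self hz)) ?_ (norm_nonneg _) hC0
    exact ((fderiv ℝ ψ z).le_opNorm v).trans (mul_le_mul_of_nonneg_right (hC' z) (norm_nonneg _))

lemma K0.integrableOn_fderiv_mul (hT : 0 < T) (hφ : φ ∈ K0 T φT) {ψ : ℝ × E d → ℝ}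
    (hψ : IsTest T ψ) (v : ℝ × E d) :
    IntegrableOn (fun z => fderiv ℝ φ z v * ψ z) (spaceTime d T) := by
  obtain ⟨C, hC0, hC⟩ := K0.exists_bound_fderiv hT hφ
  obtain ⟨C', hC0', hC'⟩ := hψ.exists_bound
  refine integrableOn_spaceTime_of_bounded (C := (C * ‖v‖) * C') ?_ fun z hz => ?_
  · exact ((K0.continuousOn_fderiv hφ).clm_apply continuousOn_const).mul
      hψ.contDiff.continuous.continuousOn
  · rw [norm_mul]
    refine mul_le_mul ?_ (hC' z) (norm_nonneg _) (by positivity)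
    exact ((fderiv ℝ φ z).le_opNorm v).trans (mul_le_mul_of_nonneg_right (hC z hz) (norm_nonneg _))

lemma K0.integral_by_parts (hT : 0 < T) (hφ : φ ∈ K0 T φT) {ψ : ℝ × E d → ℝ}
    (hψ : IsTest T ψ) (v : ℝ × E d) :
    ∫ z in spaceTime d T, φ z * fderiv ℝ ψ z v
      = - ∫ z in spaceTime d T, fderiv ℝ φ z v * ψ z :=
  setIntegral_mul_fderiv hφ.1 (K0.contDiffOn hφ) hψ v (K0.integrableOn_mul_fderiv hφ hψ v)
    (K0.integrableOn_fderiv_mul hT hφ hψ v)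

lemma IsTest.coord {Ψ : ℝ × E d → E d} (hΨ : IsTest T Ψ) (i : Fin d) :
    IsTest T fun z => Ψ z i where
  contDiff := by
    exact ((EuclideanSpace.proj i : E d →L[ℝ] ℝ).contDiff).comp hΨ.contDiff
  periodic := hΨ.periodic.comp (· i)
  support := by
    obtain ⟨a, b, ha, hb, h⟩ := hΨ.support
    exact ⟨a, b, ha, hb, fun z hz => by simp [h z hz]⟩

lemma K0.isBV (hT : 0 < T) (hφ : φ ∈ K0 T φT) : IsBV T φ where
  periodic := hφ.1
  integrable := by
    obtain ⟨C, -, hC⟩ := K0.exists_bound hφ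
    exact integrableOn_spaceTime_of_bounded (K0.contDiffOn hφ).continuousOn
      fun z hz => hC z (Ioo_subset_Icc_self hz)
  variation := by
    obtain ⟨L, hL0, hL⟩ := K0.exists_bound_fderiv hT hφ
    have hfin := isFiniteMeasure_spaceTime (d := d) T
    refine ⟨L * volume.real (spaceTime d T) + ∑ _i : Fin d, L * volume.real (spaceTime d T),
      fun ψ Ψ hψ hΨ h1 => ?_⟩
    have key : ∀ (η : ℝ × E d → ℝ) (v : ℝ × E d), IsTest T η → (∀ z, |η z| ≤ 1) → ‖v‖ ≤ 1 →
        ∫ z in spaceTime d T, φ z * fderiv ℝ η z v ≤ L * volume.real (spaceTime d T) := by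
      intro η v hη hη1 hv
      rw [K0.integral_by_parts hT hφ hη v]
      refine (neg_le_abs _).trans ?_
      have := norm_setIntegral_le_of_norm_le_const (f := fun z => fderiv ℝ φ z v * η z) (C := L)
        (volume_spaceTime_lt_top (d := d) T) (fun z hz => ?_)
      · exact this
      · rw [norm_mul]
        calc ‖fderiv ℝ φ z v‖ * ‖η z‖ ≤ (L * 1) * 1 := by
              refine mul_le_mul ?_ (hη1 z) (norm_nonneg _) (by positivity)
              exact ((fderiv ℝ φ z).le_opNorm v).trans
                (mul_le_mul (hL z hz.1) hv (norm_nonneg _) hL0)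
          _ = L := by ring
    have hsplit : ∀ z, φ z * (dt ψ z + divx Ψ z) = φ z * fderiv ℝ ψ z (1, 0)
        + ∑ i, φ z * fderiv ℝ (fun z => Ψ z i) z (0, EuclideanSpace.single i 1) := by
      intro z
      rw [hψ.dt_eq, divx_eq (hΨ.differentiable z), mul_add, Finset.mul_sum]
    simp only [hsplit]
    rw [integral_add (K0.integrableOn_mul_fderiv hφ hψ _)
      (integrable_finsetSum _ fun i _ => K0.integrableOn_mul_fderiv hφ (hΨ.coord i) _),
      integral_finsetSum _ fun i _ => K0.integrableOn_mul_fderiv hφ (hΨ.coord i) _]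
    refine add_le_add (key ψ _ hψ (fun z => ?_) norm_one_zero.le)
      (Finset.sum_le_sum fun i _ => key _ _ (hΨ.coord i) (fun z => ?_) ?_)
    · have := h1 z
      rw [← sq_le_one_iff_abs_le_one]
      nlinarith [sq_nonneg ‖Ψ z‖]
    · have h2 := h1 z
      have h3 : ‖Ψ z i‖ ≤ ‖Ψ z‖ := PiLp.norm_apply_le (Ψ z) i
      refine h3.trans (abs_le_of_sq_le_sq' ?_ zero_le_one).2
      nlinarith [sq_nonneg (ψ z)]
    · simp [Prod.norm_def]

lemma K0.isWeakGradient (hT : 0 < T) (hφ : φ ∈ K0 T φT) : IsWeakGradient T φ (Dx φ) := by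
  intro ψ hψ
  obtain ⟨C, hC0, hC⟩ := K0.exists_bound hφ
  obtain ⟨C', hC0', hC'⟩ := hψ.exists_bound_Dx
  obtain ⟨C₁, hC₁0, hC₁⟩ := K0.exists_bound_fderiv hT hφ
  obtain ⟨C₂, hC₂0, hC₂⟩ := hψ.exists_bound
  have hDc : ContinuousOn (Dx φ) (Ioo 0 T ×ˢ univ) :=
    (continuous_spaceGrad.comp_continuousOn (K0.continuousOn_fderiv hφ)).congr
      fun z hz => Dx_eq (K0.differentiableAt hφ hz.1)
  have hi1 : IntegrableOn (fun z => φ z • Dx ψ z) (spaceTime d T) := by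
    refine integrableOn_spaceTime_of_bounded (C := C * C')
      ((K0.contDiffOn hφ).continuousOn.smul hψ.continuous_Dx.continuousOn) fun z hz => ?_
    rw [norm_smul]
    exact mul_le_mul (hC z (Ioo_subset_Icc_self hz)) (hC' z) (norm_nonneg _) hC0
  have hi2 : IntegrableOn (fun z => ψ z • Dx φ z) (spaceTime d T) := by
    refine integrableOn_spaceTime_of_bounded (C := C₂ * C₁)
      (hψ.contDiff.continuous.continuousOn.smul hDc) fun z hz => ?_
    rw [norm_smul, Dx_eq (K0.differentiableAt hφ hz)]
    exact mul_le_mul (hC₂ z) ((norm_spaceGrad_le _).trans (hC₁ z hz)) (norm_nonneg _) hC₂0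
  refine ext_inner_left ℝ fun v => ?_
  rw [inner_neg_right, ← integral_inner hi1, ← integral_inner hi2]
  have h := K0.integral_by_parts hT hφ hψ (0, v)
  have e1 : ∀ z, inner ℝ v (φ z • Dx ψ z) = φ z * fderiv ℝ ψ z (0, v) := fun z => by
    rw [inner_smul_right, real_inner_comm, inner_Dx (hψ.differentiable z)]
  have e2 : ∫ z in spaceTime d T, inner ℝ v (ψ z • Dx φ z)
      = ∫ z in spaceTime d T, fderiv ℝ φ z (0, v) * ψ z := by
    refine setIntegral_congr_fun (measurableSet_spaceTime T) fun z hz => ?_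
    rw [inner_smul_right, real_inner_comm, inner_Dx (K0.differentiableAt hφ hz.1), mul_comm]
  simp only [e1]
  rw [h, e2]

/-- A smooth competitor `φ`, with `α = -∂ₜφ + H(x,Dφ)`, is a relaxed competitor. -/
lemma K0.mem_K (hT : 0 < T) {p q r : ℝ} {H : E d → E d → ℝ}
    (hH : HamiltonianAssumption q r H) (hφ : φ ∈ K0 T φT) (hp : TorusPeriodic φT)
    (hc : Continuous φT) :
    (φ, fun z => - dt φ z + H z.2 (Dx φ z)) ∈ K T p r H φT := by
  have hfin := isFiniteMeasure_spaceTime (d := d) T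
  obtain ⟨L, hL0, hL⟩ := K0.exists_bound_fderiv hT hφ
  obtain ⟨CH, hCH0, hCH⟩ := hH.exists_abs_le
  have hDc : ContinuousOn (Dx φ) (Ioo 0 T ×ˢ univ) :=
    (continuous_spaceGrad.comp_continuousOn (K0.continuousOn_fderiv hφ)).congr
      fun z hz => Dx_eq (K0.differentiableAt hφ hz.1)
  have hdtc : ContinuousOn (dt φ) (Ioo 0 T ×ˢ univ) :=
    ((K0.continuousOn_fderiv hφ).clm_apply continuousOn_const).congr
      fun z hz => dt_eq (K0.differentiableAt hφ hz.1)
  have hHc : ContinuousOn (fun z : ℝ × E d => H z.2 (Dx φ z)) (Ioo 0 T ×ˢ univ) :=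
    hH.continuous.comp_continuousOn (continuousOn_snd.prodMk hDc)
  have hDb : ∀ z : ℝ × E d, z.1 ∈ Ioo 0 T → ‖Dx φ z‖ ≤ L := fun z hz => by
    rw [Dx_eq (K0.differentiableAt hφ hz)]
    exact (norm_spaceGrad_le _).trans (hL z hz)
  have hdtb : ∀ z : ℝ × E d, z.1 ∈ Ioo 0 T → |dt φ z| ≤ L := fun z hz => by
    rw [dt_eq (K0.differentiableAt hφ hz)]
    have := (fderiv ℝ φ z).le_opNorm (1, 0)
    rw [norm_one_zero, mul_one] at this
    exact this.trans (hL z hz)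
  have hr := hH.r_pos
  have hHb : ∀ z : ℝ × E d, z.1 ∈ Ioo 0 T → |H z.2 (Dx φ z)| ≤ CH * L ^ r + CH := fun z hz => by
    refine (hCH _ _).trans ?_
    gcongr
    exact hDb z hz
  have hαb : ∀ z : ℝ × E d, z.1 ∈ Ioo 0 T →
      ‖- dt φ z + H z.2 (Dx φ z)‖ ≤ L + (CH * L ^ r + CH) := fun z hz => by
    refine (norm_add_le _ _).trans (add_le_add ?_ (hHb z hz))
    rw [norm_neg]
    exact hdtb z hz
  have hαc := hdtc.neg.add hHc
  have hHper : SpacePeriodic fun z : ℝ × E d => H z.2 (Dx φ z) := fun t k x => by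
    have h1 := Dx_periodic hφ.1 t k x
    simp only at h1 ⊢
    rw [h1]
    exact hH.periodic _ k x
  have hsub : spaceTime d T ⊆ Ioo 0 T ×ˢ univ := prod_mono Subset.rfl (subset_univ _)
  have hmem : ∀ᵐ z ∂volume.restrict (spaceTime d T), z.1 ∈ Ioo 0 T := by
    filter_upwards [ae_restrict_mem (measurableSet_spaceTime T)] with z hz using hz.1
  refine ⟨K0.isBV hT hφ, ⟨?_, ?_⟩, K0.isTraceLeft hT hφ hp hc, Dx φ,
    ⟨Dx_periodic hφ.1, ?_⟩, K0.isWeakGradient hT hφ, ?_⟩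
  · exact ((dt_periodic hφ.1).comp (- ·)).comp₂ hHper (· + ·)
  · refine MemLp.of_bound ?_ (L + (CH * L ^ r + CH)) (hmem.mono hαb)
    exact (hαc.mono hsub).aestronglyMeasurable (measurableSet_spaceTime T)
  · refine MemLp.of_bound ?_ L (hmem.mono hDb)
    exact (hDc.mono hsub).aestronglyMeasurable (measurableSet_spaceTime T)
  · intro ψ hψ _
    obtain ⟨Cψ, hCψ0, hCψ⟩ := hψ.exists_bound
    have hi1 : IntegrableOn (fun z => φ z * dt ψ z) (spaceTime d T) := by
      have := K0.integrableOn_mul_fderiv hφ hψ (1, 0)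
      simpa only [hψ.dt_eq] using this
    have hi2 : IntegrableOn (fun z => H z.2 (Dx φ z) * ψ z) (spaceTime d T) := by
      refine integrableOn_spaceTime_of_bounded (C := (CH * L ^ r + CH) * Cψ)
        (hHc.mul hψ.contDiff.continuous.continuousOn) fun z hz => ?_
      rw [norm_mul]
      exact mul_le_mul (hHb z hz) (hCψ z) (norm_nonneg _) (by positivity)
    have hi3 : IntegrableOn (fun z => -(fderiv ℝ φ z (1, 0) * ψ z)) (spaceTime d T) :=
      (K0.integrableOn_fderiv_mul hT hφ hψ (1, 0)).neg
    refine le_of_eq ?_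
    rw [integral_add hi1 hi2]
    have h1 := K0.integral_by_parts hT hφ hψ (1, 0)
    simp only [← hψ.dt_eq] at h1
    rw [h1, ← integral_neg, ← integral_add hi3 hi2]
    refine setIntegral_congr_fun (measurableSet_spaceTime T) fun z hz => ?_
    simp only [dt_eq (K0.differentiableAt hφ hz.1)]
    ring

end K0

lemma iInf_relaxedCost_le {T p q r : ℝ} (hT : 0 < T) {f : E d → ℝ → ℝ} {H : E d → E d → ℝ}
    {φT m₀ : E d → ℝ} (hH : HamiltonianAssumption q r H) (hb : BoundaryAssumption φT m₀) :
    (⨅ w ∈ K T p r H φT, relaxedCost T f m₀ w) ≤ ⨅ φ ∈ K0 T φT, smoothCost T f H m₀ φ := by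
  refine le_iInf₂ fun φ hφ => ?_
  refine iInf₂_le_of_le _ (K0.mem_K (p := p) hT hH hφ hb.terminal_periodic
    hb.terminal_contDiff.continuous) (le_of_eq ?_)
  have htr := K0.isTraceRight hT hφ
  have hae := IsTraceRight.ae_eq hT (K0.isBV hT hφ).integrable.1 (initialTrace_spec htr) htr
  simp only [relaxedCost, smoothCost, cost]
  congr 2
  refine integral_congr_ae ?_
  filter_upwards [hae] with x hx
  rw [hx]

end MFG

namespace MFG

/-! ### The conjugate cost -/

variable {d : ℕ} {f : E d → ℝ → ℝ}

lemma one_lt_p {p q : ℝ} (hq : 1 < q) (hpq : 1 / p + 1 / q = 1) : 1 < p := by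
  have h1 : 1 / q < 1 := by rw [div_lt_one (by linarith)]; exact hq
  have h2 : 0 < 1 / q := by positivity
  have h3 : 0 < 1 / p := by linarith
  have hp : 0 < p := one_div_pos.1 h3
  have h4 : 1 / p < 1 := by linarith
  rwa [div_lt_one hp] at h4

lemma conjPotential_le_iff {x : E d} {a : ℝ} {c : EReal} :
    conjPotential f x a ≤ c ↔
      ∀ m : ℝ, 0 ≤ m → ((a * m - ∫ τ in (0 : ℝ)..m, f x τ : ℝ) : EReal) ≤ c := by
  rw [conjPotential, iSup_le_iff]
  refine forall_congr' fun m => ?_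
  by_cases hm : 0 ≤ m
  · simp [potential, hm]
  · simp [potential, hm]

lemma le_conjPotential {x : E d} {a m : ℝ} (hm : 0 ≤ m) :
    ((a * m - ∫ τ in (0 : ℝ)..m, f x τ : ℝ) : EReal) ≤ conjPotential f x a :=
  conjPotential_le_iff.1 le_rfl m hm

lemma conjPotential_mono (x : E d) : Monotone (conjPotential f x) := by
  intro a b hab
  refine conjPotential_le_iff.2 fun m hm => le_trans ?_ (le_conjPotential hm)
  have : a * m ≤ b * m := mul_le_mul_of_nonneg_right hab hm
  exact_mod_cast sub_le_sub_right this _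

/-- The conjugate has growth of order `p`. -/
lemma exists_conjPotential_le {p q : ℝ} (hpq : 1 / p + 1 / q = 1) (hf : CouplingAssumption q f) :
    ∃ A C : ℝ, 0 < A ∧ 0 < C ∧ ∀ x a, conjPotential f x a ≤ ((A * (|a| + C) ^ p : ℝ) : EReal) := by
  obtain ⟨C, hC, hg⟩ := hf.growth
  have hq := hf.one_lt_q
  have hq0 : 0 < q := by linarith
  have hp := one_lt_p hq hpq
  have hp0 : 0 < p := by linarith
  have hconj : p.HolderConjugate q := by
    rw [Real.holderConjugate_iff]
    exact ⟨hp, by simpa using hpq⟩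
  set c : ℝ := C ^ (-(1 / q)) with hc
  have hc0 : 0 < c := by positivity
  have hcq : c ^ q = 1 / C := by
    rw [hc, ← Real.rpow_mul hC.le, neg_mul, one_div_mul_cancel hq0.ne', Real.rpow_neg_one, one_div]
  refine ⟨(c⁻¹) ^ p / p, C, by positivity, hC, fun x a => conjPotential_le_iff.2 fun m hm => ?_⟩
  rw [EReal.coe_le_coe_iff]
  have hcont : ContinuousOn (f x) (Icc 0 m) := by
    refine hf.continuousOn.comp (f := fun τ => (x, τ)) (by fun_prop) fun τ hτ => ?_
    exact ⟨mem_univ _, hτ.1⟩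
  have hF : 1 / C * (m ^ q / q) - C * m ≤ ∫ τ in (0 : ℝ)..m, f x τ := by
    have h1 : ∫ τ in (0 : ℝ)..m, (1 / C * τ ^ (q - 1) - C) = 1 / C * (m ^ q / q) - C * m := by
      rw [intervalIntegral.integral_sub, intervalIntegral.integral_const_mul,
        integral_rpow (Or.inl (by linarith)), intervalIntegral.integral_const]
      · simp [Real.zero_rpow hq0.ne']; ring
      · exact (intervalIntegral.intervalIntegrable_rpow' (by linarith)).const_mul _
      · exact intervalIntegrable_const
    rw [← h1]
    refine intervalIntegral.integral_mono_on hm ?_ ?_ fun τ hτ => (hg x τ hτ.1).1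
    · exact ((intervalIntegral.intervalIntegrable_rpow' (by linarith)).const_mul _).sub
        intervalIntegrable_const
    · exact ContinuousOn.intervalIntegrable (by rwa [uIcc_of_le hm])
  have hy := Real.young_inequality_of_nonneg (a := (|a| + C) * c⁻¹) (b := c * m)
    (by positivity) (by positivity) hconj
  have e1 : (|a| + C) * c⁻¹ * (c * m) = (|a| + C) * m := by field_simp
  rw [e1, Real.mul_rpow (by positivity) (by positivity), Real.mul_rpow hc0.le hm, hcq] at hy
  have h2 : a * m ≤ |a| * m := mul_le_mul_of_nonneg_right (le_abs_self a) hm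
  have e2 : 1 / C * (m ^ q / q) = 1 / C * m ^ q / q := by ring
  have e3 : (|a| + C) ^ p * c⁻¹ ^ p / p = c⁻¹ ^ p / p * (|a| + C) ^ p := by ring
  rw [e2] at hF
  rw [e3] at hy
  nlinarith

/-- Convexity of the conjugate, for its `ℝ≥0∞`-valued version. -/
lemma toENNReal_conjPotential_convex {p q : ℝ} (hpq : 1 / p + 1 / q = 1)
    (hf : CouplingAssumption q f) (x : E d) (a b : ℝ) {l : ℝ} (hl0 : 0 ≤ l) (hl1 : l ≤ 1) :
    (conjPotential f x ((1 - l) * a + l * b)).toENNReal ≤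
      ENNReal.ofReal (1 - l) * (conjPotential f x a).toENNReal
        + ENNReal.ofReal l * (conjPotential f x b).toENNReal := by
  obtain ⟨A, C, hA, hC, hg⟩ := exists_conjPotential_le hpq hf
  have hfin : ∀ a, ∃ c : ℝ, 0 ≤ c ∧ conjPotential f x a = (c : EReal) := by
    intro a
    have h0 := conjPotential_nonneg f x a
    have h1 := hg x a
    refine ⟨(conjPotential f x a).toReal, EReal.toReal_nonneg h0, ?_⟩
    rw [EReal.coe_toReal (ne_top_of_le_ne_top (EReal.coe_ne_top _) h1)]
    intro h
    rw [h] at h0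
    simp at h0
  obtain ⟨ca, hca0, hca⟩ := hfin a
  obtain ⟨cb, hcb0, hcb⟩ := hfin b
  have key : conjPotential f x ((1 - l) * a + l * b) ≤ (((1 - l) * ca + l * cb : ℝ) : EReal) := by
    refine conjPotential_le_iff.2 fun m hm => ?_
    have h1 := le_conjPotential (f := f) (x := x) (a := a) hm
    have h2 := le_conjPotential (f := f) (x := x) (a := b) hm
    rw [hca, EReal.coe_le_coe_iff] at h1
    rw [hcb, EReal.coe_le_coe_iff] at h2
    rw [EReal.coe_le_coe_iff]
    have h3 := mul_le_mul_of_nonneg_left h1 (sub_nonneg.2 hl1)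
    have h4 := mul_le_mul_of_nonneg_left h2 hl0
    nlinarith
  refine (EReal.toENNReal_le_toENNReal key).trans ?_
  rw [hca, hcb]
  simp only [EReal.toENNReal_of_ne_top (EReal.coe_ne_top _), EReal.toReal_coe]
  rw [ENNReal.ofReal_add (mul_nonneg (sub_nonneg.2 hl1) hca0) (mul_nonneg hl0 hcb0),
    ENNReal.ofReal_mul (sub_nonneg.2 hl1), ENNReal.ofReal_mul hl0]

lemma exists_toENNReal_conjPotential_le {p q : ℝ} (hpq : 1 / p + 1 / q = 1)
    (hf : CouplingAssumption q f) : ∃ A C : ℝ, 0 < A ∧ 0 < C ∧ ∀ x a,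
      (conjPotential f x a).toENNReal ≤ ENNReal.ofReal (A * (|a| + C) ^ p) := by
  obtain ⟨A, C, hA, hC, hg⟩ := exists_conjPotential_le hpq hf
  refine ⟨A, C, hA, hC, fun x a => (EReal.toENNReal_le_toENNReal (hg x a)).trans_eq ?_⟩
  simp only [EReal.toENNReal_of_ne_top (EReal.coe_ne_top _), EReal.toReal_coe]

end MFG

namespace MFG

/-! ### Mollified subsolutions -/

variable {d : ℕ}

lemma exists_kern_fderiv_le {ε : ℝ} (hε : 0 < ε) :
    ∃ C, 0 ≤ C ∧ ∀ w : ℝ × E d, ‖fderiv ℝ (kern ε) w‖ ≤ C :=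
  exists_bound_of_time (fderiv_periodic (kern_periodic ε))
    ((contDiff_kern ε).continuous_fderiv (by simp))
    (fderiv_eq_zero_of_time fun _ hz => kern_eq_zero hε hz)

lemma hasFDerivAt_avg {ε : ℝ} (hε : 0 < ε) {u : ℝ × E d → ℝ} (hu : SpacePeriodic u)
    (hi : Integrable u (cyl d)) (z : ℝ × E d) :
    HasFDerivAt (avg ε u) (∫ w, -(u w • fderiv ℝ (kern ε) (w - z)) ∂cyl d) z := by
  obtain ⟨C, hC0, hC⟩ := exists_kern_fderiv_le (d := d) hε
  obtain ⟨C', hC'⟩ := kern_bound (d := d) hε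
  have hfc : Continuous (fderiv ℝ (kern (d := d) ε)) :=
    (contDiff_kern ε).continuous_fderiv (by simp)
  have h1 : avg ε u = fun z => ∫ w, kern ε (w - z) • u w ∂cyl d := funext (avg_eq hε hu)
  rw [h1]
  refine hasFDerivAt_integral_of_dominated_of_fderiv_le (s := univ)
    (F := fun z w => kern ε (w - z) • u w)
    (F' := fun z w => -(u w • fderiv ℝ (kern ε) (w - z))) (bound := fun w => ‖u w‖ * C)
    univ_mem (Eventually.of_forall fun y => ?_) ?_ ?_ (ae_of_all _ fun w y _ => ?_)
    (hi.norm.mul_const C) (ae_of_all _ fun w y _ => ?_)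
  · exact ((contDiff_kern ε).continuous.comp
      (continuous_id.sub continuous_const)).aestronglyMeasurable.smul hi.1
  · exact hi.bdd_smul (C := C') ((contDiff_kern ε).continuous.comp
      (continuous_id.sub continuous_const)).aestronglyMeasurable (ae_of_all _ fun w => hC' _)
  · exact (hi.1.smul (hfc.comp
      (continuous_id.sub continuous_const)).aestronglyMeasurable).neg
  · rw [norm_neg, norm_smul]
    exact mul_le_mul_of_nonneg_left (hC _) (norm_nonneg _)
  · have h2 : HasFDerivAt (fun y : ℝ × E d => w - y) (-ContinuousLinearMap.id ℝ (ℝ × E d)) y :=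
      (hasFDerivAt_id y).const_sub w
    have h3 := (((contDiff_kern (d := d) ε).differentiable (by simp)) (w - y)).hasFDerivAt.comp y h2
    have h4 : HasFDerivAt (fun x => kern ε (w - x) • u w) (u w • (fderiv ℝ (kern ε) (w - y)).comp
        (-ContinuousLinearMap.id ℝ (ℝ × E d))) y := h3.mul_const (u w)
    have h5 : -(u w • fderiv ℝ (kern ε) (w - y)) = u w • (fderiv ℝ (kern ε) (w - y)).comp
        (-ContinuousLinearMap.id ℝ (ℝ × E d)) := by
      ext v <;> simp
    rw [h5]
    exact h4

lemma contDiff_avg {ε : ℝ} (hε : 0 < ε) {u : ℝ × E d → ℝ} (hu : SpacePeriodic u)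
    (hi : Integrable u (cyl d)) : ContDiff ℝ 1 (avg ε u) := by
  obtain ⟨C, hC0, hC⟩ := exists_kern_fderiv_le (d := d) hε
  have hfc : Continuous (fderiv ℝ (kern (d := d) ε)) :=
    (contDiff_kern ε).continuous_fderiv (by simp)
  rw [contDiff_one_iff_fderiv]
  refine ⟨fun z => (hasFDerivAt_avg hε hu hi z).differentiableAt, ?_⟩
  have : fderiv ℝ (avg ε u) = fun z => ∫ w, -(u w • fderiv ℝ (kern ε) (w - z)) ∂cyl d :=
    funext fun z => (hasFDerivAt_avg hε hu hi z).fderiv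
  rw [this]
  refine continuous_of_dominated (bound := fun w => ‖u w‖ * C) (fun z => ?_)
    (fun z => ae_of_all _ fun w => ?_) (hi.norm.mul_const C) (ae_of_all _ fun w => ?_)
  · exact (hi.1.smul (hfc.comp
      (continuous_id.sub continuous_const)).aestronglyMeasurable).neg
  · rw [norm_neg, norm_smul]
    exact mul_le_mul_of_nonneg_left (hC _) (norm_nonneg _)
  · have : Continuous fun x => fderiv ℝ (kern (d := d) ε) (w - x) :=
      hfc.comp (continuous_const.sub continuous_id)
    exact (this.const_smul (u w)).neg

/-- The translated kernel is an admissible test function. -/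
lemma isTest_kern {ε T : ℝ} (hε : 0 < ε) {z : ℝ × E d} (hz : 0 ≤ z.1) (hzT : z.1 + ε < T) :
    IsTest T fun w => kern ε (w - z) where
  contDiff := (contDiff_kern ε).comp (contDiff_id.sub contDiff_const)
  periodic := by
    have := (kern_periodic (d := d) ε).comp_add (-z)
    simpa only [← sub_eq_add_neg] using this
  support := by
    refine ⟨z.1 + ε / 2, z.1 + ε, by linarith, hzT, fun w hw => kern_eq_zero hε fun h => hw ?_⟩
    have h1 : (w - z).1 = w.1 - z.1 := rfl
    rw [h1] at h
    exact ⟨by linarith [h.1], by linarith [h.2]⟩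

lemma fderiv_avg_apply {ε : ℝ} (hε : 0 < ε) {u : ℝ × E d → ℝ} (hu : SpacePeriodic u)
    (hi : Integrable u (cyl d)) (z v : ℝ × E d) :
    fderiv ℝ (avg ε u) z v
      = - ∫ w, u w * fderiv ℝ (fun w => kern ε (w - z)) w v ∂cyl d := by
  obtain ⟨C, hC0, hC⟩ := exists_kern_fderiv_le (d := d) hε
  have hfc : Continuous (fderiv ℝ (kern (d := d) ε)) :=
    (contDiff_kern ε).continuous_fderiv (by simp)
  have hint : Integrable (fun w => -(u w • fderiv ℝ (kern ε) (w - z))) (cyl d) :=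
    (hi.smul_bdd (C := C) (hfc.comp
      (continuous_id.sub continuous_const)).aestronglyMeasurable (ae_of_all _ fun w => hC _)).neg
  rw [(hasFDerivAt_avg hε hu hi z).fderiv, ContinuousLinearMap.integral_apply hint,
    ← integral_neg]
  refine integral_congr_ae (ae_of_all _ fun w => ?_)
  have : fderiv ℝ (fun w => kern ε (w - z)) w = fderiv ℝ (kern ε) (w - z) :=
    fderiv_comp_sub z
  simp [this]

/-- `u` has distributional gradient `G` and satisfies `-∂_t u + H(x,G) ≤ A` in the sense of
distributions in `(0,T) × 𝕋^d`. The functions are defined and integrable on the whole cylinder, so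
that their averages make sense everywhere; only test functions supported in `(0,T)` are used. -/
structure WeakSubsolution (T : ℝ) (H : E d → E d → ℝ) (u : ℝ × E d → ℝ) (G : ℝ × E d → E d)
    (A : ℝ × E d → ℝ) : Prop where
  u_per : SpacePeriodic u
  u_int : Integrable u (cyl d)
  G_per : SpacePeriodic G
  G_int : Integrable G (cyl d)
  A_per : SpacePeriodic A
  A_int : Integrable A (cyl d)
  grad : ∀ ψ : ℝ × E d → ℝ, IsTest T ψ → ∫ z, u z • Dx ψ z ∂cyl d = - ∫ z, ψ z • G z ∂cyl d
  sub : ∀ ψ : ℝ × E d → ℝ, IsTest T ψ → (∀ z, 0 ≤ ψ z) →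
    ∫ z, u z * dt ψ z ∂cyl d + ∫ z, H z.2 (G z) * ψ z ∂cyl d ≤ ∫ z, A z * ψ z ∂cyl d

lemma WeakSubsolution.Dx_avg {T : ℝ} {H : E d → E d → ℝ} {u : ℝ × E d → ℝ} {G : ℝ × E d → E d}
    {A : ℝ × E d → ℝ} (h : WeakSubsolution T H u G A) {ε : ℝ} (hε : 0 < ε) {z : ℝ × E d}
    (hz : 0 ≤ z.1) (hzT : z.1 + ε < T) : Dx (avg ε u) z = avg ε G z := by
  have hψ := isTest_kern hε hz hzT
  have hd := (contDiff_avg hε h.u_per h.u_int).differentiable (by simp) z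
  obtain ⟨C, hC0, hC⟩ := hψ.exists_bound_Dx
  have hi1 : Integrable (fun w => u w • Dx (fun w => kern ε (w - z)) w) (cyl d) :=
    h.u_int.smul_bdd (C := C) hψ.continuous_Dx.aestronglyMeasurable (ae_of_all _ hC)
  have hg := h.grad _ hψ
  rw [avg_eq hε h.G_per z, ← neg_eq_iff_eq_neg.2 hg]
  refine ext_inner_right ℝ fun v => ?_
  rw [inner_Dx hd, fderiv_avg_apply hε h.u_per h.u_int, inner_neg_left, real_inner_comm,
    ← integral_inner hi1]
  congr 1
  refine integral_congr_ae (ae_of_all _ fun w => ?_)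
  simp only
  rw [inner_smul_right, real_inner_comm, inner_Dx (hψ.differentiable w)]

lemma SpacePeriodic.hamiltonian {q r : ℝ} {H : E d → E d → ℝ} (hH : HamiltonianAssumption q r H)
    {G : ℝ × E d → E d} (hG : SpacePeriodic G) : SpacePeriodic fun z => H z.2 (G z) := by
  intro t k x
  have h1 := hG t k x
  simp only at h1 ⊢
  rw [h1]
  exact hH.periodic _ k x

lemma WeakSubsolution.dt_avg {T q r : ℝ} {H : E d → E d → ℝ} (hH : HamiltonianAssumption q r H)
    {u : ℝ × E d → ℝ} {G : ℝ × E d → E d}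
    {A : ℝ × E d → ℝ} (h : WeakSubsolution T H u G A) {ε : ℝ} (hε : 0 < ε) {z : ℝ × E d}
    (hz : 0 ≤ z.1) (hzT : z.1 + ε < T) :
    - dt (avg ε u) z + avg ε (fun w => H w.2 (G w)) z ≤ avg ε A z := by
  have hψ := isTest_kern hε hz hzT
  have hd := (contDiff_avg hε h.u_per h.u_int).differentiable (by simp) z
  have hs := h.sub _ hψ fun w => kern_nonneg hε _
  rw [dt_eq hd, fderiv_avg_apply hε h.u_per h.u_int, neg_neg,
    avg_eq hε (h.G_per.hamiltonian hH), avg_eq hε h.A_per]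
  simp only [hψ.dt_eq] at hs
  simpa only [smul_eq_mul, mul_comm] using hs

lemma split_rpow {X R θ r : ℝ} (hX : 0 < X) (hR : 0 < R) (hθ : 0 ≤ θ) (hθr : θ ≤ r) :
    X ^ θ ≤ R ^ θ + R ^ (θ - r) * X ^ r := by
  rcases le_total X R with h | h
  · have := Real.rpow_le_rpow hX.le h hθ
    have h2 : 0 ≤ R ^ (θ - r) * X ^ r := by positivity
    linarith
  · have h1 : X ^ (θ - r) ≤ R ^ (θ - r) := Real.rpow_le_rpow_of_nonpos hR h (by linarith)
    have h2 : X ^ θ = X ^ (θ - r) * X ^ r := by rw [← Real.rpow_add hX]; congr 1; ring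
    have h3 : 0 ≤ R ^ θ := by positivity
    rw [h2]
    nlinarith [mul_le_mul_of_nonneg_right h1 (by positivity : 0 ≤ X ^ r)]

/-- The commutator between forward averaging and the nonlinear Hamiltonian is of order `ε^κ`. The
kernel has size `ε^{-(d+1)}`, so the average of `|G|^θ` is at most of order `ε^{-(d+1)θ/r}`, and
`θ < r/(d+1)` makes the modulus of continuity of `H` in `x` win. -/
lemma exists_hamiltonian_avg_le {q r : ℝ} {H : E d → E d → ℝ} (hH : HamiltonianAssumption q r H)
    {G : ℝ × E d → E d} (hG : SpacePeriodic G) (hGi : Integrable G (cyl d))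
    (hGr : Integrable (fun z => ‖G z‖ ^ r) (cyl d)) :
    ∃ κ : ℝ, 0 < κ ∧ ∃ C : ℝ, 0 ≤ C ∧ ∀ ε : ℝ, 0 < ε → ε ≤ 1 → ∀ z : ℝ × E d,
      H z.2 (avg ε G z) ≤ avg ε (fun w => H w.2 (G w)) z + C * ε ^ κ := by
  obtain ⟨θ, CL, hθ0, hθr, hCL, hLip⟩ := hH.lipschitz
  obtain ⟨CH, hCH0, hCH⟩ := hH.exists_abs_le
  obtain ⟨CK, hCK0, hCK⟩ := exists_kern_le d
  have hr := hH.r_pos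
  have hr0 : 0 < r := by linarith
  have hd : (0 : ℝ) < d + 1 := by positivity
  set I : ℝ := ∫ w, ‖G w‖ ^ r ∂cyl d with hI
  have hI0 : 0 ≤ I := integral_nonneg fun _ => by positivity
  have hθr' : θ ≤ r := by
    refine hθr.le.trans (div_le_self hr0.le ?_)
    have : (0 : ℝ) ≤ d := Nat.cast_nonneg d
    linarith
  refine ⟨1 - (d + 1) * θ / r, ?_, CL * (2 + CK * I), by positivity, fun ε hε hε1 z => ?_⟩
  · rw [lt_div_iff₀ hd] at hθr
    rw [sub_pos, div_lt_one hr0]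
    linarith
  have := isProbabilityMeasure_mollifier (d := d) hε hε1
  have hGz := integrable_mollifier_add hε hG hGi z
  have hGrp : SpacePeriodic fun z => ‖G z‖ ^ r := hG.comp (fun a => ‖a‖ ^ r)
  have hGrz := integrable_mollifier_add hε hGrp hGr z
  have hm1 : AEStronglyMeasurable (fun w => H z.2 (G (z + w))) (mollifier d ε) :=
    hH.continuous.comp_aestronglyMeasurable
      ((continuous_const (y := z.2)).aestronglyMeasurable.prodMk hGz.1)
  have hm2 : AEStronglyMeasurable (fun w => H (z + w).2 (G (z + w))) (mollifier d ε) :=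
    hH.continuous.comp_aestronglyMeasurable
      (Continuous.aestronglyMeasurable (f := fun w : ℝ × E d => (z + w).2) (by fun_prop)
        |>.prodMk hGz.1)
  have hb : Integrable (fun w => CH * ‖G (z + w)‖ ^ r + CH) (mollifier d ε) :=
    (hGrz.const_mul CH).add (integrable_const _)
  have hi1 : Integrable (fun w => H z.2 (G (z + w))) (mollifier d ε) :=
    hb.mono' hm1 (ae_of_all _ fun w => hCH _ _)
  have hi2 : Integrable (fun w => H (z + w).2 (G (z + w))) (mollifier d ε) :=
    hb.mono' hm2 (ae_of_all _ fun w => hCH _ _)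
  set R : ℝ := ε ^ (-((d + 1) / r)) with hR
  have hR0 : 0 < R := by positivity
  have hjensen : H z.2 (avg ε G z) ≤ ∫ w, H z.2 (G (z + w)) ∂mollifier d ε :=
    (hH.convex z.2).map_integral_le (hH.differentiable z.2).continuous.continuousOn isClosed_univ
      (ae_of_all _ fun _ => mem_univ _) hGz hi1
  set rhs : ℝ × E d → ℝ := fun w => H (z + w).2 (G (z + w))
    + CL * ε * (R ^ θ + R ^ (θ - r) * (‖G (z + w)‖ ^ r + 1)) with hrhs
  have hi3 : Integrable (fun w => CL * ε * (R ^ θ + R ^ (θ - r) * (‖G (z + w)‖ ^ r + 1)))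
      (mollifier d ε) :=
    ((integrable_const _).add ((hGrz.add (integrable_const 1)).const_mul _)).const_mul _
  have hpt : ∀ᵐ w ∂mollifier d ε, H z.2 (G (z + w)) ≤ rhs w := by
    filter_upwards [ae_mollifier hε] with w ⟨_, k, hk⟩
    set ξ := G (z + w)
    have h1 := hLip (z.2 + (w.2 + latticeVec k)) z.2 ξ
    have h2 : H (z.2 + (w.2 + latticeVec k)) ξ = H (z + w).2 ξ := by
      rw [← add_assoc]; exact hH.periodic ξ k _
    rw [h2, add_sub_cancel_left, abs_le] at h1
    have hmax : 0 < max ‖ξ‖ 1 := lt_max_of_lt_right one_pos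
    have h3 := split_rpow hmax hR0 hθ0 hθr'
    have h4 : (max ‖ξ‖ 1) ^ r ≤ ‖ξ‖ ^ r + 1 := by
      rcases max_cases ‖ξ‖ 1 with ⟨h, _⟩ | ⟨h, _⟩
      · rw [h]; linarith
      · rw [h, Real.one_rpow]
        have : 0 ≤ ‖ξ‖ ^ r := by positivity
        linarith
    have h5 : CL * ‖w.2 + latticeVec k‖ * (max ‖ξ‖ 1) ^ θ
        ≤ CL * ε * (R ^ θ + R ^ (θ - r) * (‖ξ‖ ^ r + 1)) := by
      gcongr
      exact h3.trans (by gcongr)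
    have h6 := h1.1
    simp only [hrhs]
    linarith
  have hint := integral_mono_ae hi1 (hi2.add hi3) hpt
  have e1 : ∫ w, (H (z + w).2 (G (z + w))
      + CL * ε * (R ^ θ + R ^ (θ - r) * (‖G (z + w)‖ ^ r + 1))) ∂mollifier d ε
      = avg ε (fun w => H w.2 (G w)) z
        + CL * ε * (R ^ θ + R ^ (θ - r) * (avg ε (fun w => ‖G w‖ ^ r) z + 1)) := by
    have hi4 : Integrable (fun w => ‖G (z + w)‖ ^ r + 1) (mollifier d ε) :=
      hGrz.add (integrable_const 1)
    rw [integral_add hi2 hi3, integral_const_mul, integral_add (integrable_const _)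
      (hi4.const_mul _), integral_const_mul, integral_add hGrz (integrable_const 1)]
    simp [avg]
  have e2 : avg ε (fun w => ‖G w‖ ^ r) z ≤ CK / ε ^ (d + 1) * I := by
    rw [avg_eq hε hGrp, hI, ← integral_const_mul]
    have hbd : Integrable (fun w => kern ε (w - z) • ‖G w‖ ^ r) (cyl d) := by
      obtain ⟨C', hC'⟩ := kern_bound (d := d) hε
      exact hGr.bdd_smul (C := C') ((contDiff_kern ε).continuous.comp
        (continuous_id.sub continuous_const)).aestronglyMeasurable (ae_of_all _ fun w => hC' _)
    refine integral_mono hbd (hGr.const_mul _) fun w => ?_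
    exact mul_le_mul_of_nonneg_right (hCK ε hε hε1 _) (by positivity)
  have e3 : R ^ θ = ε ^ (-((d + 1) * θ / r)) := by
    rw [hR, ← Real.rpow_mul hε.le]; congr 1; ring
  have e4 : R ^ (θ - r) = ε ^ (-((d + 1) * θ / r)) * ε ^ (d + 1) := by
    rw [hR, ← Real.rpow_mul hε.le, ← Real.rpow_natCast, ← Real.rpow_add hε]
    congr 1
    push_cast
    field_simp
    ring
  have hεd : ε ^ (d + 1) ≤ 1 := pow_le_one₀ hε.le hε1
  have hεd0 : 0 < ε ^ (d + 1) := by positivity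
  set S := ε ^ (-((d + 1) * θ / r)) with hS
  have hS0 : 0 < S := by positivity
  have e5 : R ^ θ + R ^ (θ - r) * (avg ε (fun w => ‖G w‖ ^ r) z + 1) ≤ S * (2 + CK * I) := by
    rw [e3, e4]
    calc S + S * ε ^ (d + 1) * (avg ε (fun w => ‖G w‖ ^ r) z + 1)
        ≤ S + S * ε ^ (d + 1) * (CK / ε ^ (d + 1) * I + 1) := by gcongr
      _ = S * (1 + CK * I + ε ^ (d + 1)) := by field_simp; ring
      _ ≤ S * (2 + CK * I) := by
        refine mul_le_mul_of_nonneg_left ?_ hS0.le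
        linarith
  have e6 : ε ^ (1 - (d + 1) * θ / r) = ε * S := by
    rw [hS, sub_eq_add_neg, Real.rpow_add hε, Real.rpow_one]
  rw [e6]
  calc H z.2 (avg ε G z) ≤ _ := hjensen
    _ ≤ _ := hint
    _ = _ := e1
    _ ≤ avg ε (fun w => H w.2 (G w)) z + CL * ε * (S * (2 + CK * I)) := by gcongr
    _ = _ := by ring

end MFG

namespace MFG

/-! ### Extension past the terminal time -/

variable {d : ℕ} {V : Type*} [NormedAddCommGroup V]

/-- `v` on `(0,T)`, continued by the time-independent function `g` on `[T,T+1)` and by `0`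
elsewhere. -/
noncomputable def extend (T : ℝ) (v : ℝ × E d → V) (g : E d → V) : ℝ × E d → V := fun z =>
  indicator (Ioo 0 T ×ˢ univ) (fun z => v z - g z.2) z
    + indicator (Ioo 0 (T + 1) ×ˢ univ) (fun z => g z.2) z

lemma extend_of_mem {T : ℝ} {v : ℝ × E d → V} {g : E d → V} {z : ℝ × E d} (hz : z.1 ∈ Ioo 0 T) :
    extend T v g z = v z := by
  have h1 : z ∈ Ioo 0 T ×ˢ (univ : Set (E d)) := ⟨hz, mem_univ _⟩
  have h2 : z ∈ Ioo 0 (T + 1) ×ˢ (univ : Set (E d)) := ⟨⟨hz.1, by linarith [hz.2]⟩, mem_univ _⟩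
  simp [extend, indicator_of_mem h1, indicator_of_mem h2]

lemma extend_of_ge {T : ℝ} (hT : 0 < T) {v : ℝ × E d → V} {g : E d → V} {z : ℝ × E d}
    (hz : z.1 ∈ Ico T (T + 1)) : extend T v g z = g z.2 := by
  have h1 : z ∉ Ioo 0 T ×ˢ (univ : Set (E d)) := fun h => (h.1.2.trans_le hz.1).false
  have h2 : z ∈ Ioo 0 (T + 1) ×ˢ (univ : Set (E d)) := ⟨⟨hT.trans_le hz.1, hz.2⟩, mem_univ _⟩
  simp [extend, indicator_of_notMem h1, indicator_of_mem h2]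

lemma extend_periodic {T : ℝ} {v : ℝ × E d → V} {g : E d → V} (hv : SpacePeriodic v)
    (hg : TorusPeriodic g) : SpacePeriodic (extend T v g) := by
  intro t k x
  have h1 := hv t k x
  simp only at h1
  simp only [extend, indicator, mem_prod, mem_univ, and_true, h1, hg k x]

lemma continuous_comp_snd {g : E d → V} (hg : Continuous g) :
    Continuous fun z : ℝ × E d => g z.2 := hg.comp continuous_snd

lemma memLp_extend {T : ℝ} {p : ℝ≥0∞} {v : ℝ × E d → V} {g : E d → V}
    (hv : MemLp v p (volume.restrict (spaceTime d T))) (hg : TorusPeriodic g)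
    (hc : Continuous g) : MemLp (extend T v g) p (cyl d) := by
  obtain ⟨C, -, hC⟩ := hg.exists_bound hc
  have hb : ∀ T, MemLp (fun z : ℝ × E d => g z.2) p (volume.restrict (spaceTime d T)) := by
    intro T
    have := isFiniteMeasure_spaceTime (d := d) T
    exact MemLp.of_bound (continuous_comp_snd hc).aestronglyMeasurable C (ae_of_all _ fun _ => hC _)
  refine MemLp.add ?_ ?_
  · rw [memLp_indicator_iff_restrict (measurableSet_Ioo.prod MeasurableSet.univ),
      ← volume_restrict_spaceTime]
    exact hv.sub (hb T)
  · rw [memLp_indicator_iff_restrict (measurableSet_Ioo.prod MeasurableSet.univ),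
      ← volume_restrict_spaceTime]
    exact hb _

lemma integrable_extend {T : ℝ} {v : ℝ × E d → V} {g : E d → V}
    (hv : IntegrableOn v (spaceTime d T)) (hg : TorusPeriodic g)
    (hc : Continuous g) : Integrable (extend T v g) (cyl d) :=
  memLp_one_iff_integrable.1 (memLp_extend (memLp_one_iff_integrable.2 hv) hg hc)

section Bilin

variable [NormedSpace ℝ V] {V' W : Type*} [NormedAddCommGroup V'] [NormedSpace ℝ V']
  [NormedAddCommGroup W] [NormedSpace ℝ W]

lemma integrable_bilin {X : Type*} [MeasurableSpace X] {μ : Measure X} (B : V →L[ℝ] V' →L[ℝ] W)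
    {v : X → V} {θ : X → V'} (hv : Integrable v μ) (hθ : AEStronglyMeasurable θ μ) {C : ℝ}
    (hC : ∀ x, ‖θ x‖ ≤ C) : Integrable (fun x => B (v x) (θ x)) μ := by
  refine Integrable.mono' (g := fun x => ‖B‖ * ‖v x‖ * C)
    ((hv.norm.const_mul ‖B‖).mul_const C) ?_ (ae_of_all _ fun x => ?_)
  · exact B.aestronglyMeasurable_comp₂ hv.1 hθ
  · refine (B.le_opNorm₂ _ _).trans ?_
    exact mul_le_mul_of_nonneg_left (hC x) (by positivity)

/-- Pairing an extended function with a test object on `(0,T+1)`. -/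
lemma integral_extend_bilin {T : ℝ} (B : V →L[ℝ] V' →L[ℝ] W) {v : ℝ × E d → V}
    {g : E d → V} (hv : IntegrableOn v (spaceTime d T)) (hg : TorusPeriodic g)
    (hc : Continuous g) {θ : ℝ × E d → V'} (hθ : Continuous θ) {C : ℝ} (hC : ∀ z, ‖θ z‖ ≤ C)
    (h0 : ∀ z : ℝ × E d, z.1 ∉ Ioo 0 (T + 1) → θ z = 0) :
    ∫ z, B (extend T v g z) (θ z) ∂cyl d
      = (∫ z in spaceTime d T, B (v z - g z.2) (θ z)) + ∫ z, B (g z.2) (θ z) ∂cyl d := by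
  obtain ⟨Cg, hCg0, hCg⟩ := hg.exists_bound hc
  have hfin := isFiniteMeasure_spaceTime (d := d) T
  have hgi : IntegrableOn (fun z : ℝ × E d => g z.2) (spaceTime d T) :=
    Integrable.of_bound (continuous_comp_snd hc).aestronglyMeasurable Cg (ae_of_all _ fun _ => hCg _)
  have e : ∀ z, B (extend T v g z) (θ z)
      = indicator (Ioo 0 T ×ˢ univ) (fun z => B (v z - g z.2) (θ z)) z + B (g z.2) (θ z) := by
    intro z
    by_cases h : z.1 ∈ Ioo 0 T
    · rw [extend_of_mem h, indicator_of_mem (by exact ⟨h, mem_univ _⟩), map_sub]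
      simp
    · rw [indicator_of_notMem (fun h' => h h'.1), zero_add]
      by_cases h2 : z.1 ∈ Ioo 0 (T + 1)
      · have : extend T v g z = g z.2 := by
          have h3 : z ∉ Ioo 0 T ×ˢ (univ : Set (E d)) := fun h' => h h'.1
          have h4 : z ∈ Ioo 0 (T + 1) ×ˢ (univ : Set (E d)) := ⟨h2, mem_univ _⟩
          simp [extend, indicator_of_notMem h3, indicator_of_mem h4]
        rw [this]
      · rw [h0 z h2]; simp
  simp only [e]
  rw [integral_add, integral_indicator (measurableSet_Ioo.prod MeasurableSet.univ),
    ← volume_restrict_spaceTime]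
  · rw [integrable_indicator_iff (measurableSet_Ioo.prod MeasurableSet.univ), IntegrableOn,
      ← volume_restrict_spaceTime]
    exact integrable_bilin B (hv.sub hgi) hθ.aestronglyMeasurable hC
  · refine integrable_cyl_of_bounded (a := 0) (b := T + 1) (C := ‖B‖ * Cg * C)
      (B.aestronglyMeasurable_comp₂ (continuous_comp_snd hc).aestronglyMeasurable
        hθ.aestronglyMeasurable) (fun z => ?_) fun z hz => ?_
    · refine (B.le_opNorm₂ _ _).trans ?_
      gcongr
      · exact hCg _
      · exact hC z
    · rw [h0 z fun h => hz (Ioo_subset_Icc_self h), map_zero]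

end Bilin

/-- Test function cut off before the terminal time `T`. -/
noncomputable def cutoff (T h : ℝ) (ψ : ℝ × E d → ℝ) (z : ℝ × E d) : ℝ :=
  timeStep h (T - z.1) * ψ z

section Cutoff

variable {T h : ℝ} {ψ : ℝ × E d → ℝ}

lemma isTest_cutoff (hh : 0 < h) (hψ : IsTest (T + 1) ψ) : IsTest T (cutoff T h ψ) where
  contDiff := ((contDiff_timeStep h).comp (contDiff_const.sub contDiff_fst)).mul hψ.contDiff
  periodic := fun t k x => by
    have := hψ.periodic t k x
    simp only at this
    simp only [cutoff, this]
  support := by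
    obtain ⟨a, b, ha, hb, h0⟩ := hψ.support
    refine ⟨a, T - h / 2, ha, by linarith, fun z hz => ?_⟩
    rw [mem_Icc, not_and_or, not_le, not_le] at hz
    rcases hz with hz | hz
    · rw [cutoff, h0 z fun h' => (hz.trans_le h'.1).false, mul_zero]
    · rw [cutoff, timeStep_eq_zero hh (by linarith), zero_mul]

lemma dt_cutoff (hψ : IsTest (T + 1) ψ) (z : ℝ × E d) :
    dt (cutoff T h ψ) z = timeStep h (T - z.1) * dt ψ z - timeKernel h (T - z.1) * ψ z := by
  have h1 : HasDerivAt (fun t => timeStep h (T - t)) (-timeKernel h (T - z.1)) z.1 := by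
    have : HasDerivAt (fun t => timeStep h (T - t)) (timeKernel h (T - z.1) * (-1)) z.1 :=
      (hasDerivAt_timeStep h (T - z.1)).comp z.1 ((hasDerivAt_id z.1).const_sub T)
    simpa using this
  have h2 := hasDerivAt_slice (hψ.differentiable z)
  have h3 : HasDerivAt (fun t => timeStep h (T - t) * ψ (t, z.2))
      (-timeKernel h (T - z.1) * ψ z + timeStep h (T - z.1) * fderiv ℝ ψ z (1, 0)) z.1 := h1.mul h2
  rw [hψ.dt_eq]
  refine h3.deriv.trans ?_
  ring

lemma Dx_cutoff (hψ : IsTest (T + 1) ψ) (z : ℝ × E d) :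
    Dx (cutoff T h ψ) z = timeStep h (T - z.1) • Dx ψ z := by
  have h1 := (hasFDerivAt_space_slice (hψ.differentiable z)).const_mul (timeStep h (T - z.1))
  rw [hψ.Dx_eq]
  simp only [Dx, cutoff, gradient]
  rw [h1.fderiv, spaceGrad, map_smul]

lemma cutoff_nonneg (h0 : ∀ z, 0 ≤ ψ z) (z : ℝ × E d) : 0 ≤ cutoff T h ψ z :=
  mul_nonneg (timeStep_nonneg _ _) (h0 z)

lemma tendsto_integral_cutoff {V : Type*} [NormedAddCommGroup V] [NormedSpace ℝ V]
    {F : ℝ × E d → V} (hF : IntegrableOn F (spaceTime d T)) :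
    Tendsto (fun h => ∫ z in spaceTime d T, timeStep h (T - z.1) • F z) (𝓝[>] 0)
      (𝓝 (∫ z in spaceTime d T, F z)) := by
  refine tendsto_integral_filter_of_dominated_convergence (fun z => ‖F z‖)
    (Eventually.of_forall fun h => ?_) (Eventually.of_forall fun h => ae_of_all _ fun z => ?_)
    hF.norm ?_
  · exact (((contDiff_timeStep h).continuous.comp
      (continuous_const.sub continuous_fst)).aestronglyMeasurable).smul hF.1
  · rw [norm_smul, Real.norm_of_nonneg (timeStep_nonneg _ _)]
    exact mul_le_of_le_one_left (norm_nonneg _) (timeStep_le_one _ _)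
  · filter_upwards [ae_restrict_mem (measurableSet_spaceTime T)] with z hz
    refine tendsto_const_nhds.congr' ?_
    have hz' : 0 < T - z.1 := sub_pos.2 hz.1.2
    filter_upwards [Ioo_mem_nhdsGT hz'] with h hh
    rw [timeStep_eq_one hh.1 hh.2.le, one_smul]

/-- The boundary layer created by the cutoff is killed by the trace condition at time `T`. -/
lemma tendsto_boundary_layer (hT : 0 < T) {φ : ℝ × E d → ℝ} {g : E d → ℝ}
    (htr : IsTraceLeft φ T g)
    (hψ : IsTest (T + 1) ψ) :
    Tendsto (fun h => ∫ z in spaceTime d T, timeKernel h (T - z.1) * ((φ z - g z.2) * ψ z))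
      (𝓝[>] 0) (𝓝 0) := by
  obtain ⟨L, hL, hLb⟩ := exists_timeKernel_le
  obtain ⟨C, hC0, hC⟩ := hψ.exists_bound
  have hlim := ENNReal.Tendsto.const_mul (a := ENNReal.ofReal (L * C)) htr.2.2
    (Or.inr ENNReal.ofReal_ne_top)
  rw [mul_zero] at hlim
  rw [tendsto_zero_iff_norm_tendsto_zero]
  simp only [← toReal_enorm]
  refine ENNReal.toReal_zero ▸ (ENNReal.tendsto_toReal ENNReal.zero_ne_top).comp (f := fun h : ℝ =>
    ‖∫ z in spaceTime d T, timeKernel h (T - z.1) * ((φ z - g z.2) * ψ z)‖ₑ) ?_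
  refine tendsto_of_tendsto_of_tendsto_of_le_of_le' tendsto_const_nhds hlim
    (Eventually.of_forall fun _ => zero_le) ?_
  filter_upwards [Ioo_mem_nhdsGT hT] with h hh
  have hh0 := hh.1
  refine (enorm_integral_le_lintegral_enorm _).trans ?_
  have hsub : Ioo (T - h) T ×ˢ unitCell d ⊆ spaceTime d T :=
    prod_mono (Ioo_subset_Ioo (by linarith [hh.2]) le_rfl) Subset.rfl
  have hpt : ∀ z ∈ spaceTime d T, ‖timeKernel h (T - z.1) * ((φ z - g z.2) * ψ z)‖ₑ ≤
      indicator (Ioo (T - h) T ×ˢ unitCell d ∪ {T - h} ×ˢ univ)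
        (fun z => ENNReal.ofReal (L * C) / ENNReal.ofReal h * ‖φ z - g z.2‖ₑ) z := by
    intro z hz
    by_cases hzm : T - h ≤ z.1
    · have hmem : z ∈ Ioo (T - h) T ×ˢ unitCell d ∪ {T - h} ×ˢ univ := by
        rcases hzm.eq_or_lt with h' | h'
        · exact Or.inr ⟨h'.symm, mem_univ _⟩
        · exact Or.inl ⟨⟨h', hz.1.2⟩, hz.2⟩
      rw [indicator_of_mem hmem, ← ENNReal.ofReal_div_of_pos hh0, ← ofReal_norm,
        ← ofReal_norm, ← ENNReal.ofReal_mul (div_nonneg (mul_nonneg hL.le hC0) hh0.le)]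
      refine ENNReal.ofReal_le_ofReal ?_
      rw [norm_mul, norm_mul, Real.norm_of_nonneg (timeKernel_nonneg hh0 _)]
      calc timeKernel h (T - z.1) * (‖φ z - g z.2‖ * ‖ψ z‖)
          ≤ L / h * (‖φ z - g z.2‖ * C) := by
            gcongr
            · exact div_nonneg hL.le hh0.le
            · exact hLb h hh0 _
            · exact hC z
        _ = _ := by ring
    · rw [timeKernel_eq_zero hh0 fun h' => hzm (by linarith [h'.2])]
      simp
  refine (setLIntegral_mono' (measurableSet_spaceTime T) hpt).trans ?_
  have hnull : volume (({T - h} : Set ℝ) ×ˢ (univ : Set (E d))) = 0 := by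
    rw [Measure.volume_eq_prod, Measure.prod_prod]; simp
  refine (setLIntegral_le_lintegral _ _).trans ?_
  rw [lintegral_indicator ((measurableSet_Ioo.prod measurableSet_unitCell).union
    ((measurableSet_singleton _).prod MeasurableSet.univ))]
  refine (lintegral_union_le _ _ _).trans ?_
  rw [setLIntegral_measure_zero _ _ hnull, add_zero, lintegral_const_mul' _ _
    (ENNReal.div_lt_top ENNReal.ofReal_ne_top (by simpa using hh0)).ne]
  refine le_of_eq ?_
  simp only [div_eq_mul_inv]
  ring

end Cutoff

lemma terminal_mem_K0 {φT : E d → ℝ} (hp : TorusPeriodic φT) (hc : ContDiff ℝ 1 φT) (T : ℝ) :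
    (fun z : ℝ × E d => φT z.2) ∈ K0 T φT :=
  ⟨hp.spacePeriodic, (hc.comp contDiff_snd).contDiffOn, fun _ => rfl⟩

lemma Dx_terminal (φT : E d → ℝ) (z : ℝ × E d) :
    Dx (fun z : ℝ × E d => φT z.2) z = gradient φT z.2 := rfl

lemma fderiv_terminal_time {φT : E d → ℝ} (hc : ContDiff ℝ 1 φT) (z : ℝ × E d) :
    fderiv ℝ (fun z : ℝ × E d => φT z.2) z (1, 0) = 0 := by
  have h : DifferentiableAt ℝ (fun z : ℝ × E d => φT z.2) z :=
    (hc.comp contDiff_snd).differentiable (by simp) z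
  rw [← dt_eq h]
  simp [dt]

lemma continuous_gradient {φT : E d → ℝ} (hc : ContDiff ℝ 1 φT) : Continuous (gradient φT) := by
  unfold gradient
  exact (LinearIsometryEquiv.continuous _).comp (hc.continuous_fderiv (by simp))

lemma integral_terminal_dt {T : ℝ} (hT : 0 < T) {φT : E d → ℝ} (hp : TorusPeriodic φT)
    (hc : ContDiff ℝ 1 φT) {ψ : ℝ × E d → ℝ} (hψ : IsTest T ψ) :
    ∫ z in spaceTime d T, φT z.2 * dt ψ z = 0 := by
  have := K0.integral_by_parts hT (terminal_mem_K0 hp hc T) hψ (1, 0)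
  simp only [fderiv_terminal_time hc, zero_mul, integral_zero, neg_zero, ← hψ.dt_eq] at this
  exact this

/-- Integrability of the Hamiltonian along a field in `L^r`. -/
lemma integrable_hamiltonian {q r : ℝ} {H : E d → E d → ℝ} (hH : HamiltonianAssumption q r H)
    {T : ℝ} {G : ℝ × E d → E d} (hG : IsLp T r G) :
    IntegrableOn (fun z => H z.2 (G z)) (spaceTime d T) := by
  have hr := hH.r_pos
  obtain ⟨C, hC0, hC⟩ := hH.exists_abs_le
  have hfin := isFiniteMeasure_spaceTime (d := d) T
  have hi : IntegrableOn (fun z => ‖G z‖ ^ r) (spaceTime d T) := by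
    have := hG.2.integrable_norm_rpow (by simp; linarith) ENNReal.ofReal_ne_top
    rwa [ENNReal.toReal_ofReal (by linarith)] at this
  refine Integrable.mono' ((hi.const_mul C).add (integrable_const C)) ?_ (ae_of_all _ fun z => hC _ _)
  exact hH.continuous.comp_aestronglyMeasurable
    (continuous_snd.aestronglyMeasurable.prodMk hG.2.1)

lemma IsLp.integrableOn {s : ℝ} (hs : 1 ≤ s) {T : ℝ} {u : ℝ × E d → V} (hu : IsLp T s u) :
    IntegrableOn u (spaceTime d T) := by
  have hfin := isFiniteMeasure_spaceTime (d := d) T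
  exact hu.2.integrable (by simpa using hs)

/-- Extending a relaxed competitor by the terminal datum keeps the subsolution property. The
competitor is only tested on `(0,T)`, so a test function on `(0,T+1)` is first cut off near `T`;
after subtracting `φT`, the derivative of the cutoff contributes nothing in the limit. -/
lemma weakSubsolution_extend {T p q r : ℝ} (hT : 0 < T) (hp : 1 ≤ p) {H : E d → E d → ℝ}
    (hH : HamiltonianAssumption q r H) {φT : E d → ℝ} (hper : TorusPeriodic φT)
    (hc : ContDiff ℝ 1 φT) {φ α : ℝ × E d → ℝ} {G : ℝ × E d → E d} (hφ : IsBV T φ)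
    (hα : IsLp T p α) (htr : IsTraceLeft φ T φT) (hG : IsLp T r G)
    (hgrad : IsWeakGradient T φ G) (hsub : IsSubsolution T H φ G α) :
    WeakSubsolution (T + 1) H (extend T φ φT) (extend T G (gradient φT))
      (extend T α fun x => H x (gradient φT x)) := by
  have hfin := isFiniteMeasure_spaceTime (d := d) T
  have hr := hH.r_pos
  have hgp : TorusPeriodic (gradient φT) := gradient_periodic hper
  have hgc : Continuous (gradient φT) := continuous_gradient hc
  have hHp : TorusPeriodic fun x => H x (gradient φT x) := fun k x => by
    simp only [hgp k x]
    exact hH.periodic _ k x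
  have hHc : Continuous fun x => H x (gradient φT x) := hH.continuous.comp (continuous_id.prodMk hgc)
  have hαi := hα.integrableOn hp
  have hGi := hG.integrableOn hr.le
  have hHi := integrable_hamiltonian hH hG
  have hbd : ∀ {V : Type} [NormedAddCommGroup V] {g : E d → V}, TorusPeriodic g → Continuous g →
      IntegrableOn (fun z : ℝ × E d => g z.2) (spaceTime d T) := by
    intro V _ g hg hgc
    obtain ⟨C, -, hC⟩ := hg.exists_bound hgc
    exact Integrable.of_bound (continuous_comp_snd hgc).aestronglyMeasurable C
      (ae_of_all _ fun _ => hC _)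
  have hφTi := hbd hper hc.continuous
  have hgi := hbd hgp hgc
  refine ⟨extend_periodic hφ.periodic hper, integrable_extend hφ.integrable hper hc.continuous,
    extend_periodic hG.1 hgp, integrable_extend hGi hgp hgc, extend_periodic hα.1 hHp,
    integrable_extend hαi hHp hHc, fun ψ hψ => ?_, fun ψ hψ hψ0 => ?_⟩
  · obtain ⟨C, hC0, hC⟩ := hψ.exists_bound
    obtain ⟨C', hC0', hC'⟩ := hψ.exists_bound_Dx
    have e1 := integral_extend_bilin (T := T) (ContinuousLinearMap.lsmul ℝ ℝ : ℝ →L[ℝ] E d →L[ℝ] E d)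
      hφ.integrable hper hc.continuous hψ.continuous_Dx hC' fun z hz => by
        rw [hψ.Dx_eq, hψ.fderiv_eq_zero hz]; simp [spaceGrad]
    have e2 := integral_extend_bilin (T := T)
      (ContinuousLinearMap.lsmul ℝ ℝ : ℝ →L[ℝ] E d →L[ℝ] E d).flip
      hGi hgp hgc hψ.contDiff.continuous hC fun z hz => hψ.eq_zero hz
    simp only [ContinuousLinearMap.flip_apply, ContinuousLinearMap.lsmul_apply] at e1 e2
    rw [e1, e2, neg_add]
    congr 1
    · have hF1 : IntegrableOn (fun z => (φ z - φT z.2) • Dx ψ z) (spaceTime d T) :=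
        (hφ.integrable.sub hφTi).smul_bdd _ hψ.continuous_Dx.aestronglyMeasurable (ae_of_all _ hC')
      have hF2 : IntegrableOn (fun z => ψ z • (G z - gradient φT z.2)) (spaceTime d T) :=
        (hGi.sub hgi).bdd_smul _ hψ.contDiff.continuous.aestronglyMeasurable (ae_of_all _ hC)
      refine tendsto_nhds_unique (tendsto_integral_cutoff hF1)
        ((tendsto_integral_cutoff hF2).neg.congr' ?_)
      filter_upwards [self_mem_nhdsWithin] with h hh
      have hψh := isTest_cutoff (h := h) (T := T) hh hψ
      obtain ⟨Ch, hCh0, hCh⟩ := hψh.exists_bound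
      obtain ⟨Ch', hCh0', hCh'⟩ := hψh.exists_bound_Dx
      have g1 := hgrad _ hψh
      have g2 := K0.isWeakGradient hT (terminal_mem_K0 hper hc T) _ hψh
      simp only [Dx_terminal] at g2
      have i1 : IntegrableOn (fun z => φ z • Dx (cutoff T h ψ) z) (spaceTime d T) :=
        hφ.integrable.smul_bdd _ hψh.continuous_Dx.aestronglyMeasurable (ae_of_all _ hCh')
      have i2 : IntegrableOn (fun z => φT z.2 • Dx (cutoff T h ψ) z) (spaceTime d T) :=
        hφTi.smul_bdd _ hψh.continuous_Dx.aestronglyMeasurable (ae_of_all _ hCh')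
      have i3 : IntegrableOn (fun z => cutoff T h ψ z • G z) (spaceTime d T) :=
        hGi.bdd_smul _ hψh.contDiff.continuous.aestronglyMeasurable (ae_of_all _ hCh)
      have i4 : IntegrableOn (fun z => cutoff T h ψ z • gradient φT z.2) (spaceTime d T) :=
        hgi.bdd_smul _ hψh.contDiff.continuous.aestronglyMeasurable (ae_of_all _ hCh)
      have l1 : ∫ z in spaceTime d T, timeStep h (T - z.1) • ((φ z - φT z.2) • Dx ψ z)
          = (∫ z in spaceTime d T, φ z • Dx (cutoff T h ψ) z)
            - ∫ z in spaceTime d T, φT z.2 • Dx (cutoff T h ψ) z := by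
        rw [← integral_sub i1 i2]
        refine integral_congr_ae (ae_of_all _ fun z => ?_)
        simp only [Dx_cutoff hψ]
        rw [← sub_smul, smul_comm]
      have l2 : ∫ z in spaceTime d T, timeStep h (T - z.1) • (ψ z • (G z - gradient φT z.2))
          = (∫ z in spaceTime d T, cutoff T h ψ z • G z)
            - ∫ z in spaceTime d T, cutoff T h ψ z • gradient φT z.2 := by
        rw [← integral_sub i3 i4]
        refine integral_congr_ae (ae_of_all _ fun z => ?_)
        simp only [cutoff]
        rw [← smul_sub, smul_smul]
      rw [l1, l2, g1, g2]
      abel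
    · have g2 := K0.isWeakGradient (by linarith) (terminal_mem_K0 hper hc (T + 1)) _ hψ
      simp only [Dx_terminal] at g2
      rw [setIntegral_spaceTime_eq, setIntegral_spaceTime_eq] at g2
      · exact g2
      · intro z hz; rw [hψ.eq_zero hz, zero_smul]
      · intro z hz; rw [hψ.Dx_eq, hψ.fderiv_eq_zero hz]; simp [spaceGrad]
  · obtain ⟨C, hC0, hC⟩ := hψ.exists_bound
    obtain ⟨C', hC0', hC'⟩ := hψ.exists_bound_dt
    have e1 := integral_extend_bilin (T := T) (ContinuousLinearMap.mul ℝ ℝ)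
      hφ.integrable hper hc.continuous hψ.continuous_dt hC' fun z hz => by
        rw [hψ.dt_eq, hψ.fderiv_eq_zero hz]; simp
    have e2 := integral_extend_bilin (T := T) (ContinuousLinearMap.mul ℝ ℝ)
      hHi hHp hHc hψ.contDiff.continuous hC fun z hz => hψ.eq_zero hz
    have e3 := integral_extend_bilin (T := T) (ContinuousLinearMap.mul ℝ ℝ)
      hαi hHp hHc hψ.contDiff.continuous hC fun z hz => hψ.eq_zero hz
    simp only [ContinuousLinearMap.mul_apply'] at e1 e2 e3
    have e4 : ∫ z, φT z.2 * dt ψ z ∂cyl d = 0 := by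
      rw [← setIntegral_spaceTime_eq (T := T + 1),
        integral_terminal_dt (by linarith) hper hc hψ]
      intro z hz; rw [hψ.dt_eq, hψ.fderiv_eq_zero hz]; simp
    have e5 : ∫ z, H z.2 (extend T G (gradient φT) z) * ψ z ∂cyl d
        = ∫ z, extend T (fun z => H z.2 (G z)) (fun x => H x (gradient φT x)) z * ψ z ∂cyl d := by
      refine integral_congr_ae (ae_of_all _ fun z => ?_)
      simp only
      by_cases hz : z.1 ∈ Ioo 0 (T + 1)
      · by_cases hz2 : z.1 ∈ Ioo 0 T
        · rw [extend_of_mem hz2, extend_of_mem hz2]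
        · have hz3 : z.1 ∈ Ico T (T + 1) :=
            ⟨by by_contra h; exact hz2 ⟨hz.1, not_le.1 h⟩, hz.2⟩
          rw [extend_of_ge hT hz3, extend_of_ge hT hz3]
      · rw [hψ.eq_zero hz]; simp
    rw [e5, e1, e2, e3, e4, add_zero, ← add_assoc]
    refine add_le_add ?_ le_rfl
    have hHTi := hbd hHp hHc
    have hF1 : IntegrableOn (fun z => (φ z - φT z.2) * dt ψ z) (spaceTime d T) :=
      (hφ.integrable.sub hφTi).mul_bdd hψ.continuous_dt.aestronglyMeasurable (ae_of_all _ hC')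
    have mk : ∀ {v : ℝ × E d → ℝ}, IntegrableOn v (spaceTime d T) →
        IntegrableOn (fun z => v z * ψ z) (spaceTime d T) := fun hv =>
      Integrable.mul_bdd hv hψ.contDiff.continuous.aestronglyMeasurable (ae_of_all _ hC)
    have hF2 := mk hHi
    have hF3 := mk hαi
    have hF4 := mk hHTi
    have s1 : ∫ z in spaceTime d T, (H z.2 (G z) - H z.2 (gradient φT z.2)) * ψ z
        = (∫ z in spaceTime d T, H z.2 (G z) * ψ z)
          - ∫ z in spaceTime d T, H z.2 (gradient φT z.2) * ψ z := by
      rw [← integral_sub hF2 hF4]; simp only [sub_mul]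
    have s2 : ∫ z in spaceTime d T, (α z - H z.2 (gradient φT z.2)) * ψ z
        = (∫ z in spaceTime d T, α z * ψ z)
          - ∫ z in spaceTime d T, H z.2 (gradient φT z.2) * ψ z := by
      rw [← integral_sub hF3 hF4]; simp only [sub_mul]
    rw [s1, s2]
    have key : (∫ z in spaceTime d T, (φ z - φT z.2) * dt ψ z)
        + ∫ z in spaceTime d T, H z.2 (G z) * ψ z ≤ ∫ z in spaceTime d T, α z * ψ z := by
      have t1 := ((tendsto_integral_cutoff hF1).sub (tendsto_boundary_layer hT htr hψ)).add
        (tendsto_integral_cutoff hF2)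
      rw [sub_zero] at t1
      refine le_of_tendsto_of_tendsto t1 (tendsto_integral_cutoff hF3) ?_
      filter_upwards [self_mem_nhdsWithin] with h hh
      have hψh := isTest_cutoff (h := h) (T := T) hh hψ
      obtain ⟨Ch, hCh0, hCh⟩ := hψh.exists_bound
      obtain ⟨Ch', hCh0', hCh'⟩ := hψh.exists_bound_dt
      have g1 := hsub _ hψh (cutoff_nonneg hψ0)
      have g2 := integral_terminal_dt hT hper hc hψh
      have i1 : IntegrableOn (fun z => φ z * dt (cutoff T h ψ) z) (spaceTime d T) :=
        hφ.integrable.mul_bdd hψh.continuous_dt.aestronglyMeasurable (ae_of_all _ hCh')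
      have i2 : IntegrableOn (fun z => φT z.2 * dt (cutoff T h ψ) z) (spaceTime d T) :=
        hφTi.mul_bdd hψh.continuous_dt.aestronglyMeasurable (ae_of_all _ hCh')
      have i3 : IntegrableOn (fun z => H z.2 (G z) * cutoff T h ψ z) (spaceTime d T) :=
        hHi.mul_bdd hψh.contDiff.continuous.aestronglyMeasurable (ae_of_all _ hCh)
      have i5 : IntegrableOn (fun z => timeStep h (T - z.1) • ((φ z - φT z.2) * dt ψ z))
          (spaceTime d T) :=
        hF1.bdd_smul (C := 1) ((contDiff_timeStep h).continuous.comp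
          (continuous_const.sub continuous_fst)).aestronglyMeasurable (ae_of_all _ fun z => by
            exact (Real.norm_of_nonneg (timeStep_nonneg _ _)).trans_le (timeStep_le_one _ _))
      obtain ⟨L, hL, hLb⟩ := exists_timeKernel_le
      have i6 : IntegrableOn (fun z => timeKernel h (T - z.1) * ((φ z - φT z.2) * ψ z))
          (spaceTime d T) :=
        (mk (hφ.integrable.sub hφTi)).bdd_mul (c := L / h) ((contDiff_timeKernel h).continuous.comp
          (continuous_const.sub continuous_fst)).aestronglyMeasurable (ae_of_all _ fun z => by
            exact (Real.norm_of_nonneg (timeKernel_nonneg hh _)).trans_le (hLb h hh _))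
      rw [integral_add i1 i3] at g1
      have l1 : (∫ z in spaceTime d T, timeStep h (T - z.1) • ((φ z - φT z.2) * dt ψ z))
          - ∫ z in spaceTime d T, timeKernel h (T - z.1) * ((φ z - φT z.2) * ψ z)
          = (∫ z in spaceTime d T, φ z * dt (cutoff T h ψ) z)
            - ∫ z in spaceTime d T, φT z.2 * dt (cutoff T h ψ) z := by
        rw [← integral_sub i1 i2, ← integral_sub i5 i6]
        refine integral_congr_ae (ae_of_all _ fun z => ?_)
        simp only [dt_cutoff hψ, smul_eq_mul]
        ring
      rw [l1, g2, sub_zero]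
      refine le_trans (le_of_eq ?_) (g1.trans (le_of_eq ?_))
      · congr 1
        refine integral_congr_ae (ae_of_all _ fun z => ?_)
        simp only [cutoff, smul_eq_mul]; ring
      · refine integral_congr_ae (ae_of_all _ fun z => ?_)
        simp only [cutoff, smul_eq_mul]; ring
    linarith

end MFG

namespace MFG

/-! ### Existence of the trace at the initial time -/

variable {d : ℕ}

lemma spaceKernel_neg (ε : ℝ) (x : E d) : spaceKernel ε (-x) = spaceKernel ε x := by
  simp [spaceKernel, spaceBump]

lemma integral_spaceKernel_sub {ε : ℝ} (hε : 0 < ε) (hε1 : ε ≤ 1) (y : E d) :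
    ∫ x in unitCell d, spaceKernel ε (y - x) = 1 := by
  have hp : SpacePeriodic fun z : ℝ × E d => timeKernel ε z.1 * spaceKernel ε z.2 :=
    kern_periodic ε
  have h1 := integral_cyl_add hp (0, -y)
  have h2 := integral_kern (d := d) hε hε1
  simp only [kern] at h2
  rw [h2, cyl_eq_prod] at h1
  have h3 := integral_prod_mul (μ := (volume : Measure ℝ)) (ν := volume.restrict (unitCell d))
    (timeKernel ε) (fun x => spaceKernel ε (x + -y))
  rw [integral_timeKernel hε, one_mul] at h3
  simp only [Prod.fst_add, add_zero, Prod.snd_add] at h1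
  rw [h1] at h3
  rw [h3]
  refine integral_congr_ae (ae_of_all _ fun x => ?_)
  simp only
  rw [← spaceKernel_neg]
  congr 1
  abel

/-- The mass of the average at time `0` only sees the time marginal of the kernel. -/
lemma integral_cell_avg {ε : ℝ} (hε : 0 < ε) (hε1 : ε ≤ 1) {u : ℝ × E d → ℝ}
    (hu : SpacePeriodic u) (hi : Integrable u (cyl d)) :
    ∫ x in unitCell d, avg ε u (0, x) = ∫ w, timeKernel ε w.1 * u w ∂cyl d := by
  have hfin : IsFiniteMeasure ((volume : Measure (E d)).restrict (unitCell d)) :=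
    ⟨by rw [Measure.restrict_apply_univ]; exact volume_unitCell_lt_top⟩
  obtain ⟨C, hC⟩ := kern_bound (d := d) hε
  have hint : Integrable (fun q : E d × (ℝ × E d) => kern ε (q.2 - (0, q.1)) * u q.2)
      ((volume.restrict (unitCell d)).prod (cyl d)) := by
    refine Integrable.bdd_mul (hi.comp_snd _) (c := C) ?_ (ae_of_all _ fun q => hC _)
    exact ((contDiff_kern ε).continuous.comp (continuous_snd.sub
      (continuous_const.prodMk continuous_fst))).aestronglyMeasurable
  simp only [avg_eq hε hu, smul_eq_mul]
  rw [integral_integral_swap hint]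
  refine integral_congr_ae (ae_of_all _ fun w => ?_)
  simp only [kern, Prod.fst_sub, sub_zero, Prod.snd_sub]
  rw [integral_mul_const, integral_const_mul, integral_spaceKernel_sub hε hε1, mul_one]

lemma continuous_avg {ε : ℝ} (hε : 0 < ε) {u : ℝ × E d → ℝ} (hu : SpacePeriodic u)
    (hi : Integrable u (cyl d)) : Continuous (avg ε u) := (contDiff_avg hε hu hi).continuous

lemma tendsto_lintegral_avg_sub {u : ℝ × E d → ℝ} (hu : SpacePeriodic u)
    (hi : Integrable u (cyl d)) :
    Tendsto (fun ε => ∫⁻ z, ‖avg ε u z - u z‖ₑ ∂cyl d) (𝓝[>] (0 : ℝ)) (𝓝 0) := by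
  rw [ENNReal.tendsto_nhds_zero]
  intro δ hδ
  rcases eq_or_ne δ ⊤ with rfl | hδt
  · exact Eventually.of_forall fun _ => le_top
  have hm : MemLp u (ENNReal.ofReal 1) (cyl d) := by
    rw [ENNReal.ofReal_one]; exact memLp_one_iff_integrable.2 hi
  obtain ⟨ε₀, hε₀, h⟩ := exists_lintegral_avg_sub_le le_rfl hu hi hm
    (ENNReal.toReal_pos hδ.ne' hδt)
  filter_upwards [Ioo_mem_nhdsGT (lt_min hε₀ one_pos)] with ε hε
  have := h ε hε.1 (hε.2.le.trans (min_le_right _ _)) (hε.2.le.trans (min_le_left _ _))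
  simpa only [ENNReal.rpow_one, ENNReal.ofReal_toReal hδt] using this

/-- Pairing with a bounded weight is stable under averaging. -/
lemma abs_integral_mul_avg_sub_le {ε : ℝ} (hε : 0 < ε) {u : ℝ × E d → ℝ} (hu : SpacePeriodic u)
    (hi : Integrable u (cyl d)) {χ : ℝ → ℝ} (hχ : Continuous χ) {a b L : ℝ}
    (h0 : ∀ s, s ∉ Icc a b → χ s = 0) (hL : ∀ s, |χ s| ≤ L)
    (hfin : ∫⁻ z, ‖avg ε u z - u z‖ₑ ∂cyl d ≠ ⊤) :
    |(∫ w, χ w.1 * avg ε u w ∂cyl d) - ∫ w, χ w.1 * u w ∂cyl d|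
      ≤ L * (∫⁻ z, ‖avg ε u z - u z‖ₑ ∂cyl d).toReal := by
  have hL0 : 0 ≤ L := (abs_nonneg _).trans (hL 0)
  have hc := continuous_avg hε hu hi
  have hcχ : Continuous fun w : ℝ × E d => χ w.1 := hχ.comp continuous_fst
  have hp : SpacePeriodic fun w : ℝ × E d => χ w.1 * avg ε u w := by
    intro t k x
    have := avg_periodic ε hu t k x
    simp only at this
    simp only [this]
  obtain ⟨C, -, hC⟩ := exists_bound_of_time hp (hcχ.mul hc) (a := a) (b := b)
    fun z hz => by rw [h0 _ hz, zero_mul]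
  have i1 : Integrable (fun w => χ w.1 * avg ε u w) (cyl d) :=
    integrable_cyl_of_bounded (hcχ.mul hc).aestronglyMeasurable hC
      fun z hz => by rw [h0 _ hz, zero_mul]
  have i2 : Integrable (fun w => χ w.1 * u w) (cyl d) :=
    hi.bdd_mul (c := L) hcχ.aestronglyMeasurable (ae_of_all _ fun z => hL _)
  have i3 : Integrable (fun z => avg ε u z - u z) (cyl d) :=
    ⟨hc.aestronglyMeasurable.sub hi.1, by
      rw [hasFiniteIntegral_iff_enorm]; exact hfin.lt_top⟩
  rw [← integral_sub i1 i2, ← integral_norm_eq_lintegral_enorm i3.1, ← integral_const_mul]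
  refine (norm_integral_le_integral_norm _).trans (integral_mono (i1.sub i2).norm
    (i3.norm.const_mul L) fun z => ?_)
  change ‖χ z.1 * avg ε u z - χ z.1 * u z‖ ≤ L * ‖avg ε u z - u z‖
  rw [← mul_sub, norm_mul]
  exact mul_le_mul_of_nonneg_right (hL _) (norm_nonneg _)

/-- If `∂_t U ≥ -c` on `[0,h]`, the oscillation of `U` near time `0` is controlled by the variation
of its mass and by the mass of `c`: the increments of `U` are positive up to an error `c`. -/
lemma integral_abs_sub_le {U c : ℝ × E d → ℝ} (hU : ContDiff ℝ 1 U) (hUp : SpacePeriodic U)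
    (hc : Continuous c) (hcp : SpacePeriodic c) (hc0 : ∀ z, 0 ≤ c z) {h : ℝ} (hh : 0 < h)
    (hdt : ∀ z : ℝ × E d, z.1 ∈ Icc 0 h → - dt U z ≤ c z) {t : ℝ} (ht : t ∈ Icc 0 (h / 2)) :
    ∫ x in unitCell d, |U (t, x) - U (0, x)| ≤
      (∫ w, timeKernel h w.1 * U w ∂cyl d) - (∫ x in unitCell d, U (0, x))
        + 3 * ∫ z in spaceTime d h, c z := by
  have hcont : ∀ s : ℝ, Continuous fun x : E d => U (s, x) := fun s =>
    hU.continuous.comp (continuous_const.prodMk continuous_id)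
  have hcs : ∀ x : E d, Continuous fun s => c (s, x) := fun x =>
    hc.comp (continuous_id.prodMk continuous_const)
  have hUs : ∀ x : E d, Continuous fun s => U (s, x) := fun x =>
    hU.continuous.comp (continuous_id.prodMk continuous_const)
  have hder : ∀ (x : E d) (s : ℝ), HasDerivAt (fun t => U (t, x)) (dt U (s, x)) s := by
    intro x s
    have := hasDerivAt_slice (hU.differentiable (by simp) (s, x))
    rwa [← dt_eq (hU.differentiable (by simp) (s, x))] at this
  have hderc : ∀ x : E d, Continuous fun s => dt U (s, x) := by
    intro x
    have : (fun s => dt U (s, x)) = fun s => fderiv ℝ U (s, x) (1, 0) :=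
      funext fun s => dt_eq (hU.differentiable (by simp) (s, x))
    rw [this]
    exact ((hU.continuous_fderiv (by simp)).comp
      (continuous_id.prodMk continuous_const)).clm_apply continuous_const
  have hslice : ∀ x s t, 0 ≤ s → s ≤ t → t ≤ h →
      U (s, x) ≤ U (t, x) + ∫ τ in Ioo 0 h, c (τ, x) := by
    intro x s t hs hst hth
    have e1 := intervalIntegral.integral_eq_sub_of_hasDerivAt (a := s) (b := t)
      (fun τ _ => hder x τ) ((hderc x).intervalIntegrable _ _)
    have e2 : ∫ τ in s..t, -c (τ, x) ≤ ∫ τ in s..t, dt U (τ, x) :=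
      intervalIntegral.integral_mono_on hst ((hcs x).neg.intervalIntegrable _ _)
        ((hderc x).intervalIntegrable _ _) fun τ hτ => by
          have := hdt (τ, x) ⟨hs.trans hτ.1, hτ.2.trans hth⟩
          linarith
    rw [intervalIntegral.integral_neg, intervalIntegral.integral_of_le hst] at e2
    have e3 : ∫ τ in Ioc s t, c (τ, x) ≤ ∫ τ in Ioc 0 h, c (τ, x) :=
      setIntegral_mono_set (((hcs x).integrableOn_Icc).mono_set Ioc_subset_Icc_self)
        (ae_of_all _ fun τ => hc0 _) (LE.le.eventuallyLE (Ioc_subset_Ioc hs hth))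
    have e4 : ∫ τ in Ioc 0 h, c (τ, x) = ∫ τ in Ioo 0 h, c (τ, x) := integral_Ioc_eq_integral_Ioo
    linarith
  have hkc : Continuous (timeKernel h) := (contDiff_timeKernel h).continuous
  have hki : Integrable (timeKernel h) := integrable_timeKernel hh
  have hksupp : ∀ s, s ∉ Icc (h / 2) h → timeKernel h s = 0 := fun s hs => timeKernel_eq_zero hh hs
  have hkUi : ∀ x : E d, Integrable fun s => timeKernel h s * U (s, x) := fun x =>
    (hkc.mul (hUs x)).integrable_of_hasCompactSupport
      (HasCompactSupport.of_support_subset_isCompact (isCompact_Icc (a := h / 2) (b := h))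
        fun s hs => by
          by_contra h'
          exact hs (by simp [hksupp s h']))
  have hupper : ∀ x, U (t, x) ≤
      (∫ s, timeKernel h s * U (s, x)) + ∫ τ in Ioo 0 h, c (τ, x) := by
    intro x
    have : ∫ s, timeKernel h s * (U (t, x) - ∫ τ in Ioo 0 h, c (τ, x))
        ≤ ∫ s, timeKernel h s * U (s, x) := by
      refine integral_mono (hki.mul_const _) (hkUi x) fun s => ?_
      by_cases hs : s ∈ Icc (h / 2) h
      · refine mul_le_mul_of_nonneg_left ?_ (timeKernel_nonneg hh s)
        have := hslice x t s ht.1 (ht.2.trans hs.1) hs.2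
        linarith
      · simp [hksupp s hs]
    rw [integral_mul_const, integral_timeKernel hh, one_mul] at this
    linarith
  have hpt : ∀ x, |U (t, x) - U (0, x)| ≤ (∫ s, timeKernel h s * U (s, x)) - U (0, x)
      + 3 * ∫ τ in Ioo 0 h, c (τ, x) := by
    intro x
    have h1 := hslice x 0 t le_rfl ht.1 (by linarith [ht.2])
    have h2 := hupper x
    have h3 : 0 ≤ ∫ τ in Ioo 0 h, c (τ, x) := integral_nonneg fun _ => hc0 _
    rw [abs_le]
    constructor <;> linarith
  obtain ⟨Cc, hCc0, hCc⟩ := hcp.exists_bound (a := 0) (b := h) hc.continuousOn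
  have ic : Integrable c (((volume : Measure ℝ).restrict (Ioo 0 h)).prod
      (volume.restrict (unitCell d))) := by
    rw [Measure.prod_restrict]
    exact integrableOn_spaceTime_of_bounded hc.continuousOn fun z hz => hCc z (Ioo_subset_Icc_self hz)
  have hkp : SpacePeriodic fun w : ℝ × E d => timeKernel h w.1 * U w := by
    intro s k x
    have := hUp s k x
    simp only at this
    simp only [this]
  have hkcU : Continuous fun w : ℝ × E d => timeKernel h w.1 * U w :=
    (hkc.comp continuous_fst).mul hU.continuous
  have hk0 : ∀ z : ℝ × E d, z.1 ∉ Icc (h / 2) h → timeKernel h z.1 * U z = 0 := fun z hz => by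
    rw [hksupp _ hz, zero_mul]
  obtain ⟨Ck, -, hCk⟩ := exists_bound_of_time hkp hkcU hk0
  have ik : Integrable (fun w : ℝ × E d => timeKernel h w.1 * U w) (cyl d) :=
    integrable_cyl_of_bounded hkcU.aestronglyMeasurable hCk hk0
  rw [cyl_eq_prod] at ik ⊢
  have hST : ∫ z in spaceTime d h, c z
      = ∫ x in unitCell d, ∫ τ in Ioo 0 h, c (τ, x) := by
    rw [← integral_prod_symm c ic, Measure.prod_restrict]
    rfl
  have i0 : ∀ s : ℝ, IntegrableOn (fun x => U (s, x)) (unitCell d) := fun s =>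
    integrableOn_unitCell_of_continuous (hcont s)
  have ia : IntegrableOn (fun x => (∫ s, timeKernel h s * U (s, x)) - U (0, x)) (unitCell d) :=
    ik.integral_prod_right.sub (i0 0)
  have ib : IntegrableOn (fun x => 3 * ∫ τ in Ioo 0 h, c (τ, x)) (unitCell d) :=
    ic.integral_prod_right.const_mul 3
  rw [hST, integral_prod_symm _ ik, ← integral_const_mul, ← integral_sub ik.integral_prod_right (i0 0),
    ← integral_add ia ib]
  exact integral_mono ((i0 t).sub (i0 0)).abs (ia.add ib) hpt

/-- Averages of a subsolution have time derivative bounded below by averages of an integrable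
function. -/
lemma WeakSubsolution.exists_neg_dt_avg_le {T q r : ℝ} {H : E d → E d → ℝ}
    (hH : HamiltonianAssumption q r H) {u : ℝ × E d → ℝ} {G : ℝ × E d → E d}
    {A : ℝ × E d → ℝ} (h : WeakSubsolution T H u G A) :
    ∃ C, 0 ≤ C ∧ ∀ ε : ℝ, 0 < ε → ε ≤ 1 → ∀ z : ℝ × E d, 0 ≤ z.1 → z.1 + ε < T →
      - dt (avg ε u) z ≤ avg ε (fun w => |A w|) z + C := by
  obtain ⟨C, hC, hgr⟩ := hH.growth
  have hr := hH.r_pos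
  refine ⟨C, hC.le, fun ε hε hε1 z hz hzT => ?_⟩
  have := isProbabilityMeasure_mollifier (d := d) hε hε1
  have h1 := h.dt_avg hH hε hz hzT
  have h2 : avg ε A z ≤ avg ε (fun w => |A w|) z :=
    integral_mono (integrable_mollifier_add hε h.A_per h.A_int z)
      (integrable_mollifier_add hε h.A_per h.A_int z).abs fun w => le_abs_self _
  have h3 : -C ≤ avg ε (fun w => H w.2 (G w)) z := by
    by_cases hi : Integrable (fun w => H (z + w).2 (G (z + w))) (mollifier d ε)
    · have : ∫ _, -C ∂mollifier d ε ≤ avg ε (fun w => H w.2 (G w)) z := by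
        refine integral_mono (integrable_const _) hi fun w => ?_
        have h4 := (hgr (z + w).2 (G (z + w))).1
        have h5 : 0 ≤ 1 / (r * C) * ‖G (z + w)‖ ^ r := by positivity
        simp only
        linarith
      simpa using this
    · rw [avg, integral_undef hi]
      linarith
  linarith

lemma tendsto_integral_spaceTime_zero {v : ℝ × E d → ℝ} {T : ℝ} (hT : 0 < T)
    (hv : IntegrableOn v (spaceTime d T)) :
    Tendsto (fun h => ∫ z in spaceTime d h, v z) (𝓝[>] 0) (𝓝 0) := by
  have h1 : Tendsto (fun h : ℝ => ENNReal.ofReal h * volume (unitCell d)) (𝓝[>] 0) (𝓝 0) := by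
    have h1 : Tendsto (fun h : ℝ => ENNReal.ofReal h) (𝓝[>] 0) (𝓝 (ENNReal.ofReal 0)) :=
      ENNReal.continuous_ofReal.continuousWithinAt
    simpa using ENNReal.Tendsto.mul_const (b := volume (unitCell d)) h1
      (Or.inr volume_unitCell_lt_top.ne)
  have h2 : Tendsto ((volume.restrict (spaceTime d T)) ∘ fun h => spaceTime d h) (𝓝[>] 0)
      (𝓝 0) := by
    refine tendsto_of_tendsto_of_tendsto_of_le_of_le tendsto_const_nhds h1 (fun _ => zero_le)
      fun h => (Measure.restrict_apply_le _ _).trans ?_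
    change volume (spaceTime d h) ≤ _
    rw [spaceTime, Measure.volume_eq_prod, Measure.prod_prod]
    simp
  refine (hv.2.tendsto_setIntegral_nhds_zero h2).congr' ?_
  filter_upwards [Ioo_mem_nhdsGT hT] with h hh
  rw [Measure.restrict_restrict (measurableSet_spaceTime h), inter_eq_left.2]
  exact prod_mono (Ioo_subset_Ioo_right hh.2.le) Subset.rfl

lemma integral_spaceTime_avg_le {ε : ℝ} (hε : 0 < ε) {v : ℝ × E d → ℝ} (hv : SpacePeriodic v)
    (hi : Integrable v (cyl d)) (hfin : ∫⁻ z, ‖avg ε v z - v z‖ₑ ∂cyl d ≠ ⊤) (C h : ℝ) :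
    ∫ z in spaceTime d h, (avg ε v z + C) ≤
      (∫ z in spaceTime d h, (v z + C)) + (∫⁻ z, ‖avg ε v z - v z‖ₑ ∂cyl d).toReal := by
  have := isFiniteMeasure_spaceTime (d := d) h
  have i3 : Integrable (fun z => avg ε v z - v z) (cyl d) :=
    ⟨(continuous_avg hε hv hi).aestronglyMeasurable.sub hi.1, by
      rw [hasFiniteIntegral_iff_enorm]; exact hfin.lt_top⟩
  have i4 : IntegrableOn (fun z => avg ε v z - v z) (spaceTime d h) := by
    rw [IntegrableOn, volume_restrict_spaceTime]; exact i3.restrict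
  have i5 : IntegrableOn v (spaceTime d h) := by
    rw [IntegrableOn, volume_restrict_spaceTime]; exact hi.restrict
  have i6 : IntegrableOn (fun z => v z + C) (spaceTime d h) := i5.add (integrable_const C)
  have e1 : ∫ z in spaceTime d h, (avg ε v z + C)
      = (∫ z in spaceTime d h, (v z + C)) + ∫ z in spaceTime d h, (avg ε v z - v z) := by
    rw [← integral_add i6 i4]
    congr 1
    ext z
    ring
  rw [e1, ← integral_norm_eq_lintegral_enorm i3.1]
  refine add_le_add le_rfl ?_
  refine (Real.le_norm_self _).trans ((norm_integral_le_integral_norm _).trans ?_)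
  rw [volume_restrict_spaceTime]
  exact setIntegral_le_integral i3.norm (ae_of_all _ fun _ => norm_nonneg _)

/-- Oscillation of averages near time `0`, in terms of the mass of `u` near the times `s` and `η`.
The constant `C` comes from the lower bound `H ≥ -C`. -/
lemma WeakSubsolution.eventually_integral_abs_sub_le {T q r : ℝ} (hT : 0 < T)
    {H : E d → E d → ℝ}
    (hH : HamiltonianAssumption q r H) {u : ℝ × E d → ℝ} {G : ℝ × E d → E d}
    {A : ℝ × E d → ℝ} (h : WeakSubsolution T H u G A) :
    ∃ C, ∀ s ∈ Ioo 0 (T / 2), ∀ δ > 0, ∀ᶠ η in 𝓝[>] (0 : ℝ), ∀ t ∈ Icc 0 (s / 2),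
      ∫ x in unitCell d, |avg η u (t, x) - avg η u (0, x)| ≤
        (∫ w, timeKernel s w.1 * u w ∂cyl d) - (∫ w, timeKernel η w.1 * u w ∂cyl d)
          + 3 * (∫ z in spaceTime d s, (|A z| + C)) + δ := by
  obtain ⟨C, hC0, hC⟩ := h.exists_neg_dt_avg_le hH
  obtain ⟨L, hL, hLb⟩ := exists_timeKernel_le
  have hAp : SpacePeriodic fun w => |A w| := h.A_per.comp _
  have hAi := h.A_int.abs
  refine ⟨C, fun s hs δ hδ => ?_⟩
  have t1 := tendsto_lintegral_avg_sub h.u_per h.u_int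
  have t2 := tendsto_lintegral_avg_sub hAp hAi
  have t3 := ((((ENNReal.tendsto_toReal ENNReal.zero_ne_top).comp t1).const_mul (L / s)).add
    (((ENNReal.tendsto_toReal ENNReal.zero_ne_top).comp t2).const_mul 3))
  simp only [ENNReal.toReal_zero, mul_zero, add_zero] at t3
  filter_upwards [t3.eventually_le_const hδ, t1.eventually_lt_const ENNReal.zero_lt_top,
    t2.eventually_lt_const ENNReal.zero_lt_top,
    Ioo_mem_nhdsGT (lt_min one_pos (half_pos hT))] with η h3 h1 h2 hη t ht
  have hη1 : η ≤ 1 := hη.2.le.trans (min_le_left _ _)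
  have hη2 : η < T / 2 := hη.2.trans_le (min_le_right _ _)
  have hU := contDiff_avg hη.1 h.u_per h.u_int
  have hA := continuous_avg hη.1 hAp hAi
  have m1 := integral_abs_sub_le (c := fun z => avg η (fun w => |A w|) z + C) hU
    (avg_periodic η h.u_per) (hA.add continuous_const) ((avg_periodic η hAp).comp (· + C))
    (fun z => add_nonneg (integral_nonneg fun _ => abs_nonneg _) hC0) hs.1
    (fun z hz => hC η hη.1 hη1 z hz.1 (by linarith [hz.2, hs.2])) ht
  have m2 := integral_spaceTime_avg_le hη.1 hAp hAi h2.ne C s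
  have m3 := abs_integral_mul_avg_sub_le hη.1 h.u_per h.u_int (χ := timeKernel s)
    (contDiff_timeKernel s).continuous (a := s / 2) (b := s) (L := L / s)
    (fun τ hτ => timeKernel_eq_zero hs.1 hτ)
    (fun τ => (abs_of_nonneg (timeKernel_nonneg hs.1 τ)).trans_le (hLb s hs.1 τ)) h1.ne
  have m4 := (abs_le.1 m3).2
  rw [integral_cell_avg hη.1 hη1 h.u_per h.u_int] at m1
  simp only [Function.comp] at h3
  linarith

/-- Averages at small scale of a subsolution whose mass is bounded below near time `0` are
continuous in `L¹` at time `0`, uniformly in the scale. -/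
lemma WeakSubsolution.exists_eventually_integral_abs_sub_le {T q r : ℝ} (hT : 0 < T)
    {H : E d → E d → ℝ}
    (hH : HamiltonianAssumption q r H) {u : ℝ × E d → ℝ} {G : ℝ × E d → E d}
    {A : ℝ × E d → ℝ} (h : WeakSubsolution T H u G A) {c : ℝ}
    (hlow : ∀ᶠ ε in 𝓝[>] (0 : ℝ), c ≤ ∫ w, timeKernel ε w.1 * u w ∂cyl d) {δ : ℝ} (hδ : 0 < δ) :
    ∃ s > 0, ∀ᶠ η in 𝓝[>] (0 : ℝ), ∀ t ∈ Icc 0 s,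
      ∫ x in unitCell d, |avg η u (t, x) - avg η u (0, x)| ≤ δ := by
  obtain ⟨C, hC⟩ := h.eventually_integral_abs_sub_le hT hH
  set ℓ : ℝ → ℝ := fun ε => ∫ w, timeKernel ε w.1 * u w ∂cyl d with hℓ
  have hfin := isFiniteMeasure_spaceTime (d := d) T
  have hB : Tendsto (fun s => ∫ z in spaceTime d s, (|A z| + C)) (𝓝[>] 0) (𝓝 0) := by
    refine tendsto_integral_spaceTime_zero hT ?_
    refine Integrable.add ?_ (integrable_const C)
    rw [volume_restrict_spaceTime]
    exact h.A_int.abs.restrict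
  have hbdd : IsBoundedUnder (· ≤ ·) (𝓝[>] (0 : ℝ)) ℓ := by
    have hs : T / 4 ∈ Ioo 0 (T / 2) := ⟨by linarith, by linarith⟩
    refine ⟨ℓ (T / 4) + 3 * (∫ z in spaceTime d (T / 4), (|A z| + C)) + 1, ?_⟩
    rw [eventually_map]
    filter_upwards [hC _ hs 1 one_pos] with η hη
    have := hη 0 ⟨le_rfl, by linarith [hs.1]⟩
    simp only [sub_self, abs_zero, integral_zero] at this
    linarith
  have hbdd' : IsBoundedUnder (· ≥ ·) (𝓝[>] (0 : ℝ)) ℓ := ⟨c, by rwa [eventually_map]⟩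
  -- By the estimate above, `ℓ η ≤ ℓ s` up to a small error once `η` is much smaller than `s`.
  -- So `ℓ` has a limit at `0`, its lower limit: pick `s` with `ℓ s` almost as small as the lower
  -- limit; then `ℓ s - ℓ η` is small for all small `η`.
  have ev := eventually_lt_of_lt_liminf
    (show liminf ℓ (𝓝[>] 0) - δ / 8 < liminf ℓ (𝓝[>] 0) by linarith) hbdd'
  have fr := frequently_lt_of_liminf_lt hbdd.isCoboundedUnder_ge
    (show liminf ℓ (𝓝[>] 0) < liminf ℓ (𝓝[>] 0) + δ / 8 by linarith)
  obtain ⟨s, hs1, hs2, hs3⟩ := (fr.and_eventually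
    ((hB.eventually_le_const (show 0 < δ / 8 by linarith)).and
      (Ioo_mem_nhdsGT (half_pos hT)))).exists
  refine ⟨s / 2, half_pos hs3.1, ?_⟩
  filter_upwards [ev, hC s hs3 (δ / 8) (by linarith)] with η h1 h2 t ht
  have := h2 t ht
  linarith

lemma volume_restrict_spaceTime_prod (s : ℝ) : volume.restrict (spaceTime d s)
    = ((volume : Measure ℝ).restrict (Ioo 0 s)).prod (volume.restrict (unitCell d)) := by
  rw [Measure.prod_restrict]; rfl

lemma lintegral_spaceTime_snd (s : ℝ) {f : E d → ℝ≥0∞}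
    (hf : AEMeasurable f (volume.restrict (unitCell d))) :
    ∫⁻ z in spaceTime d s, f z.2 = ENNReal.ofReal s * ∫⁻ x in unitCell d, f x := by
  rw [volume_restrict_spaceTime_prod, lintegral_prod _ hf.comp_snd]
  simp [mul_comm]

/-- Near time `0`, a subsolution is close in mean to its small-scale averages at time `0`. -/
lemma WeakSubsolution.exists_lintegral_edist_initial_le {T q r : ℝ} (hT : 0 < T)
    {H : E d → E d → ℝ}
    (hH : HamiltonianAssumption q r H) {u : ℝ × E d → ℝ} {G : ℝ × E d → E d}
    {A : ℝ × E d → ℝ} (h : WeakSubsolution T H u G A) {c : ℝ}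
    (hlow : ∀ᶠ ε in 𝓝[>] (0 : ℝ), c ≤ ∫ w, timeKernel ε w.1 * u w ∂cyl d) {δ : ℝ} (hδ : 0 < δ) :
    ∃ s₀ > 0, ∀ s ∈ Ioc 0 s₀, ∀ᶠ η in 𝓝[>] (0 : ℝ),
      ∫⁻ z in spaceTime d s, edist (avg η u (0, z.2)) (u z)
        ≤ ENNReal.ofReal s * ENNReal.ofReal δ := by
  obtain ⟨s₀, hs₀, hs⟩ := h.exists_eventually_integral_abs_sub_le hT hH hlow (half_pos hδ)
  refine ⟨s₀, hs₀, fun s hss => ?_⟩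
  have hpos : 0 < ENNReal.ofReal (s * (δ / 2)) :=
    ENNReal.ofReal_pos.2 (mul_pos hss.1 (half_pos hδ))
  filter_upwards [hs, (tendsto_lintegral_avg_sub h.u_per h.u_int).eventually_le_const hpos,
    self_mem_nhdsWithin] with η h1 h2 hη
  have hc := continuous_avg hη h.u_per h.u_int
  have hc0 : Continuous fun z : ℝ × E d => avg η u (0, z.2) :=
    hc.comp (continuous_const.prodMk continuous_snd)
  have h3 : ∫⁻ z in spaceTime d s, edist (avg η u (0, z.2)) (avg η u z)
      ≤ ENNReal.ofReal (s * (δ / 2)) := by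
    rw [volume_restrict_spaceTime_prod, lintegral_prod _ (hc0.edist hc).measurable.aemeasurable]
    have h4 : ∀ t ∈ Ioo 0 s, ∫⁻ x in unitCell d, edist (avg η u (0, x)) (avg η u (t, x))
        ≤ ENNReal.ofReal (δ / 2) := by
      intro t ht
      have h5 := h1 t ⟨ht.1.le, ht.2.le.trans hss.2⟩
      have i : IntegrableOn (fun x => avg η u (t, x) - avg η u (0, x)) (unitCell d) :=
        integrableOn_unitCell_of_continuous ((hc.comp (continuous_const.prodMk continuous_id)).sub
          (hc.comp (continuous_const.prodMk continuous_id)))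
      calc ∫⁻ x in unitCell d, edist (avg η u (0, x)) (avg η u (t, x))
          = ∫⁻ x in unitCell d, ‖avg η u (t, x) - avg η u (0, x)‖ₑ := by
            simp only [edist_comm, edist_eq_enorm_sub]
        _ = ENNReal.ofReal (∫ x in unitCell d, ‖avg η u (t, x) - avg η u (0, x)‖) :=
            (ofReal_integral_norm_eq_lintegral_enorm i).symm
        _ ≤ _ := ENNReal.ofReal_le_ofReal h5
    refine (setLIntegral_mono' measurableSet_Ioo h4).trans (le_of_eq ?_)
    rw [setLIntegral_const, Real.volume_Ioo, sub_zero, mul_comm, ← ENNReal.ofReal_mul hss.1.le]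
  have h6 : ∫⁻ z in spaceTime d s, edist (u z) (avg η u z) ≤ ENNReal.ofReal (s * (δ / 2)) := by
    refine le_trans ?_ h2
    rw [volume_restrict_spaceTime]
    refine (setLIntegral_le_lintegral _ _).trans (le_of_eq ?_)
    simp only [edist_comm (u _), edist_eq_enorm_sub]
  refine (lintegral_edist_triangle hc0.aestronglyMeasurable
    (h := avg η u) hc.aestronglyMeasurable).trans ((add_le_add h3 h6).trans (le_of_eq ?_))
  rw [← ENNReal.ofReal_add (by have := hss.1; positivity) (by have := hss.1; positivity),
    ← ENNReal.ofReal_mul hss.1.le]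
  congr 1
  ring

/-- A function on the fundamental cell, extended by periodicity. -/
noncomputable def periodize (g : E d → ℝ) (x : E d) : ℝ := g (x + latticeVec (-floorVec x))

lemma periodize_periodic (g : E d → ℝ) : TorusPeriodic (periodize g) := by
  intro k x
  have : floorVec (x + latticeVec k) = floorVec x + k := by
    funext i; simp [floorVec]
  simp only [periodize, this, neg_add, latticeVec_add, latticeVec_neg]
  congr 1
  abel

lemma periodize_of_mem {g : E d → ℝ} {x : E d} (hx : x ∈ unitCell d) : periodize g x = g x := by
  have h : x + latticeVec (0 : Fin d → ℤ) ∈ unitCell d := by rwa [latticeVec_zero, add_zero]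
  rw [periodize, ← eq_neg_floorVec_of_mem h, latticeVec_zero, add_zero]

/-- A subsolution whose mass is bounded below near time `0` has a trace at time `0`, which is the
`L¹` limit of its averages at time `0`. -/
lemma WeakSubsolution.exists_trace {T q r : ℝ} (hT : 0 < T) {H : E d → E d → ℝ}
    (hH : HamiltonianAssumption q r H) {u : ℝ × E d → ℝ} {G : ℝ × E d → E d}
    {A : ℝ × E d → ℝ} (h : WeakSubsolution T H u G A) {c : ℝ}
    (hlow : ∀ᶠ ε in 𝓝[>] (0 : ℝ), c ≤ ∫ w, timeKernel ε w.1 * u w ∂cyl d) :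
    ∃ g, IsTraceRight u 0 g ∧
      Tendsto (fun η => ∫⁻ x in unitCell d, edist (avg η u (0, x)) (g x)) (𝓝[>] (0 : ℝ)) (𝓝 0) := by
  set μ := (volume : Measure (E d)).restrict (unitCell d) with hμ
  have hi : ∀ η, 0 < η → Integrable (fun x => avg η u (0, x)) μ := fun η hη =>
    integrableOn_unitCell_of_continuous ((continuous_avg hη h.u_per h.u_int).comp
      (continuous_const.prodMk continuous_id))
  have hum : ∀ s, AEStronglyMeasurable u (volume.restrict (spaceTime d s)) := fun s => by
    rw [volume_restrict_spaceTime]; exact h.u_int.1.restrict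
  have key := fun {δ : ℝ} (hδ : 0 < δ) => h.exists_lintegral_edist_initial_le hT hH hlow hδ
  -- the averages at time `0`, as a family in `L¹`
  set F : ℝ → (E d →₁[μ] ℝ) := fun η =>
    if hη : 0 < η then (hi η hη).toL1 (fun x => avg η u (0, x)) else 0 with hF
  have hFpos : ∀ η (hη : 0 < η), F η = (hi η hη).toL1 (fun x => avg η u (0, x)) := fun η hη =>
    dif_pos hη
  have hcauchy : Cauchy (map F (𝓝[>] 0)) := by
    refine EMetric.cauchy_iff.2 ⟨(inferInstance : (map F (𝓝[>] (0 : ℝ))).NeBot).ne, fun δ hδ => ?_⟩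
    obtain ⟨δ', h1, h2⟩ := ENNReal.lt_iff_exists_nnreal_btwn.1 hδ
    have hδ' : (0 : ℝ) < δ' / 2 := by
      have : 0 < δ' := by exact_mod_cast h1
      positivity
    obtain ⟨s, hs, hη⟩ := key hδ'
    have hη' := (hη s ⟨hs, le_rfl⟩).and self_mem_nhdsWithin
    refine ⟨_, image_mem_map hη', ?_⟩
    rintro _ ⟨η, ⟨hη1, hη2⟩, rfl⟩ _ ⟨η', ⟨hη1', hη2'⟩, rfl⟩
    rw [hFpos η hη2, hFpos η' hη2', Integrable.edist_toL1_toL1]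
    have hm1 := (hi η hη2).1
    have hm2 := (hi η' hη2').1
    refine lt_of_le_of_lt ?_ h2
    have hs0 : ENNReal.ofReal s ≠ 0 := by simpa using hs
    rw [← ENNReal.mul_le_mul_iff_right hs0 ENNReal.ofReal_ne_top,
      ← lintegral_spaceTime_snd s (hm1.edist hm2)]
    refine (lintegral_edist_triangle (f := fun z : ℝ × E d => avg η u (0, z.2))
      (g := fun z : ℝ × E d => avg η' u (0, z.2)) (h := u) ?_ (hum s)).trans
      ((add_le_add hη1 hη1').trans (le_of_eq ?_))
    · exact ((continuous_avg hη2 h.u_per h.u_int).comp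
        (continuous_const.prodMk continuous_snd)).aestronglyMeasurable
    · rw [← mul_add, ← ENNReal.ofReal_add hδ'.le hδ'.le, add_halves, ENNReal.ofReal_coe_nnreal]
  obtain ⟨g₀, hg₀⟩ := CompleteSpace.complete hcauchy
  have hg : Tendsto F (𝓝[>] 0) (𝓝 g₀) := hg₀
  have hgi : Integrable g₀ μ := L1.integrable_coeFn g₀
  have hae : periodize g₀ =ᵐ[μ] g₀ := by
    filter_upwards [ae_restrict_mem measurableSet_unitCell] with x hx using periodize_of_mem hx
  have hpi : Integrable (periodize g₀) μ := hgi.congr hae.symm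
  have hlim : Tendsto (fun η => ∫⁻ x in unitCell d, edist (avg η u (0, x)) (periodize g₀ x))
      (𝓝[>] (0 : ℝ)) (𝓝 0) := by
    refine (tendsto_iff_edist_tendsto_0.1 hg).congr' ?_
    filter_upwards [self_mem_nhdsWithin] with η hη
    rw [hFpos η hη]
    conv_lhs => rw [← Integrable.toL1_coeFn g₀ hgi]
    rw [Integrable.edist_toL1_toL1]
    refine lintegral_congr_ae ?_
    filter_upwards [hae] with x hx
    rw [hx]
  refine ⟨periodize g₀, ⟨periodize_periodic _, hpi, ?_⟩, hlim⟩
  rw [ENNReal.tendsto_nhds_zero]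
  intro δ hδ
  rcases eq_or_ne δ ⊤ with rfl | hδt
  · exact Eventually.of_forall fun _ => le_top
  obtain ⟨s₀, hs₀, hs⟩ := key (ENNReal.toReal_pos hδ.ne' hδt)
  filter_upwards [Ioc_mem_nhdsGT hs₀] with s hs'
  refine ENNReal.div_le_of_le_mul ?_
  rw [zero_add, mul_comm]
  -- compare `u` with its averages at time `0`, and let their scale `η` tend to `0` for fixed `s`
  have hlim2 := (ENNReal.Tendsto.const_mul (a := ENNReal.ofReal s) hlim
    (Or.inr ENNReal.ofReal_ne_top)).const_add (ENNReal.ofReal s * δ)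
  rw [mul_zero, add_zero] at hlim2
  refine ge_of_tendsto hlim2 ?_
  filter_upwards [hs s hs', self_mem_nhdsWithin] with η hη hη0
  rw [ENNReal.ofReal_toReal hδt] at hη
  have hm := (hi η hη0).1
  rw [← lintegral_spaceTime_snd s (hm.edist hpi.1)]
  have hcm : AEStronglyMeasurable (fun z : ℝ × E d => avg η u (0, z.2))
      (volume.restrict (spaceTime d s)) :=
    ((continuous_avg hη0 h.u_per h.u_int).comp
        (continuous_const.prodMk continuous_snd)).aestronglyMeasurable
  calc ∫⁻ z in Ioo 0 s ×ˢ unitCell d, ‖u z - periodize g₀ z.2‖ₑ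
      = ∫⁻ z in spaceTime d s, edist (u z) (periodize g₀ z.2) := by
        simp only [edist_eq_enorm_sub]; rfl
    _ ≤ (∫⁻ z in spaceTime d s, edist (u z) (avg η u (0, z.2)))
        + ∫⁻ z in spaceTime d s, edist (periodize g₀ z.2) (avg η u (0, z.2)) :=
        lintegral_edist_triangle (hum s) hcm
    _ ≤ _ := by
        refine add_le_add ?_ (le_of_eq ?_)
        · simpa only [edist_comm] using hη
        · simp only [edist_comm]

/-- The mass of a function of bounded variation stays bounded below as `t → 0`. -/
lemma IsBV.exists_le_integral_timeKernel {T : ℝ} (hT : 0 < T) {φ : ℝ × E d → ℝ} (hφ : IsBV T φ) :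
    ∃ c, ∀ ε ∈ Ioo 0 (T / 2), c ≤ ∫ z in spaceTime d T, timeKernel ε z.1 * φ z := by
  obtain ⟨C, hC⟩ := hφ.variation
  obtain ⟨L, hL, hLb⟩ := exists_timeKernel_le
  have hT2 : 0 < T / 2 := half_pos hT
  refine ⟨-(L / (T / 2) * ∫ z in spaceTime d T, ‖φ z‖) - C, fun ε hε => ?_⟩
  have hder : ∀ z : ℝ × E d, HasDerivAt (fun t => -(timeStep ε t * timeStep (T / 2) (T - t)))
      (-timeKernel ε z.1 + timeStep ε z.1 * timeKernel (T / 2) (T - z.1)) z.1 := by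
    intro z
    have h1 := hasDerivAt_timeStep ε z.1
    have h2 : HasDerivAt (fun t => timeStep (T / 2) (T - t))
        (timeKernel (T / 2) (T - z.1) * (-1)) z.1 :=
      (hasDerivAt_timeStep (T / 2) (T - z.1)).comp z.1 ((hasDerivAt_id z.1).const_sub T)
    have h3 := (h1.mul h2).neg
    -- the second cutoff equals `1` on the support of the kernel
    have h4 : timeKernel ε z.1 * timeStep (T / 2) (T - z.1) = timeKernel ε z.1 := by
      by_cases hz : z.1 ∈ Icc (ε / 2) ε
      · rw [timeStep_eq_one hT2 (by linarith [hz.2, hε.2]), mul_one]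
      · rw [timeKernel_eq_zero hε.1 hz, zero_mul]
    rw [h4] at h3
    exact HasDerivAt.congr_deriv h3 (by ring)
  have hψ : IsTest (d := d) T fun z => -(timeStep ε z.1 * timeStep (T / 2) (T - z.1)) := by
    refine ⟨(((contDiff_timeStep ε).comp contDiff_fst).mul ((contDiff_timeStep (T / 2)).comp
      (contDiff_const.sub contDiff_fst))).neg, fun t k x => rfl, ε / 2, T - T / 2 / 2,
      half_pos hε.1, by linarith, fun z hz => ?_⟩
    rw [mem_Icc, not_and_or, not_le, not_le] at hz
    rcases hz with hz | hz
    · rw [timeStep_eq_zero hε.1 hz.le, zero_mul, neg_zero]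
    · rw [timeStep_eq_zero hT2 (by linarith), mul_zero, neg_zero]
  have h0 : IsTest (d := d) T fun _ => (0 : E d) :=
    ⟨contDiff_const, fun t k x => rfl, T / 4, T / 2, by linarith, by linarith, fun z _ => rfl⟩
  have hk : Continuous fun z : ℝ × E d => timeKernel ε z.1 :=
    (contDiff_timeKernel ε).continuous.comp continuous_fst
  have hs : Continuous fun z : ℝ × E d => timeStep ε z.1 * timeKernel (T / 2) (T - z.1) :=
    ((contDiff_timeStep ε).continuous.comp continuous_fst).mul
      ((contDiff_timeKernel (T / 2)).continuous.comp (continuous_const.sub continuous_fst))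
  have hsb : ∀ z : ℝ × E d, ‖timeStep ε z.1 * timeKernel (T / 2) (T - z.1)‖ ≤ L / (T / 2) := by
    intro z
    rw [Real.norm_of_nonneg (mul_nonneg (timeStep_nonneg _ _) (timeKernel_nonneg hT2 _))]
    exact (mul_le_of_le_one_left (timeKernel_nonneg hT2 _) (timeStep_le_one _ _)).trans
      (hLb _ hT2 _)
  have i1 : IntegrableOn (fun z => timeKernel ε z.1 * φ z) (spaceTime d T) :=
    hφ.integrable.bdd_mul (c := L / ε) hk.aestronglyMeasurable (ae_of_all _ fun z =>
      (Real.norm_of_nonneg (timeKernel_nonneg hε.1 _)).trans_le (hLb _ hε.1 _))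
  have i2 : IntegrableOn (fun z => timeStep ε z.1 * timeKernel (T / 2) (T - z.1) * φ z)
      (spaceTime d T) :=
    hφ.integrable.bdd_mul (c := L / (T / 2)) hs.aestronglyMeasurable (ae_of_all _ hsb)
  have hv := hC _ _ hψ h0 fun z => by
    have h1 := timeStep_nonneg ε z.1
    have h2 := timeStep_le_one ε z.1
    have h3 := timeStep_nonneg (T / 2) (T - z.1)
    have h4 := timeStep_le_one (T / 2) (T - z.1)
    have h5 := mul_nonneg h1 h3
    have h6 := mul_le_one₀ h2 h3 h4
    simp only [norm_zero]
    nlinarith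
  have e : ∀ z : ℝ × E d, φ z * (dt (fun z : ℝ × E d =>
      -(timeStep ε z.1 * timeStep (T / 2) (T - z.1))) z + divx (fun _ => (0 : E d)) z)
      = timeStep ε z.1 * timeKernel (T / 2) (T - z.1) * φ z - timeKernel ε z.1 * φ z := by
    intro z
    have : divx (fun _ => (0 : E d)) z = 0 := by simp [divx]
    rw [dt, (hder z).deriv, this]
    ring
  simp only [e] at hv
  rw [integral_sub i2 i1] at hv
  have hb : |∫ z in spaceTime d T, timeStep ε z.1 * timeKernel (T / 2) (T - z.1) * φ z|
      ≤ L / (T / 2) * ∫ z in spaceTime d T, ‖φ z‖ := by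
    rw [← integral_const_mul]
    refine (norm_integral_le_integral_norm _).trans
      (integral_mono i2.norm (hφ.integrable.norm.const_mul _) fun z => ?_)
    simp only [norm_mul (_ * _) (φ z)]
    exact mul_le_mul_of_nonneg_right (hsb z) (norm_nonneg _)
  linarith [(abs_le.1 hb).1]

/-- Averages of the extension of a relaxed competitor converge at time `0` to its initial trace. -/
lemma tendsto_avg_initialTrace {T p r q : ℝ} (hT : 0 < T) (hp : 1 ≤ p) {H : E d → E d → ℝ}
    (hH : HamiltonianAssumption q r H) {φT : E d → ℝ} (hper : TorusPeriodic φT)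
    (hc : ContDiff ℝ 1 φT) {w : (ℝ × E d → ℝ) × (ℝ × E d → ℝ)} (hw : w ∈ K T p r H φT) :
    IntegrableOn (initialTrace w.1) (unitCell d) ∧
    Tendsto (fun η => ∫⁻ x in unitCell d,
      edist (avg η (extend T w.1 φT) (0, x)) (initialTrace w.1 x)) (𝓝[>] (0 : ℝ)) (𝓝 0) := by
  obtain ⟨hφ, hα, htr, G, hG, hgrad, hsub⟩ := hw
  have hW := weakSubsolution_extend hT hp hH hper hc hφ hα htr hG hgrad hsub
  obtain ⟨c, hlow⟩ := hφ.exists_le_integral_timeKernel hT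
  have hlow' : ∀ᶠ ε in 𝓝[>] (0 : ℝ), c ≤ ∫ z, timeKernel ε z.1 * extend T w.1 φT z ∂cyl d := by
    filter_upwards [Ioo_mem_nhdsGT (half_pos hT)] with ε hε
    refine (hlow ε hε).trans (le_of_eq ?_)
    rw [← setIntegral_spaceTime_eq (T := T)]
    · refine setIntegral_congr_fun (measurableSet_spaceTime T) fun z hz => ?_
      simp only [extend_of_mem hz.1]
    · intro z hz
      rw [timeKernel_eq_zero hε.1 fun h => hz
        ⟨(half_pos hε.1).trans_le h.1, h.2.trans_lt (by linarith [hε.2])⟩, zero_mul]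
  obtain ⟨g, hg, hlim⟩ := hW.exists_trace (by linarith) hH hlow'
  have hg' : IsTraceRight w.1 0 g := by
    refine ⟨hg.1, hg.2.1, hg.2.2.congr' ?_⟩
    filter_upwards [Ioo_mem_nhdsGT hT] with s hs
    congr 1
    refine setLIntegral_congr_fun (measurableSet_Ioo.prod measurableSet_unitCell) fun z hz => ?_
    rw [extend_of_mem (show z.1 ∈ Ioo 0 T from ⟨hz.1.1, hz.1.2.trans (by linarith [hs.2])⟩)]
  have hφm : AEStronglyMeasurable w.1 (volume.restrict (spaceTime d T)) := hφ.integrable.1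
  have hspec := initialTrace_spec hg'
  refine ⟨hspec.2.1, hlim.congr fun η => ?_⟩
  refine lintegral_congr_ae ?_
  filter_upwards [IsTraceRight.ae_eq hT hφm hg' hspec] with x hx
  rw [hx]

end MFG

namespace MFG

/-! ### Smooth competitors built from relaxed ones -/

variable {d : ℕ}

/-- At the terminal time, averages of an extended function are close to the continuation. -/
lemma norm_avg_extend_sub_le {V : Type*} [NormedAddCommGroup V] [NormedSpace ℝ V] [CompleteSpace V]
    {T : ℝ} (hT : 0 < T) {v : ℝ × E d → V} {g : E d → V} (hv : SpacePeriodic v)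
    (hvi : IntegrableOn v (spaceTime d T)) (hg : TorusPeriodic g) (hc : Continuous g) {ε δ : ℝ}
    (hε : 0 < ε) (hε1 : ε < 1)
    (hδ : ∀ x y : E d, NearLattice ε y → ‖g (x + y) - g x‖ ≤ δ) (x : E d) :
    ‖avg ε (extend T v g) (T, x) - g x‖ ≤ δ := by
  have hprob := isProbabilityMeasure_mollifier (d := d) hε hε1.le
  have hi := integrable_mollifier_add hε (extend_periodic hv hg) (integrable_extend hvi hg hc) (T, x)
  have e : avg ε (extend T v g) (T, x) - g x
      = ∫ w, (extend T v g ((T, x) + w) - g x) ∂mollifier d ε := by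
    rw [integral_sub hi (integrable_const _)]
    simp [avg]
  rw [e]
  have : ∀ᵐ w ∂mollifier d ε, ‖extend T v g ((T, x) + w) - g x‖ ≤ δ := by
    filter_upwards [ae_mollifier hε] with w hw
    rw [extend_of_ge hT (z := (T, x) + w)]
    · exact hδ x w.2 hw.2
    · have h1 := hw.1.1
      have h2 := hw.1.2
      constructor <;> simp only [Prod.fst_add] <;> linarith
  refine (norm_integral_le_of_norm_le_const this).trans ?_
  simp

/-- The average of `u` at scale `ε`, damped by the factor `1 - l` and corrected by a
time-independent term so as to take the value `φT` at time `T`. -/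
noncomputable def competitor (T l ε : ℝ) (u : ℝ × E d → ℝ) (φT : E d → ℝ) (z : ℝ × E d) : ℝ :=
  (1 - l) * avg ε u z + (φT z.2 - (1 - l) * avg ε u (T, z.2))

lemma competitor_mem_K0 {T l ε : ℝ} (hε : 0 < ε) {u : ℝ × E d → ℝ} (hu : SpacePeriodic u)
    (hi : Integrable u (cyl d)) {φT : E d → ℝ} (hp : TorusPeriodic φT) (hc : ContDiff ℝ 1 φT) :
    competitor T l ε u φT ∈ K0 T φT := by
  have hU := contDiff_avg hε hu hi
  refine ⟨fun t k x => ?_, ContDiff.contDiffOn ?_, fun x => ?_⟩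
  · have h1 := avg_periodic ε hu t k x
    have h2 := avg_periodic ε hu T k x
    simp only at h1 h2
    simp only [competitor, h1, h2, hp k x]
  · exact (contDiff_const.mul hU).add ((hc.comp contDiff_snd).sub
      (contDiff_const.mul (hU.comp (contDiff_const.prodMk contDiff_snd))))
  · simp [competitor]

lemma dt_competitor {T l ε : ℝ} (hε : 0 < ε) {u : ℝ × E d → ℝ} (hu : SpacePeriodic u)
    (hi : Integrable u (cyl d)) (φT : E d → ℝ) (z : ℝ × E d) :
    dt (competitor T l ε u φT) z = (1 - l) * dt (avg ε u) z := by
  have hU := (contDiff_avg hε hu hi).differentiable (by simp) z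
  have h := ((hasDerivAt_slice hU).const_mul (1 - l)).add_const
    (φT z.2 - (1 - l) * avg ε u (T, z.2))
  rw [dt_eq hU]
  exact h.deriv

lemma Dx_competitor {T l ε : ℝ} (hε : 0 < ε) {u : ℝ × E d → ℝ} (hu : SpacePeriodic u)
    (hi : Integrable u (cyl d)) {φT : E d → ℝ} (hc : ContDiff ℝ 1 φT) (z : ℝ × E d) :
    Dx (competitor T l ε u φT) z = (1 - l) • Dx (avg ε u) z
      + (gradient φT z.2 - (1 - l) • Dx (avg ε u) (T, z.2)) := by
  have hU := (contDiff_avg hε hu hi).differentiable (by simp)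
  have h1 := hasFDerivAt_space_slice (hU z)
  have h2 := hasFDerivAt_space_slice (hU (T, z.2))
  have h3 := (hc.differentiable (by simp) z.2).hasFDerivAt
  have h := (h1.const_mul (1 - l)).add (h3.sub (h2.const_mul (1 - l)))
  have h' : HasFDerivAt (fun x => competitor T l ε u φT (z.1, x)) _ z.2 := h
  rw [Dx, gradient, h'.fderiv, Dx_eq (hU z), Dx_eq (hU (T, z.2)), spaceGrad, spaceGrad, gradient]
  simp only [map_add, map_sub, map_smul]

/-- The competitor is an approximate subsolution. Convexity of `H` absorbs the correction of the
terminal value into a fraction `l` of the gradient. -/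
lemma WeakSubsolution.competitor_le {T q r l ε : ℝ} (hT : 0 < T) {H : E d → E d → ℝ}
    (hH : HamiltonianAssumption q r H) {u : ℝ × E d → ℝ} {G : ℝ × E d → E d}
    {A : ℝ × E d → ℝ} (h : WeakSubsolution (T + 1) H u G A) {φT : E d → ℝ}
    (hc : ContDiff ℝ 1 φT) (hl0 : 0 < l) (hl1 : l < 1) (hε : 0 < ε) (hε1 : ε < 1)
    {R C₁ : ℝ} (hR : ∀ x, ‖gradient φT x‖ ≤ R)
    (hC₁ : ∀ x e, ‖e‖ ≤ R + 1 → H x e ≤ C₁)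
    (hG : ∀ x, ‖avg ε G (T, x) - gradient φT x‖ ≤ l)
    (hHG : ∀ z : ℝ × E d, H z.2 (avg ε G z) ≤ avg ε (fun w => H w.2 (G w)) z + l)
    {z : ℝ × E d} (hz : z.1 ∈ Icc 0 T) :
    - dt (competitor T l ε u φT) z + H z.2 (Dx (competitor T l ε u φT) z)
      ≤ (1 - l) * avg ε A z + l * (1 + C₁) := by
  have h1 := h.dt_avg hH hε hz.1 (by linarith [hz.2])
  rw [dt_competitor hε h.u_per h.u_int, Dx_competitor hε h.u_per h.u_int hc,
    h.Dx_avg hε hz.1 (by linarith [hz.2]),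
    h.Dx_avg hε (z := (T, z.2)) hT.le (by simp only; linarith)]
  set a := avg ε G z
  set b := avg ε G (T, z.2)
  set e : E d := gradient φT z.2 + ((1 - l) / l) • (gradient φT z.2 - b) with he
  have hle : l • e = gradient φT z.2 - (1 - l) • b := by
    rw [he, smul_add, smul_smul, mul_div_cancel₀ _ hl0.ne']
    module
  have hen : ‖e‖ ≤ R + 1 := by
    refine (norm_add_le _ _).trans (add_le_add (hR _) ?_)
    rw [norm_smul, Real.norm_of_nonneg (div_nonneg (by linarith) hl0.le), norm_sub_rev]
    calc (1 - l) / l * ‖b - gradient φT z.2‖ ≤ (1 - l) / l * l :=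
          mul_le_mul_of_nonneg_left (hG _) (div_nonneg (by linarith) hl0.le)
      _ = 1 - l := div_mul_cancel₀ _ hl0.ne'
      _ ≤ 1 := by linarith
  have hconv := (hH.convex z.2).2 (mem_univ a) (mem_univ e) (show 0 ≤ 1 - l by linarith) hl0.le
    (by ring)
  rw [← hle]
  simp only [smul_eq_mul] at hconv
  have h2 := hC₁ z.2 e hen
  have h3 := hHG z
  have h4 : (1 - l) * H z.2 a ≤ (1 - l) * (avg ε (fun w => H w.2 (G w)) z + l) :=
    mul_le_mul_of_nonneg_left h3 (by linarith)
  have h5 : (1 - l) * (-dt (avg ε u) z + avg ε (fun w => H w.2 (G w)) z) ≤ (1 - l) * avg ε A z :=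
    mul_le_mul_of_nonneg_left h1 (by linarith)
  have h6 : l * H z.2 e ≤ l * C₁ := mul_le_mul_of_nonneg_left h2 hl0.le
  nlinarith

/-- The running cost of an approximate subsolution, by convexity of the conjugate. The last
hypothesis bounds the convexity error uniformly in `l`. -/
lemma lintegral_conjPotential_le {p q T l B A C : ℝ} {f : E d → ℝ → ℝ} (hpq : 1 / p + 1 / q = 1)
    (hf : CouplingAssumption q f) (hl0 : 0 < l) (hl1 : l < 1) (hB : 0 ≤ B)
    (hA : 0 < A) (hC : 0 < C)
    (hAC : ∀ x a, (conjPotential f x a).toENNReal ≤ ENNReal.ofReal (A * (|a| + C) ^ p))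
    {α a b : ℝ × E d → ℝ}
    (hm : AEStronglyMeasurable (fun z => a z - α z) (volume.restrict (spaceTime d T)))
    (hb : ∀ z ∈ spaceTime d T, b z ≤ (1 - l) * a z + l * B)
    (hα : ∫⁻ z in spaceTime d T, ‖a z - α z‖ₑ ^ p ≤ ENNReal.ofReal (l ^ p)) :
    ∫⁻ z in spaceTime d T, (conjPotential f z.2 (b z)).toENNReal ≤
      (∫⁻ z in spaceTime d T, (conjPotential f z.2 (α z)).toENNReal)
        + ENNReal.ofReal l * (ENNReal.ofReal A * 2 ^ (p - 1)
          * (1 + ENNReal.ofReal (B + C) ^ p * volume (spaceTime d T))) := by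
  have hp := one_lt_p hf.one_lt_q hpq
  have hp0 : 0 < p := by linarith
  have hlE : ENNReal.ofReal l ≠ 0 := by simpa using hl0
  have hpt : ∀ z ∈ spaceTime d T, (conjPotential f z.2 (b z)).toENNReal ≤
      (conjPotential f z.2 (α z)).toENNReal + ENNReal.ofReal l * (ENNReal.ofReal A * 2 ^ (p - 1)
        * (‖a z - α z‖ₑ ^ p / ENNReal.ofReal (l ^ p) + ENNReal.ofReal (B + C) ^ p)) := by
    intro z hz
    set v := (1 - l) * (a z - α z) / l + B with hv
    have h1 : b z ≤ (1 - l) * α z + l * v := by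
      refine (hb z hz).trans (le_of_eq ?_)
      rw [hv]; field_simp; ring
    refine (EReal.toENNReal_le_toENNReal (conjPotential_mono z.2 h1)).trans
      ((toENNReal_conjPotential_convex hpq hf z.2 (α z) v hl0.le hl1.le).trans ?_)
    refine add_le_add ?_ ?_
    · refine mul_le_of_le_one_left zero_le ?_
      rw [ENNReal.ofReal_le_one]; linarith
    · refine mul_le_mul_right ((hAC z.2 v).trans ?_) _
      rw [ENNReal.ofReal_mul hA.le, mul_assoc]
      refine mul_le_mul_right ?_ _
      have h2 : |v| + C ≤ |a z - α z| / l + (B + C) := by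
        have : |v| ≤ |a z - α z| / l + B := by
          refine (abs_add_le _ _).trans (add_le_add ?_ (abs_of_nonneg hB).le)
          rw [abs_div, abs_mul, abs_of_pos hl0, abs_of_nonneg (show 0 ≤ 1 - l by linarith)]
          exact div_le_div_of_nonneg_right
            (mul_le_of_le_one_left (abs_nonneg _) (by linarith)) hl0.le
        linarith
      rw [← ENNReal.ofReal_rpow_of_nonneg (by positivity) hp0.le]
      calc ENNReal.ofReal (|v| + C) ^ p
          ≤ (ENNReal.ofReal (|a z - α z| / l) + ENNReal.ofReal (B + C)) ^ p := by
            refine ENNReal.rpow_le_rpow ?_ hp0.le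
            rw [← ENNReal.ofReal_add (by positivity) (by positivity)]
            exact ENNReal.ofReal_le_ofReal h2
        _ ≤ 2 ^ (p - 1) * (ENNReal.ofReal (|a z - α z| / l) ^ p + ENNReal.ofReal (B + C) ^ p) :=
            ENNReal.rpow_add_le_mul_rpow_add_rpow _ _ hp.le
        _ = _ := by
            rw [ENNReal.ofReal_div_of_pos hl0, ENNReal.div_rpow_of_nonneg _ _ hp0.le,
              ENNReal.ofReal_rpow_of_pos hl0, ← Real.norm_eq_abs, ofReal_norm]
  refine (setLIntegral_mono' (measurableSet_spaceTime T) hpt).trans ?_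
  rw [lintegral_add_right' _ (((((hm.enorm.pow_const p).div_const _).add_const _).const_mul
    _).const_mul _)]
  refine add_le_add le_rfl ?_
  rw [lintegral_const_mul' _ _ ENNReal.ofReal_ne_top, lintegral_const_mul' _ _
    (ENNReal.mul_ne_top ENNReal.ofReal_ne_top
      (ENNReal.rpow_ne_top_of_nonneg (by linarith) (by simp)))]
  refine mul_le_mul_right (mul_le_mul_right ?_ _) _
  rw [lintegral_add_right' _ aemeasurable_const, setLIntegral_const]
  refine add_le_add ?_ le_rfl
  simp only [div_eq_mul_inv]
  have hlp : ENNReal.ofReal (l ^ p) ≠ 0 := by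
    simpa using Real.rpow_pos_of_pos hl0 p
  rw [lintegral_mul_const' _ _ (ENNReal.inv_ne_top.2 hlp), ← div_eq_mul_inv]
  exact ENNReal.div_le_of_le_mul (by rwa [one_mul])

lemma integral_competitor_ge {T l ε Cφ M : ℝ} (hl0 : 0 < l) (hl1 : l < 1) (hε : 0 < ε)
    {u : ℝ × E d → ℝ} (hu : SpacePeriodic u) (hi : Integrable u (cyl d)) {φT m₀ g : E d → ℝ}
    (hc : Continuous φT) (hm : Continuous m₀) (hCφ : ∀ x, ‖φT x‖ ≤ Cφ) (hM : ∀ x, ‖m₀ x‖ ≤ M)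
    (hg : IntegrableOn g (unitCell d)) (hT : ∀ x, ‖avg ε u (T, x) - φT x‖ ≤ l)
    (h0 : ∫⁻ x in unitCell d, edist (avg ε u (0, x)) (g x) ≤ ENNReal.ofReal l) :
    (∫ x in unitCell d, g x * m₀ x)
      - l * (M * (1 + (∫ x in unitCell d, ‖g x‖) + (Cφ + 1) * volume.real (unitCell d)))
      ≤ ∫ x in unitCell d, competitor T l ε u φT (0, x) * m₀ x := by
  have hfin : IsFiniteMeasure ((volume : Measure (E d)).restrict (unitCell d)) :=
    ⟨by rw [Measure.restrict_apply_univ]; exact volume_unitCell_lt_top⟩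
  have hM0 : 0 ≤ M := (norm_nonneg _).trans (hM 0)
  have hU := continuous_avg hε hu hi
  have hslice : ∀ s : ℝ, Continuous fun x : E d => avg ε u (s, x) := fun s =>
    hU.comp (continuous_const.prodMk continuous_id)
  have i0 : IntegrableOn (fun x => avg ε u (0, x)) (unitCell d) :=
    integrableOn_unitCell_of_continuous (hslice 0)
  have hcomp : Continuous fun x => competitor T l ε u φT (0, x) :=
    (continuous_const.mul (hslice 0)).add (hc.sub (continuous_const.mul (hslice T)))
  have i1 : IntegrableOn (fun x => competitor T l ε u φT (0, x) * m₀ x) (unitCell d) :=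
    integrableOn_unitCell_of_continuous (hcomp.mul hm)
  have i2 : IntegrableOn (fun x => g x * m₀ x) (unitCell d) :=
    Integrable.mul_bdd hg hm.aestronglyMeasurable (ae_of_all _ hM)
  have id : IntegrableOn (fun x => ‖avg ε u (0, x) - g x‖) (unitCell d) := (i0.sub hg).norm
  have ig : IntegrableOn (fun x => l * ‖g x‖) (unitCell d) := hg.norm.const_mul l
  have idg : IntegrableOn (fun x => ‖avg ε u (0, x) - g x‖ + l * ‖g x‖) (unitCell d) := id.add ig
  have hdist : ∫ x in unitCell d, ‖avg ε u (0, x) - g x‖ ≤ l := by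
    refine (integral_norm_eq_lintegral_enorm (i0.sub hg).1).trans_le ?_
    refine ENNReal.toReal_le_of_le_ofReal hl0.le ?_
    simpa only [edist_eq_enorm_sub] using! h0
  have hpt : ∀ x, g x * m₀ x - competitor T l ε u φT (0, x) * m₀ x
      ≤ (‖avg ε u (0, x) - g x‖ + l * ‖g x‖ + l * (Cφ + 1)) * M := by
    intro x
    have h1 : |g x - competitor T l ε u φT (0, x)|
        ≤ ‖avg ε u (0, x) - g x‖ + l * ‖g x‖ + l * (Cφ + 1) := by
      have e : g x - competitor T l ε u φT (0, x) = -((1 - l) * (avg ε u (0, x) - g x))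
          + (l * g x) + (-(l * φT x) + (1 - l) * (avg ε u (T, x) - φT x)) := by
        simp only [competitor]; ring
      rw [e]
      refine (abs_add_le _ _).trans (add_le_add ((abs_add_le _ _).trans (add_le_add ?_ ?_)) ?_)
      · rw [abs_neg, abs_mul, abs_of_nonneg (show 0 ≤ 1 - l by linarith)]
        exact mul_le_of_le_one_left (abs_nonneg _) (by linarith)
      · rw [abs_mul, abs_of_pos hl0]; rfl
      · refine (abs_add_le _ _).trans ?_
        rw [abs_neg, abs_mul, abs_mul, abs_of_pos hl0, abs_of_nonneg (show 0 ≤ 1 - l by linarith),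
          mul_add, mul_one]
        refine add_le_add (mul_le_mul_of_nonneg_left (hCφ x) hl0.le) ?_
        exact (mul_le_of_le_one_left (abs_nonneg _) (by linarith)).trans (hT x)
    rw [← sub_mul]
    refine (le_abs_self _).trans ?_
    rw [abs_mul]
    exact mul_le_mul h1 (hM x) (abs_nonneg _) ((abs_nonneg _).trans h1)
  have hint := integral_mono (i2.sub i1) ((idg.add (integrable_const (l * (Cφ + 1)))).mul_const M) hpt
  have e1 : ∫ x in unitCell d, (g x * m₀ x - competitor T l ε u φT (0, x) * m₀ x)
      = (∫ x in unitCell d, g x * m₀ x) - ∫ x in unitCell d, competitor T l ε u φT (0, x) * m₀ x :=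
    integral_sub i2 i1
  have e2 : ∫ x in unitCell d, (‖avg ε u (0, x) - g x‖ + l * ‖g x‖ + l * (Cφ + 1)) * M
      = ((∫ x in unitCell d, ‖avg ε u (0, x) - g x‖) + l * (∫ x in unitCell d, ‖g x‖)
        + volume.real (unitCell d) * (l * (Cφ + 1))) * M := by
    rw [integral_mul_const, integral_add idg (integrable_const _), integral_add id ig,
      integral_const_mul, setIntegral_const, smul_eq_mul]
  have h3 := mul_le_mul_of_nonneg_right hdist hM0
  have h4 : (∫ x in unitCell d, (g x * m₀ x - competitor T l ε u φT (0, x) * m₀ x))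
    ≤ ∫ x in unitCell d, (‖avg ε u (0, x) - g x‖ + l * ‖g x‖ + l * (Cφ + 1)) * M := hint
  rw [e1, e2] at h4
  nlinarith

/-- Every relaxed competitor is approximated by smooth ones, with an error linear in `l`. -/
lemma exists_smoothCost_le {T p q r : ℝ} (hT : 0 < T) (hpq : 1 / p + 1 / q = 1)
    {f : E d → ℝ → ℝ} {H : E d → E d → ℝ} {φT m₀ : E d → ℝ} (hf : CouplingAssumption q f)
    (hH : HamiltonianAssumption q r H) (hb : BoundaryAssumption φT m₀)
    {w : (ℝ × E d → ℝ) × (ℝ × E d → ℝ)} (hw : w ∈ K T p r H φT) :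
    ∃ M : ℝ≥0∞, M ≠ ⊤ ∧ ∃ N : ℝ, ∀ l, 0 < l → l < 1 → ∃ φ ∈ K0 T φT,
      ∫⁻ z in spaceTime d T, (conjPotential f z.2 (- dt φ z + H z.2 (Dx φ z))).toENNReal
        ≤ (∫⁻ z in spaceTime d T, (conjPotential f z.2 (w.2 z)).toENNReal)
          + ENNReal.ofReal l * M ∧
      (∫ x in unitCell d, initialTrace w.1 x * m₀ x) - l * N
        ≤ ∫ x in unitCell d, φ (0, x) * m₀ x := by
  have hp := one_lt_p hf.one_lt_q hpq
  have hp0 : 0 < p := by linarith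
  have hr := hH.r_pos
  have hper := hb.terminal_periodic
  have hc := hb.terminal_contDiff
  obtain ⟨hgi, hlim⟩ := tendsto_avg_initialTrace hT hp.le hH hper hc hw
  obtain ⟨hφ, hα, htr, G, hG, hgrad, hsub⟩ := hw
  have hW := weakSubsolution_extend hT hp.le hH hper hc hφ hα htr hG hgrad hsub
  have hgp : TorusPeriodic (gradient φT) := gradient_periodic hper
  have hgc : Continuous (gradient φT) := continuous_gradient hc
  have hHp : TorusPeriodic fun x => H x (gradient φT x) := fun k x => by
    simp only [hgp k x]
    exact hH.periodic _ k x
  have hHc : Continuous fun x => H x (gradient φT x) := hH.continuous.comp (continuous_id.prodMk hgc)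
  have hGr : Integrable (fun z => ‖extend T G (gradient φT) z‖ ^ r) (cyl d) := by
    have := (memLp_extend hG.2 hgp hgc).integrable_norm_rpow (by simp; linarith)
      ENNReal.ofReal_ne_top
    rwa [ENNReal.toReal_ofReal (by linarith)] at this
  have hAp := memLp_extend hα.2 hHp hHc
  obtain ⟨κ, hκ, CH, hCH0, hCH⟩ := exists_hamiltonian_avg_le hH hW.G_per hW.G_int hGr
  obtain ⟨A, C, hA, hC, hAC⟩ := exists_toENNReal_conjPotential_le hpq hf
  obtain ⟨R, hR0, hR⟩ := hgp.exists_bound hgc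
  obtain ⟨Ch, hCh0, hCh⟩ := hH.exists_abs_le
  obtain ⟨Cφ, hCφ0, hCφ⟩ := hper.exists_bound hc.continuous
  obtain ⟨M, hM0, hM⟩ := hb.initial_periodic.exists_bound hb.initial_continuous
  set C₁ := Ch * (R + 1) ^ r + Ch with hC₁
  have hC₁0 : 0 ≤ C₁ := by positivity
  have hC₁b : ∀ x e, ‖e‖ ≤ R + 1 → H x e ≤ C₁ := by
    intro x e he
    refine (le_abs_self _).trans ((hCh x e).trans ?_)
    rw [hC₁]
    gcongr
  refine ⟨ENNReal.ofReal A * 2 ^ (p - 1)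
      * (1 + ENNReal.ofReal (1 + C₁ + C) ^ p * volume (spaceTime d T)), ?_, M * (1 + (∫ x in unitCell d, ‖initialTrace w.1 x‖)
    + (Cφ + 1) * volume.real (unitCell d)), fun l hl0 hl1 => ?_⟩
  · refine ENNReal.mul_ne_top (ENNReal.mul_ne_top ENNReal.ofReal_ne_top
      (ENNReal.rpow_ne_top_of_nonneg (by linarith) (by simp))) (ENNReal.add_ne_top.2
      ⟨ENNReal.one_ne_top, ENNReal.mul_ne_top (ENNReal.rpow_ne_top_of_nonneg hp0.le
        ENNReal.ofReal_ne_top) (volume_spaceTime_lt_top T).ne⟩)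
  obtain ⟨ε₁, hε₁, hu1⟩ := hgp.uniform hgc hl0
  obtain ⟨ε₂, hε₂, hu2⟩ := hper.uniform hc.continuous hl0
  obtain ⟨ε₃, hε₃, hu3⟩ := exists_lintegral_avg_sub_le hp.le hW.A_per hW.A_int hAp
    (Real.rpow_pos_of_pos hl0 p)
  have hκlim : Tendsto (fun ε : ℝ => CH * ε ^ κ) (𝓝[>] 0) (𝓝 0) := by
    have h1 : Tendsto (fun ε : ℝ => ε ^ κ) (𝓝[>] 0) (𝓝 ((0 : ℝ) ^ κ)) :=
      (Real.continuousAt_rpow_const 0 κ (Or.inr hκ.le)).tendsto.mono_left nhdsWithin_le_nhds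
    rw [Real.zero_rpow hκ.ne'] at h1
    simpa using h1.const_mul CH
  have hlE : 0 < ENNReal.ofReal l := ENNReal.ofReal_pos.2 hl0
  have hev : ∀ᶠ ε in 𝓝[>] (0 : ℝ), ε ∈ Ioo 0 (min 1 (min ε₁ (min ε₂ ε₃))) :=
    Ioo_mem_nhdsGT (lt_min one_pos (lt_min hε₁ (lt_min hε₂ hε₃)))
  obtain ⟨ε, ⟨hε, hε'⟩, hεκ, hεg⟩ := (hev.and ((hκlim.eventually_le_const hl0).and
      (hlim.eventually_le_const hlE))).exists
  simp only [lt_min_iff] at hε'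
  obtain ⟨hε1, he1, he2, he3⟩ := hε'
  refine ⟨competitor T l ε (extend T w.1 φT) φT,
    competitor_mem_K0 hε hW.u_per hW.u_int hper hc, ?_, ?_⟩
  · refine lintegral_conjPotential_le hpq hf hl0 hl1 (by linarith) hA hC hAC
      (a := avg ε (extend T w.2 fun x => H x (gradient φT x))) ?_ ?_ ?_
    · exact (continuous_avg hε hW.A_per hW.A_int).aestronglyMeasurable.sub hα.2.1
    · intro z hz
      refine hW.competitor_le hT hH hc hl0 hl1 hε hε1 hR hC₁b (fun x => ?_) (fun z => ?_)
        (Ioo_subset_Icc_self hz.1)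
      · refine norm_avg_extend_sub_le hT hG.1 (hG.integrableOn hr.le) hgp hgc hε hε1
          (fun x y hy => hu1 x y ?_) x
        exact hy.imp fun k hk => hk.trans he1.le
      · exact (hCH ε hε hε1.le z).trans (add_le_add le_rfl hεκ)
    · refine le_trans ?_ (hu3 ε hε hε1.le he3.le)
      rw [setLIntegral_congr_fun (measurableSet_spaceTime T) (g := fun z =>
        ‖avg ε (extend T w.2 fun x => H x (gradient φT x)) z
          - extend T w.2 (fun x => H x (gradient φT x)) z‖ₑ ^ p)
        fun z hz => by simp only [extend_of_mem hz.1], volume_restrict_spaceTime]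
      exact setLIntegral_le_lintegral _ _
  · refine integral_competitor_ge hl0 hl1 hε hW.u_per hW.u_int hc.continuous hb.initial_continuous
      hCφ hM hgi (fun x => ?_) hεg
    refine norm_avg_extend_sub_le hT hφ.periodic hφ.integrable hper hc.continuous hε hε1
          (fun x y hy => hu2 x y ?_) x
    exact hy.imp fun k hk => hk.trans he2.le

lemma iInf_smoothCost_le {T p q r : ℝ} (hT : 0 < T) (hpq : 1 / p + 1 / q = 1)
    {f : E d → ℝ → ℝ} {H : E d → E d → ℝ} {φT m₀ : E d → ℝ} (hf : CouplingAssumption q f)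
    (hH : HamiltonianAssumption q r H) (hb : BoundaryAssumption φT m₀) :
    (⨅ φ ∈ K0 T φT, smoothCost T f H m₀ φ) ≤ ⨅ w ∈ K T p r H φT, relaxedCost T f m₀ w := by
  refine le_iInf₂ fun w hw => ?_
  obtain ⟨M, hM, N, h⟩ := exists_smoothCost_le hT hpq hf hH hb hw
  simp only [relaxedCost, cost]
  generalize (∫⁻ z in spaceTime d T, (conjPotential f z.2 (w.2 z)).toENNReal) = I at h ⊢
  set J := ∫ x in unitCell d, initialTrace w.1 x * m₀ x with hJ
  rcases eq_or_ne I ⊤ with hIt | hIt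
  · rw [hIt, EReal.coe_ennreal_top, EReal.top_sub_coe]
    exact le_top
  lift I to NNReal using hIt
  lift M to NNReal using hM
  have hle : ∀ l ∈ Ioo (0 : ℝ) 1, (⨅ φ ∈ K0 T φT, smoothCost T f H m₀ φ)
      ≤ ((I + l * M - (J - l * N) : ℝ) : EReal) := by
    intro l hl
    obtain ⟨φ, hφ, h1, h2⟩ := h l hl.1 hl.2
    refine iInf₂_le_of_le φ hφ ?_
    rw [smoothCost, cost, EReal.coe_sub]
    refine EReal.sub_le_sub ?_ (by exact_mod_cast h2)
    refine (EReal.coe_ennreal_le_coe_ennreal_iff.2 h1).trans (le_of_eq ?_)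
    have e : (I : ℝ≥0∞) + ENNReal.ofReal l * M = ENNReal.ofReal (I + l * M) := by
      rw [ENNReal.ofReal_add I.coe_nonneg (mul_nonneg hl.1.le M.coe_nonneg),
        ENNReal.ofReal_mul hl.1.le, ENNReal.ofReal_coe_nnreal, ENNReal.ofReal_coe_nnreal]
    rw [e, EReal.coe_ennreal_ofReal, max_eq_left]
    exact add_nonneg I.coe_nonneg (mul_nonneg hl.1.le M.coe_nonneg)
  have hlim : Tendsto (fun l : ℝ => ((I + l * M - (J - l * N) : ℝ) : EReal)) (𝓝[>] 0)
      (𝓝 ((I + 0 * M - (J - 0 * N) : ℝ) : EReal)) := by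
    refine (continuous_coe_real_ereal.tendsto _).comp ?_
    have : Continuous fun l : ℝ => (I + l * M - (J - l * N) : ℝ) := by fun_prop
    exact this.continuousWithinAt
  have hfinal := ge_of_tendsto hlim (by
    filter_upwards [Ioo_mem_nhdsGT one_pos] with l hl using hle l hl)
  refine hfinal.trans (le_of_eq ?_)
  rw [zero_mul, zero_mul, add_zero, sub_zero, EReal.coe_sub]
  rfl

end MFG

theorem proposition3p1 {d : ℕ} (T p q r : ℝ) (hT : 0 < T) (hpq : 1 / p + 1 / q = 1)
    (f : MFG.E d → ℝ → ℝ) (H : MFG.E d → MFG.E d → ℝ) (φT m₀ : MFG.E d → ℝ)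
    (hf : MFG.CouplingAssumption q f) (hH : MFG.HamiltonianAssumption q r H)
    (hb : MFG.BoundaryAssumption φT m₀) :
    (⨅ φ ∈ MFG.K0 T φT, MFG.smoothCost T f H m₀ φ) =
      (⨅ w ∈ MFG.K T p r H φT, MFG.relaxedCost T f m₀ w) := by
  exact le_antisymm (MFG.iInf_smoothCost_le hT hpq hf hH hb) (MFG.iInf_relaxedCost_le hT hH hb)
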